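/- Let $N\ge 2$, let $\Omega\subseteq\mathbb R^N$ be a bounded domain with Lipschitz boundary, write $C_+(\overline\Omega)=\{h\in C(\overline\Omega): h(x)>1 \text{ for all } x\in\overline\Omega\}$ and $h_-=\min_{\overline\Omega}h$, and assume the following. **(H)** $0\le\mu\in L^\infty(\Omega)$ and $p,q\in C_+(\overline\Omega)$ satisfy $p(x)<N$ and $p(x)<q(x)<p^*(x):=\frac{Np(x)}{N-p(x)}$ for all $x\in\overline\Omega$. **H(f)** $f\colon\Omega\times\mathbb R\times\mathbb R^N\to\mathbb R$ is a Carathéodory function ($f(\cdot,s,\xi)$ is measurable for all $(s,\xi)$, and $f(x,\cdot,\cdot)$ is continuous for a.a. $x\in\Omega$), $f(\cdot,0,0)$ is not a.e. zero, and: (i) there are $r\in C_+(\overline\Omega)$ with $r(x)<p^*(x)$ for all $x\in\overline\Omega$, $\alpha\in L^{\frac{r(\cdot)}{r(\cdot)-1}}(\Omega)$ and $a_1,a_2\ge 0$ such that $$|f(x,s,\xi)|\le a_1|\xi|^{p(x)\frac{r(x)-1}{r(x)}}+a_2|s|^{r(x)-1}+\alpha(x)$$ for a.a. $x\in\Omega$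 and all $s\in\mathbb R$, $\xi\in\mathbb R^N$; (ii) there are $\omega\in L^1(\Omega)$ and $b_1,b_2\ge 0$ with $1-b_1-b_2\lambda_{1,p_-}^{-1}>0$ such that $$f(x,s,\xi)\,s\le b_1|\xi|^{p(x)}+b_2|s|^{p_-}+\omega(x)$$ for a.a. $x\in\Omega$ and all $s\in\mathbb R$, $\xi\in\mathbb R^N$. Here, for $1<t<\infty$, $\lambda_{1,t}$ denotes the first (smallest) eigenvalue of the Dirichlet problem $-\Delta_t u=\lambda|u|^{t-2}u$ in $\Omega$, $u=0$ on $\partial\Omega$, understood weakly in $W^{1,t}_0(\Omega)$. **(U1)** There is $c_1\ge 0$ with $(f(x,s,\xi)-f(x,t,\xi))(s-t)\le c_1|s-t|^2$ for a.a. $x\in\Omega$ and all $s,t\in\mathbb R$, $\xi\in\mathbb R^N$. **(U2)** There are $r\in C_+(\overline\Omega)$ with $r(x)<p^*(x)$ for all $x\in\overline\Omega$, $\rho\in L^{\frac{r(\cdot)}{r(\cdot)-1}}(\Omega)$ and $c_2\ge 0$ such that, for a.a. $x\in\Omega$ and all $s\in\mathbb R$, the map $\xi\mapsto f(x,s,\xi)-\rho(x)$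 is linear and $|f(x,s,\xi)-\rho(x)|\le c_2|\xi|$ for all $\xi\in\mathbb R^N$; moreover $$c_1\lambda_{1,2}^{-1}+c_2\lambda_{1,2}^{-1/2}<1 .$$ Let $\mathcal H(x,t)=t^{p(x)}+\mu(x)t^{q(x)}$, let $L^{\mathcal H}(\Omega)$ be the space of measurable $u$ with $\int_\Omega\mathcal H(x,|u|)\,dx<\infty$, normed by $\|u\|_{\mathcal H}=\inf\{\tau>0:\int_\Omega\mathcal H(x,|u|/\tau)\,dx\le1\}$, let $W^{1,\mathcal H}(\Omega)=\{u\in L^{\mathcal H}(\Omega):|\nabla u|\in L^{\mathcal H}(\Omega)\}$ with norm $\|u\|_{\mathcal H}+\|\,|\nabla u|\,\|_{\mathcal H}$ ($\nabla u$ the weak gradient), and let $W^{1,\mathcal H}_0(\Omega)$ be the closure of $C_0^\infty(\Omega)$ in $W^{1,\mathcal H}(\Omega)$. **Theorem.** If (H), H(f), (U1) and (U2) hold and $p(x)=2$ for all $x\in\overline\Omega$, then the problem $$-\operatorname{div}\big(|\nabla u|^{p(x)-2}\nabla u+\mu(x)|\nabla u|^{q(x)-2}\nabla u\big)=f(x,u,\nabla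 u)\ \text{ in }\Omega,\qquad u=0\ \text{ on }\partial\Omega,$$ has exactly one weak solution, that is, there is exactly one $u\in W^{1,\mathcal H}_0(\Omega)$ (functions agreeing a.e. being identified) such that $$\int_\Omega\big(|\nabla u|^{p(x)-2}\nabla u+\mu(x)|\nabla u|^{q(x)-2}\nabla u\big)\cdot\nabla\varphi\,dx=\int_\Omega f(x,u,\nabla u)\,\varphi\,dx\qquad\text{for all }\varphi\in W^{1,\mathcal H}_0(\Omega),$$ both integrals being absolutely convergent. -/

import Mathlib

open MeasureTheory Filter Topology
open scoped ENNReal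

noncomputable section

namespace DoublePhase

/-- The space `ℝ^N` with the Euclidean norm. -/
abbrev Space (N : ℕ) : Type := EuclideanSpace ℝ (Fin N)

/-- `Ω` has a Lipschitz boundary: near each boundary point, after choosing a unit vector `e` as the
vertical direction, `Ω` is the set above the graph of a Lipschitz function `γ` of the horizontal
component `x - ⟪e, x⟫ e`. -/
def HasLipschitzBoundary {N : ℕ} (Ω : Set (Space N)) : Prop :=
  ∀ x₀ ∈ frontier Ω, ∃ (δ : ℝ) (e : Space N) (K : NNReal) (γ : Space N → ℝ),
    0 < δ ∧ ‖e‖ = 1 ∧ LipschitzWith K γ ∧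
      ∀ x ∈ Metric.ball x₀ δ, x ∈ Ω ↔ γ (x - inner ℝ e x • e) < inner ℝ e x

/-- A bounded domain with Lipschitz boundary. -/
structure IsBoundedLipschitzDomain {N : ℕ} (Ω : Set (Space N)) : Prop where
  isOpen : IsOpen Ω
  isConnected : IsConnected Ω
  isBounded : Bornology.IsBounded Ω
  lipschitz : HasLipschitzBoundary Ω

/-- The class `C₊(closure Ω)` of continuous functions on `closure Ω` with values in `(1, ∞)`. -/
def MemCPlus {N : ℕ} (Ω : Set (Space N)) (h : Space N → ℝ) : Prop :=
  ContinuousOn h (closure Ω) ∧ ∀ x ∈ closure Ω, 1 < h x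

/-- The minimum `h₋` of `h` over `closure Ω`. -/
def minExponent {N : ℕ} (Ω : Set (Space N)) (h : Space N → ℝ) : ℝ :=
  sInf (h '' closure Ω)

/-- The critical Sobolev exponent `p*(x) = N p(x) / (N - p(x))`, used for `p(x) < N`. -/
def criticalExponent {N : ℕ} (p : Space N → ℝ) (x : Space N) : ℝ :=
  N * p x / (N - p x)

/-- The integrand `t ↦ t ^ r(x)` of the variable exponent Lebesgue space. -/
def powerFn {N : ℕ} (r : Space N → ℝ) (x : Space N) (t : ℝ) : ℝ :=
  t ^ r x

/-- The double phase integrand `H(x, t) = t ^ p(x) + μ(x) t ^ q(x)`. -/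
def doublePhaseFn {N : ℕ} (p q μ : Space N → ℝ) (x : Space N) (t : ℝ) : ℝ :=
  t ^ p x + μ x * t ^ q x

/-- The modular `∫_Ω Φ(x, |u|) dx`, with values in `[0, ∞]`. -/
def modular {N : ℕ} {F : Type*} [NormedAddCommGroup F] (Ω : Set (Space N))
    (Φ : Space N → ℝ → ℝ) (u : Space N → F) : ℝ≥0∞ :=
  ∫⁻ x in Ω, ENNReal.ofReal (Φ x ‖u x‖)

/-- Membership in the Musielak-Orlicz space `L^Φ(Ω)` (for `Φ` satisfying the `Δ₂`-condition):
measurable functions of finite modular. For a vector field this means `|u| ∈ L^Φ(Ω)`. -/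
def MemL {N : ℕ} {F : Type*} [NormedAddCommGroup F] (Ω : Set (Space N))
    (Φ : Space N → ℝ → ℝ) (u : Space N → F) : Prop :=
  AEStronglyMeasurable u (volume.restrict Ω) ∧ modular Ω Φ u < ∞

/-- The Luxemburg norm `inf {τ > 0 : ∫_Ω Φ(x, |u| / τ) dx ≤ 1}`, with values in `[0, ∞]`. -/
def luxemburgNorm {N : ℕ} {F : Type*} [NormedAddCommGroup F] [NormedSpace ℝ F]
    (Ω : Set (Space N)) (Φ : Space N → ℝ → ℝ) (u : Space N → F) : ℝ≥0∞ :=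
  ⨅ (τ : ℝ) (_ : 0 < τ) (_ : modular Ω Φ (fun x => τ⁻¹ • u x) ≤ 1), ENNReal.ofReal τ

/-- The class `C_0^∞(Ω)` of smooth functions with compact support in `Ω`. -/
def IsTestFunction {N : ℕ} (Ω : Set (Space N)) (φ : Space N → ℝ) : Prop :=
  ContDiff ℝ (⊤ : ℕ∞) φ ∧ HasCompactSupport φ ∧ tsupport φ ⊆ Ω

/-- `v` is a weak gradient of `u` in `Ω`. -/
def HasWeakGradient {N : ℕ} (Ω : Set (Space N)) (u : Space N → ℝ) (v : Space N → Space N) :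
    Prop :=
  LocallyIntegrableOn u Ω ∧ LocallyIntegrableOn v Ω ∧
    ∀ φ : Space N → ℝ, IsTestFunction Ω φ →
      ∫ x in Ω, u x • gradient φ x = - ∫ x in Ω, φ x • v x

open Classical in
/-- The weak gradient `∇u` in `Ω` (determined up to a null set when it exists, and `0` if
there is none). -/
def weakGrad {N : ℕ} (Ω : Set (Space N)) (u : Space N → ℝ) : Space N → Space N :=
  if h : ∃ v, HasWeakGradient Ω u v then h.choose else 0

/-- Membership in the Musielak-Orlicz Sobolev space `W^{1,Φ}(Ω)`. -/
structure MemW {N : ℕ} (Ω : Set (Space N)) (Φ : Space N → ℝ → ℝ) (u : Space N → ℝ) : Prop where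
  memL : MemL Ω Φ u
  hasWeakGradient : ∃ v, HasWeakGradient Ω u v
  memL_grad : MemL Ω Φ (weakGrad Ω u)

/-- Membership in `W_0^{1,Φ}(Ω)`, the closure of `C_0^∞(Ω)` in `W^{1,Φ}(Ω)` with respect to the
norm `‖u‖_Φ + ‖∇u‖_Φ`. -/
def MemWZero {N : ℕ} (Ω : Set (Space N)) (Φ : Space N → ℝ → ℝ) (u : Space N → ℝ) : Prop :=
  MemW Ω Φ u ∧ ∃ φ : ℕ → Space N → ℝ, (∀ n, IsTestFunction Ω (φ n)) ∧
    Tendsto (fun n => luxemburgNorm Ω Φ (fun x => φ n x - u x) +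
      luxemburgNorm Ω Φ (fun x => gradient (φ n) x - weakGrad Ω u x)) atTop (𝓝 0)

/-- `l` is an eigenvalue of `-Δ_s u = l |u|^{s-2} u` in `Ω`, `u = 0` on `∂Ω`, in the weak sense in
`W_0^{1,s}(Ω)`. -/
def IsDirichletEigenvalue {N : ℕ} (s : ℝ) (Ω : Set (Space N)) (l : ℝ) : Prop :=
  ∃ u : Space N → ℝ, MemWZero Ω (powerFn fun _ => s) u ∧ ¬ u =ᵐ[volume.restrict Ω] 0 ∧
    ∀ φ : Space N → ℝ, MemWZero Ω (powerFn fun _ => s) φ →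
      ∫ x in Ω, inner ℝ (‖weakGrad Ω u x‖ ^ (s - 2) • weakGrad Ω u x) (weakGrad Ω φ x) =
        l * ∫ x in Ω, |u x| ^ (s - 2) * u x * φ x

/-- The first eigenvalue `λ_{1,s}` of the `s`-Laplacian with Dirichlet boundary condition. -/
def firstEigenvalue {N : ℕ} (s : ℝ) (Ω : Set (Space N)) : ℝ :=
  sInf {l | IsDirichletEigenvalue s Ω l}

/-- Hypothesis (H) on the domain, the weight and the exponents. -/
structure HypH {N : ℕ} (Ω : Set (Space N)) (p q μ : Space N → ℝ) : Prop where
  two_le : 2 ≤ N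
  domain : IsBoundedLipschitzDomain Ω
  weight_nonneg : ∀ᵐ x ∂volume.restrict Ω, 0 ≤ μ x
  weight_bounded : MemLp μ ∞ (volume.restrict Ω)
  p_mem : MemCPlus Ω p
  q_mem : MemCPlus Ω q
  p_lt_dim : ∀ x ∈ closure Ω, p x < N
  p_lt_q : ∀ x ∈ closure Ω, p x < q x
  q_lt_critical : ∀ x ∈ closure Ω, q x < criticalExponent p x

/-- `f` is a Carathéodory function on `Ω × ℝ × ℝ^N`. -/
def IsCaratheodory {N : ℕ} (Ω : Set (Space N)) (f : Space N → ℝ → Space N → ℝ) : Prop :=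
  (∀ (s : ℝ) (ξ : Space N), AEStronglyMeasurable (fun x => f x s ξ) (volume.restrict Ω)) ∧
    ∀ᵐ x ∂volume.restrict Ω, Continuous fun z : ℝ × Space N => f x z.1 z.2

/-- Part (i) of H(f): growth condition. -/
def GrowthCondition {N : ℕ} (Ω : Set (Space N)) (p : Space N → ℝ)
    (f : Space N → ℝ → Space N → ℝ) : Prop :=
  ∃ (r α : Space N → ℝ) (a₁ a₂ : ℝ),
    MemCPlus Ω r ∧ (∀ x ∈ closure Ω, r x < criticalExponent p x) ∧
    MemL Ω (powerFn fun x => r x / (r x - 1)) α ∧ 0 ≤ a₁ ∧ 0 ≤ a₂ ∧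
    ∀ᵐ x ∂volume.restrict Ω, ∀ (s : ℝ) (ξ : Space N),
      |f x s ξ| ≤ a₁ * ‖ξ‖ ^ (p x * ((r x - 1) / r x)) + a₂ * |s| ^ (r x - 1) + α x

/-- Part (ii) of H(f): coercivity condition. -/
def CoercivityCondition {N : ℕ} (Ω : Set (Space N)) (p : Space N → ℝ)
    (f : Space N → ℝ → Space N → ℝ) : Prop :=
  ∃ (ω : Space N → ℝ) (b₁ b₂ : ℝ),
    Integrable ω (volume.restrict Ω) ∧ 0 ≤ b₁ ∧ 0 ≤ b₂ ∧
    (∀ᵐ x ∂volume.restrict Ω, ∀ (s : ℝ) (ξ : Space N),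
      f x s ξ * s ≤ b₁ * ‖ξ‖ ^ p x + b₂ * |s| ^ minExponent Ω p + ω x) ∧
    0 < 1 - b₁ - b₂ * (firstEigenvalue (minExponent Ω p) Ω)⁻¹

/-- Hypothesis H(f) on the nonlinearity. -/
structure HypF {N : ℕ} (Ω : Set (Space N)) (p : Space N → ℝ)
    (f : Space N → ℝ → Space N → ℝ) : Prop where
  caratheodory : IsCaratheodory Ω f
  nontrivial : ¬ (fun x => f x 0 0) =ᵐ[volume.restrict Ω] 0
  growth : GrowthCondition Ω p f
  coercivity : CoercivityCondition Ω p f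

/-- Hypothesis (U1) with constant `c₁`. -/
def HypU1 {N : ℕ} (Ω : Set (Space N)) (f : Space N → ℝ → Space N → ℝ) (c₁ : ℝ) : Prop :=
  0 ≤ c₁ ∧ ∀ᵐ x ∂volume.restrict Ω, ∀ (s t : ℝ) (ξ : Space N),
    (f x s ξ - f x t ξ) * (s - t) ≤ c₁ * |s - t| ^ 2

/-- Hypothesis (U2) with constant `c₂`; `c₁` is the constant of (U1). -/
def HypU2 {N : ℕ} (Ω : Set (Space N)) (p : Space N → ℝ) (f : Space N → ℝ → Space N → ℝ)
    (c₁ c₂ : ℝ) : Prop :=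
  (∃ r ρ : Space N → ℝ, MemCPlus Ω r ∧ (∀ x ∈ closure Ω, r x < criticalExponent p x) ∧
    MemL Ω (powerFn fun x => r x / (r x - 1)) ρ ∧
    (∀ᵐ x ∂volume.restrict Ω, ∀ s : ℝ, IsLinearMap ℝ fun ξ : Space N => f x s ξ - ρ x) ∧
    ∀ᵐ x ∂volume.restrict Ω, ∀ (s : ℝ) (ξ : Space N), |f x s ξ - ρ x| ≤ c₂ * ‖ξ‖) ∧
  0 ≤ c₂ ∧
  c₁ * (firstEigenvalue 2 Ω)⁻¹ + c₂ * firstEigenvalue 2 Ω ^ (-(1 / 2) : ℝ) < 1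

/-- The vector field `|ξ|^{p(x)-2} ξ + μ(x) |ξ|^{q(x)-2} ξ` of the double phase operator. -/
def doublePhaseField {N : ℕ} (p q μ : Space N → ℝ) (x ξ : Space N) : Space N :=
  ‖ξ‖ ^ (p x - 2) • ξ + (μ x * ‖ξ‖ ^ (q x - 2)) • ξ

/-- `u` is a weak solution in `W_0^{1,H}(Ω)` of
`-div (|∇u|^{p(x)-2} ∇u + μ(x) |∇u|^{q(x)-2} ∇u) = f(x, u, ∇u)` in `Ω`, `u = 0` on `∂Ω`.
That both integrals exist is part of the definition. -/
def IsWeakSolution {N : ℕ} (Ω : Set (Space N)) (p q μ : Space N → ℝ)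
    (f : Space N → ℝ → Space N → ℝ) (u : Space N → ℝ) : Prop :=
  MemWZero Ω (doublePhaseFn p q μ) u ∧
    ∀ φ : Space N → ℝ, MemWZero Ω (doublePhaseFn p q μ) φ →
      IntegrableOn (fun x => inner ℝ (doublePhaseField p q μ x (weakGrad Ω u x))
        (weakGrad Ω φ x)) Ω ∧
      IntegrableOn (fun x => f x (u x) (weakGrad Ω u x) * φ x) Ω ∧
      ∫ x in Ω, inner ℝ (doublePhaseField p q μ x (weakGrad Ω u x)) (weakGrad Ω φ x) =
        ∫ x in Ω, f x (u x) (weakGrad Ω u x) * φ x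

end DoublePhase

end

/-!
Since `p = 2 < N`, the dimension is at least three and the differential operator is
`-div (∇u + μ |∇u|^{q-2} ∇u)`, which is strongly monotone with respect to the Dirichlet norm.

The right-hand side is much more rigid than it looks. By (U2), `f(x, s, ·) - ρ(x)` is a linear form.
Condition (U1) bounds `(f(x, s, ξ) - f(x, t, ξ)) (s - t)`, which is linear in `ξ`, by a quantity
independent of `ξ`, so scaling `ξ` shows that this linear form does not depend on `s`. Hence
`f(x, s, ξ) = ρ(x) + ⟪B(x), ξ⟫` with `|B| ≤ c₂` (`exists_rightHandSide_eq`).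

Given a field `g ∈ L²(Ω; ℝ^N)`, the problem with right-hand side `ρ + ⟪B, g⟫` is the Euler-Lagrange
equation of a convex functional on `W_0^{1,H}(Ω)`. Clarkson's inequality, available as `q ≥ 2`, makes
minimizing sequences converge in the modular sense, and Fatou's lemma shows that the limit is a
minimizer `u_g` (`IsQuadraticSetting.exists_weak_solution_of_dualBound`). By strong monotonicity and
the Poincaré inequality with the optimal constant, `g ↦ ∇u_g` is a contraction of `L²(Ω; ℝ^N)`, because
`c₂ λ_{1,2}^{-1/2} < 1` (`IsQuadraticSetting.integral_grad_sub_sq_le`). Its fixed point is the gradient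
of a solution, and the same estimate gives uniqueness.

What remains is to identify `firstEigenvalue 2 Ω`, the infimum of the set of Dirichlet eigenvalues,
with the positive infimum of the Rayleigh quotient (`firstEigenvalue_two_eq`). That infimum is
attained thanks to Rellich's compactness theorem (`exists_subseq_cauchy_of_gradient_bounded`), proved
by averaging over small balls and weak compactness in `L²(Ω)`.

All work on the spaces `W_0^{1,Φ}(Ω)` is done with pairs `(u, v)` that are modular limits of pairs
`(φ, ∇φ)` of test functions and their gradients (`IsLimitPair`). By the `Δ₂`-condition these are the
pairs `(u, ∇u)` with `u ∈ W_0^{1,Φ}(Ω)` (`IsLimitPair.memWZero`, `MemWZero.isLimitPair`). The Sobolev inequality for test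
functions passes to such pairs, and is the reason why `∇φ_n` converging in modular is enough for `φ_n`
to converge.
-/

noncomputable section

namespace DoublePhase

/-! ### Integrands of quadratic growth and their modulars -/

/-- The critical exponent `2* = 2N / (N - 2)` of the embedding of `W_0^{1,2}`. -/
def sobolevExponent (N : ℕ) : ℝ := 2 * N / (N - 2)

/-- An integrand with at least quadratic growth and at most critical growth, satisfying the
`Δ₂`-condition. This is all that the modular calculus needs to know about the double phase integrand
with `p = 2`; the constant `C` serves in both upper bounds. -/
structure IsQuadraticIntegrand {N : ℕ} (Ω : Set (Space N)) (Φ : Space N → ℝ → ℝ) (C : ℝ) :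
    Prop where
  one_le : 1 ≤ C
  aemeasurable : ∀ w : Space N → ℝ, AEMeasurable w (volume.restrict Ω) →
    AEMeasurable (fun x => Φ x (w x)) (volume.restrict Ω)
  continuous : ∀ᵐ x ∂volume.restrict Ω, Continuous (Φ x)
  mono : ∀ᵐ x ∂volume.restrict Ω, ∀ s t, 0 ≤ s → s ≤ t → Φ x s ≤ Φ x t
  sq_le : ∀ᵐ x ∂volume.restrict Ω, ∀ t, 0 ≤ t → t ^ 2 ≤ Φ x t
  smul_le : ∀ᵐ x ∂volume.restrict Ω, ∀ c t, 1 ≤ c → 0 ≤ t → Φ x (c * t) ≤ c ^ C * Φ x t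
  smul_le_sq : ∀ᵐ x ∂volume.restrict Ω, ∀ c t, 0 ≤ c → c ≤ 1 → 0 ≤ t →
    Φ x (c * t) ≤ c ^ 2 * Φ x t
  le_critical : ∀ᵐ x ∂volume.restrict Ω, ∀ t, 0 ≤ t →
    Φ x t ≤ C * (t ^ 2 + t ^ sobolevExponent N)

section Modular

variable {N : ℕ} {F : Type*} [NormedAddCommGroup F] {Ω : Set (Space N)}
  {Φ : Space N → ℝ → ℝ} {C : ℝ}

lemma modular_congr_ae {u v : Space N → F} (h : u =ᵐ[volume.restrict Ω] v) :
    modular Ω Φ u = modular Ω Φ v := by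
  refine lintegral_congr_ae ?_
  filter_upwards [h] with x hx
  rw [hx]

lemma modular_neg_sub (u v : Space N → F) :
    modular Ω Φ (fun x => u x - v x) = modular Ω Φ (fun x => v x - u x) := by
  simp only [modular, norm_sub_rev]

namespace IsQuadraticIntegrand

variable (h : IsQuadraticIntegrand Ω Φ C)
include h

lemma add_le : ∀ᵐ x ∂volume.restrict Ω, ∀ a b : F,
    Φ x ‖a + b‖ ≤ 2 ^ C * (Φ x ‖a‖ + Φ x ‖b‖) := by
  filter_upwards [h.mono, h.smul_le, h.sq_le] with x hm hs hq a b
  have key : ∀ s t : ℝ, 0 ≤ s → s ≤ t → Φ x (s + t) ≤ 2 ^ C * Φ x t := fun s t h0 h1 =>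
    (hm _ (2 * t) (by linarith) (by linarith)).trans (hs 2 t (by norm_num) (h0.trans h1))
  have h2 : (0 : ℝ) < 2 ^ C := by positivity
  have hab := hm _ _ (norm_nonneg _) (norm_add_le a b)
  have ha := (sq_nonneg _).trans (hq _ (norm_nonneg a))
  have hb := (sq_nonneg _).trans (hq _ (norm_nonneg b))
  rcases le_total ‖a‖ ‖b‖ with hc | hc
  · have := key _ _ (norm_nonneg _) hc
    nlinarith [mul_nonneg h2.le ha]
  · have := key _ _ (norm_nonneg _) hc
    rw [add_comm ‖b‖] at this
    nlinarith [mul_nonneg h2.le hb]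

lemma aemeasurable_norm {u : Space N → F} (hu : AEStronglyMeasurable u (volume.restrict Ω)) :
    AEMeasurable (fun x => ENNReal.ofReal (Φ x ‖u x‖)) (volume.restrict Ω) :=
  (h.aemeasurable _ hu.norm.aemeasurable).ennreal_ofReal

lemma modular_add_le {u : Space N → F} (v : Space N → F)
    (hu : AEStronglyMeasurable u (volume.restrict Ω)) :
    modular Ω Φ (fun x => u x + v x) ≤
      ENNReal.ofReal (2 ^ C) * (modular Ω Φ u + modular Ω Φ v) := by
  unfold modular
  rw [← lintegral_add_left' (h.aemeasurable_norm hu),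
    ← lintegral_const_mul' _ _ ENNReal.ofReal_ne_top]
  refine lintegral_mono_ae ?_
  filter_upwards [h.add_le (F := F), h.sq_le] with x hx hq
  rw [← ENNReal.ofReal_add ((sq_nonneg _).trans (hq _ (norm_nonneg _)))
    ((sq_nonneg _).trans (hq _ (norm_nonneg _))), ← ENNReal.ofReal_mul (by positivity)]
  exact ENNReal.ofReal_le_ofReal (hx _ _)

lemma modular_sub_le {u v w : Space N → F}
    (hu : AEStronglyMeasurable u (volume.restrict Ω))
    (hv : AEStronglyMeasurable v (volume.restrict Ω)) :
    modular Ω Φ (fun x => u x - w x) ≤ ENNReal.ofReal (2 ^ C) *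
      (modular Ω Φ (fun x => u x - v x) + modular Ω Φ (fun x => v x - w x)) := by
  have := h.modular_add_le (u := fun x => u x - v x) (fun x => v x - w x) (hu.sub hv)
  simpa only [sub_add_sub_cancel] using this

lemma modular_smul_le [NormedSpace ℝ F] {c : ℝ} (hc : 1 ≤ c) (u : Space N → F) :
    modular Ω Φ (fun x => c • u x) ≤ ENNReal.ofReal (c ^ C) * modular Ω Φ u := by
  unfold modular
  rw [← lintegral_const_mul' _ _ ENNReal.ofReal_ne_top]
  refine lintegral_mono_ae ?_
  filter_upwards [h.smul_le] with x hx
  rw [← ENNReal.ofReal_mul (by positivity), norm_smul, Real.norm_of_nonneg (by linarith)]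
  exact ENNReal.ofReal_le_ofReal (hx _ _ hc (norm_nonneg _))

lemma modular_smul_le_sq [NormedSpace ℝ F] {c : ℝ} (h0 : 0 ≤ c) (hc : c ≤ 1) (u : Space N → F) :
    modular Ω Φ (fun x => c • u x) ≤ ENNReal.ofReal (c ^ 2) * modular Ω Φ u := by
  unfold modular
  rw [← lintegral_const_mul' _ _ ENNReal.ofReal_ne_top]
  refine lintegral_mono_ae ?_
  filter_upwards [h.smul_le_sq] with x hx
  rw [← ENNReal.ofReal_mul (by positivity), norm_smul, Real.norm_of_nonneg h0]
  exact ENNReal.ofReal_le_ofReal (hx _ _ h0 hc (norm_nonneg _))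

lemma modular_const_smul_le [NormedSpace ℝ F] (c : ℝ) (u : Space N → F) :
    modular Ω Φ (fun x => c • u x) ≤ ENNReal.ofReal ((|c| + 1) ^ C) * modular Ω Φ u := by
  refine le_trans ?_ (h.modular_smul_le (by linarith [abs_nonneg c]) u)
  refine lintegral_mono_ae ?_
  filter_upwards [h.mono] with x hx
  refine ENNReal.ofReal_le_ofReal (hx _ _ (norm_nonneg _) ?_)
  rw [norm_smul, norm_smul, Real.norm_eq_abs, Real.norm_of_nonneg (by positivity)]
  nlinarith [norm_nonneg (u x)]

/-- By the `Δ₂`-condition, norm convergence and modular convergence to zero agree. -/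
lemma tendsto_luxemburgNorm_iff [NormedSpace ℝ F] {u : ℕ → Space N → F} :
    Tendsto (fun n => luxemburgNorm Ω Φ (u n)) atTop (𝓝 0) ↔
      Tendsto (fun n => modular Ω Φ (u n)) atTop (𝓝 0) := by
  constructor
  · intro hu
    rw [ENNReal.tendsto_nhds_zero] at hu ⊢
    intro ε hε
    -- a `τ ≤ 1` admissible in the infimum bounds the modular by `τ ^ 2 ≤ τ`
    filter_upwards [(ENNReal.tendsto_nhds_zero.2 hu).eventually
      (gt_mem_nhds (show (0 : ℝ≥0∞) < min ε 1 from lt_min hε one_pos))] with n hn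
    simp only [luxemburgNorm, iInf_lt_iff] at hn
    obtain ⟨τ, h0, hm, hτ⟩ := hn
    have h1 : τ ≤ 1 := by
      have := (hτ.trans_le (min_le_right _ _)).le
      rwa [ENNReal.ofReal_le_one] at this
    have hsm := h.modular_smul_le_sq h0.le h1 (fun x => τ⁻¹ • u n x)
    simp only [smul_inv_smul₀ h0.ne'] at hsm
    refine hsm.trans ?_
    calc ENNReal.ofReal (τ ^ 2) * modular Ω Φ (fun x => τ⁻¹ • u n x)
        ≤ ENNReal.ofReal τ * 1 := by
          gcongr
          nlinarith
      _ ≤ ε := by rw [mul_one]; exact (hτ.trans_le (min_le_left _ _)).le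
  · intro hu
    rw [ENNReal.tendsto_nhds_zero]
    intro ε hε
    obtain ⟨τ, h0, hτ1, hτ⟩ : ∃ τ : ℝ, 0 < τ ∧ τ ≤ 1 ∧ ENNReal.ofReal τ ≤ ε := by
      rcases eq_or_ne ε ∞ with rfl | he
      · exact ⟨1, one_pos, le_rfl, le_top⟩
      · refine ⟨min 1 ε.toReal, lt_min one_pos (ENNReal.toReal_pos hε.ne' he), min_le_left _ _, ?_⟩
        exact (ENNReal.ofReal_le_ofReal (min_le_right _ _)).trans ENNReal.ofReal_toReal_le
    have h2 : Tendsto (fun n => ENNReal.ofReal (τ⁻¹ ^ C) * modular Ω Φ (u n)) atTop (𝓝 0) := by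
      simpa using ENNReal.Tendsto.const_mul hu (Or.inr ENNReal.ofReal_ne_top)
    filter_upwards [h2.eventually (gt_mem_nhds one_pos)] with n hn
    refine le_trans ?_ hτ
    refine iInf_le_of_le τ (iInf_le_of_le h0 (iInf_le_of_le ?_ le_rfl))
    exact (h.modular_smul_le ((one_le_inv₀ h0).2 hτ1) (u n)).trans hn.le

lemma eLpNorm_two_le (u : Space N → F) :
    eLpNorm u 2 (volume.restrict Ω) ^ 2 ≤ modular Ω Φ u := by
  have := eLpNorm_nnreal_pow_eq_lintegral (f := u) (μ := volume.restrict Ω)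
    (show (2 : NNReal) ≠ 0 by norm_num)
  have h2 : eLpNorm u 2 (volume.restrict Ω) ^ 2 = ∫⁻ x in Ω, ‖u x‖ₑ ^ 2 := by
    simpa using this
  rw [h2]
  refine lintegral_mono_ae ?_
  filter_upwards [h.sq_le] with x hx
  rw [← ofReal_norm, ← ENNReal.ofReal_pow (norm_nonneg _)]
  exact ENNReal.ofReal_le_ofReal (hx _ (norm_nonneg _))

lemma memLp_two {u : Space N → F} (hu : AEStronglyMeasurable u (volume.restrict Ω))
    (hm : modular Ω Φ u < ∞) : MemLp u 2 (volume.restrict Ω) := by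
  refine ⟨hu, ?_⟩
  by_contra hc
  rw [not_lt, top_le_iff] at hc
  have := h.eLpNorm_two_le u
  rw [hc] at this
  simp at this
  simp [this] at hm

lemma tendsto_eLpNorm_two {u : ℕ → Space N → F}
    (hu : Tendsto (fun n => modular Ω Φ (u n)) atTop (𝓝 0)) :
    Tendsto (fun n => eLpNorm (u n) 2 (volume.restrict Ω)) atTop (𝓝 0) := by
  have h1 := tendsto_of_tendsto_of_tendsto_of_le_of_le tendsto_const_nhds hu
    (fun n => zero_le) (fun n => h.eLpNorm_two_le (u n))
  have h2 := h1.ennrpow_const (1 / 2)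
  rw [ENNReal.zero_rpow_of_pos (by norm_num)] at h2
  refine h2.congr fun n => ?_
  rw [← ENNReal.rpow_natCast, ← ENNReal.rpow_mul]
  norm_num

lemma modular_le_liminf {u : ℕ → Space N → F} {v : Space N → F}
    (hu : ∀ n, AEStronglyMeasurable (u n) (volume.restrict Ω))
    (hv : ∀ᵐ x ∂volume.restrict Ω, Tendsto (fun n => u n x) atTop (𝓝 (v x))) :
    modular Ω Φ v ≤ liminf (fun n => modular Ω Φ (u n)) atTop := by
  refine le_trans (lintegral_mono_ae ?_) (lintegral_liminf_le' fun n => h.aemeasurable_norm (hu n))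
  filter_upwards [hv, h.continuous] with x hx hc
  exact (ENNReal.tendsto_ofReal ((hc.tendsto _).comp hx.norm)).liminf_eq.ge

lemma exists_tendsto_modular [CompleteSpace F] {u : ℕ → Space N → F}
    (hu : ∀ n, MemLp (u n) 2 (volume.restrict Ω))
    (hc : ∀ ε : ℝ≥0∞, 0 < ε → ∃ n₀, ∀ n ≥ n₀, ∀ m ≥ n₀,
      modular Ω Φ (fun x => u n x - u m x) ≤ ε) :
    ∃ v : Space N → F, AEStronglyMeasurable v (volume.restrict Ω) ∧
      Tendsto (fun n => modular Ω Φ (fun x => u n x - v x)) atTop (𝓝 0) := by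
  let U : ℕ → Lp F 2 (volume.restrict Ω) := fun n => (hu n).toLp
  have hU : CauchySeq U := by
    rw [EMetric.cauchySeq_iff]
    intro ε hε
    obtain ⟨δ, h0, hδ⟩ := exists_between hε
    obtain ⟨n₀, hn⟩ := hc (δ ^ 2) (by positivity)
    refine ⟨n₀, fun m hm n hn' => ?_⟩
    rw [Lp.edist_toLp_toLp]
    refine lt_of_le_of_lt ?_ hδ
    have := (h.eLpNorm_two_le _).trans (hn m hm n hn')
    exact (ENNReal.pow_le_pow_left_iff two_ne_zero).1 this
  obtain ⟨V, hV⟩ := cauchySeq_tendsto_of_complete hU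
  have hV2 : Tendsto (fun n => eLpNorm (u n - (V : Space N → F)) 2 (volume.restrict Ω)) atTop (𝓝 0) := by
    have := (tendsto_iff_edist_tendsto_0.1 hV)
    refine this.congr fun n => ?_
    rw [Lp.edist_def]
    exact eLpNorm_congr_ae ((hu n).coeFn_toLp.sub (ae_eq_refl _))
  obtain ⟨k, hk, hkV⟩ := (tendstoInMeasure_of_tendsto_eLpNorm two_ne_zero
    (fun n => (hu n).1) (Lp.aestronglyMeasurable V) hV2).exists_seq_tendsto_ae
  refine ⟨V, Lp.aestronglyMeasurable V, ?_⟩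
  rw [ENNReal.tendsto_nhds_zero]
  intro ε hε
  obtain ⟨n₀, hn⟩ := hc ε hε
  filter_upwards [eventually_ge_atTop n₀] with n hn'
  refine (h.modular_le_liminf (u := fun m x => u n x - u (k m) x)
    (fun m => (hu n).1.sub (hu (k m)).1) ?_).trans ?_
  · filter_upwards [hkV] with x hx
    exact tendsto_const_nhds.sub hx
  · refine liminf_le_of_frequently_le' (Eventually.frequently ?_)
    filter_upwards [hk.tendsto_atTop.eventually_ge_atTop n₀] with m hm
    exact hn n hn' _ hm

end IsQuadraticIntegrand
end Modular

/-! ### The double phase integrand -/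

lemma two_lt_sobolevExponent {N : ℕ} (hN : 3 ≤ N) : 2 < sobolevExponent N := by
  have : (3 : ℝ) ≤ N := by exact_mod_cast hN
  rw [sobolevExponent, lt_div_iff₀ (by linarith)]
  linarith

lemma rpow_le_sq_add_rpow {t q s : ℝ} (ht : 0 ≤ t) (h2 : 2 ≤ q) (hs : q ≤ s) :
    t ^ q ≤ t ^ 2 + t ^ s := by
  rcases le_total t 1 with h | h
  · have := Real.rpow_le_rpow_of_exponent_ge' ht h (by norm_num) h2
    rw [Real.rpow_two] at this
    linarith [Real.rpow_nonneg ht s]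
  · have := Real.rpow_le_rpow_of_exponent_le h hs
    linarith [sq_nonneg t]

lemma isQuadraticIntegrand_doublePhaseFn {N : ℕ} {Ω : Set (Space N)} {p q μ : Space N → ℝ} {M : ℝ}
    (hN : 3 ≤ N) (hp : ∀ᵐ x ∂volume.restrict Ω, p x = 2)
    (hμm : AEMeasurable μ (volume.restrict Ω)) (hqm : AEMeasurable q (volume.restrict Ω))
    (hμ : ∀ᵐ x ∂volume.restrict Ω, 0 ≤ μ x ∧ μ x ≤ M)
    (hq : ∀ᵐ x ∂volume.restrict Ω, 2 ≤ q x ∧ q x ≤ sobolevExponent N) (hM : 0 ≤ M) :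
    IsQuadraticIntegrand Ω (doublePhaseFn p q μ) (1 + M + sobolevExponent N) := by
  have hS := two_lt_sobolevExponent hN
  refine ⟨by linarith, ?_, ?_, ?_, ?_, ?_, ?_, ?_⟩
  · intro w hw
    have hpm : AEMeasurable p (volume.restrict Ω) :=
      (aemeasurable_const (b := (2 : ℝ))).congr (by
        filter_upwards [hp] with x hx using hx.symm)
    exact (hw.pow hpm).add (hμm.mul (hw.pow hqm))
  · filter_upwards [hp, hq] with x hx hqx
    unfold doublePhaseFn
    rw [hx]
    exact (Real.continuous_rpow_const (by norm_num)).add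
      (continuous_const.mul (Real.continuous_rpow_const (by linarith)))
  · filter_upwards [hp, hq, hμ] with x hx hqx hm s t hs hst
    unfold doublePhaseFn
    rw [hx]
    have h1 := Real.rpow_le_rpow hs hst (show (0 : ℝ) ≤ 2 by norm_num)
    have h2 := Real.rpow_le_rpow hs hst (show (0 : ℝ) ≤ q x by linarith)
    have := mul_le_mul_of_nonneg_left h2 hm.1
    linarith
  · filter_upwards [hp, hμ] with x hx hm t ht
    unfold doublePhaseFn
    rw [hx, Real.rpow_two]
    have := mul_nonneg hm.1 (Real.rpow_nonneg ht (q x))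
    linarith
  · filter_upwards [hp, hq, hμ] with x hx hqx hm c t hc ht
    unfold doublePhaseFn
    rw [hx, Real.mul_rpow (by linarith) ht, Real.mul_rpow (by linarith) ht]
    have h1 := Real.rpow_le_rpow_of_exponent_le hc
      (show (2 : ℝ) ≤ 1 + M + sobolevExponent N by linarith)
    have h2 := Real.rpow_le_rpow_of_exponent_le hc
      (show q x ≤ 1 + M + sobolevExponent N by linarith)
    have h3 := mul_le_mul_of_nonneg_right h1 (Real.rpow_nonneg ht 2)
    have h4 := mul_le_mul_of_nonneg_right h2 (mul_nonneg hm.1 (Real.rpow_nonneg ht (q x)))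
    linarith
  · filter_upwards [hp, hq, hμ] with x hx hqx hm c t h0 hc ht
    unfold doublePhaseFn
    rw [hx, Real.mul_rpow h0 ht, Real.mul_rpow h0 ht, ← Real.rpow_two c]
    have h2 := Real.rpow_le_rpow_of_exponent_ge' h0 hc (by norm_num) hqx.1
    have h4 := mul_le_mul_of_nonneg_right h2 (mul_nonneg hm.1 (Real.rpow_nonneg ht (q x)))
    linarith
  · filter_upwards [hp, hq, hμ] with x hx hqx hm t ht
    unfold doublePhaseFn
    rw [hx, Real.rpow_two]
    have h1 := rpow_le_sq_add_rpow ht hqx.1 hqx.2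
    have h0 := Real.rpow_nonneg ht (sobolevExponent N)
    have h2 := mul_le_mul hm.2 h1 (Real.rpow_nonneg ht _) hM
    have h3 : 0 ≤ sobolevExponent N * (t ^ 2 + t ^ sobolevExponent N) :=
      mul_nonneg (by linarith) (add_nonneg (sq_nonneg t) h0)
    linarith

lemma powerFn_two_eq {N : ℕ} :
    (powerFn fun _ : Space N => (2 : ℝ)) = doublePhaseFn (fun _ => 2) (fun _ => 2) 0 := by
  ext x t
  simp [powerFn, doublePhaseFn]

lemma isQuadraticIntegrand_powerFn {N : ℕ} (Ω : Set (Space N)) (hN : 3 ≤ N) :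
    IsQuadraticIntegrand Ω (powerFn fun _ => 2) (1 + 0 + sobolevExponent N) := by
  rw [powerFn_two_eq]
  have := two_lt_sobolevExponent hN
  exact isQuadraticIntegrand_doublePhaseFn hN (by simp) aemeasurable_const aemeasurable_const
    (by simp) (by simp [this.le]) le_rfl

/-! ### Test functions -/

section TestFunctions

variable {N : ℕ} {Ω : Set (Space N)} {φ ψ : Space N → ℝ}

lemma gradient_eq (φ : Space N → ℝ) (x : Space N) :
    gradient φ x = (InnerProductSpace.toDual ℝ (Space N)).symm (fderiv ℝ φ x) := rfl

lemma norm_gradient (φ : Space N → ℝ) (x : Space N) : ‖gradient φ x‖ = ‖fderiv ℝ φ x‖ := by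
  rw [gradient_eq, LinearIsometryEquiv.norm_map]

namespace IsTestFunction

lemma differentiable (h : IsTestFunction Ω φ) : Differentiable ℝ φ :=
  h.1.differentiable (by simp)

lemma gradient_add (h : IsTestFunction Ω φ) (h' : IsTestFunction Ω ψ) (x : Space N) :
    gradient (fun y => φ y + ψ y) x = gradient φ x + gradient ψ x := by
  simp only [gradient_eq]
  rw [fderiv_fun_add (h.differentiable x) (h'.differentiable x), map_add]

lemma gradient_smul (h : IsTestFunction Ω φ) (c : ℝ) (x : Space N) :
    gradient (fun y => c • φ y) x = c • gradient φ x := by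
  simp only [gradient_eq]
  rw [fderiv_fun_const_smul (h.differentiable x)]
  simp

lemma add (h : IsTestFunction Ω φ) (h' : IsTestFunction Ω ψ) :
    IsTestFunction Ω (fun x => φ x + ψ x) :=
  ⟨h.1.add h'.1, h.2.1.add h'.2.1, (tsupport_add φ ψ).trans (Set.union_subset h.2.2 h'.2.2)⟩

lemma smul (h : IsTestFunction Ω φ) (c : ℝ) : IsTestFunction Ω (fun x => c • φ x) :=
  ⟨h.1.const_smul c, h.2.1.smul_left (f := fun _ => c),
    (closure_mono (Function.support_const_smul_subset c φ)).trans h.2.2⟩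

lemma zero : IsTestFunction Ω (fun _ => 0) := by
  refine ⟨contDiff_const, HasCompactSupport.zero, ?_⟩
  have : tsupport (fun _ : Space N => (0 : ℝ)) = ∅ := tsupport_eq_empty_iff.2 rfl
  simp [this]

lemma continuous (h : IsTestFunction Ω φ) : Continuous φ := h.1.continuous

lemma continuous_gradient (h : IsTestFunction Ω φ) : Continuous (gradient φ) :=
  (LinearIsometryEquiv.continuous _).comp (h.1.continuous_fderiv (by simp))

lemma support_gradient_subset (φ : Space N → ℝ) :
    Function.support (gradient φ) ⊆ tsupport φ := by
  refine subset_trans (fun x hx => ?_) (support_fderiv_subset ℝ (f := φ))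
  contrapose! hx
  simp only [Function.mem_support, not_not] at hx ⊢
  rw [gradient_eq, hx, map_zero]

lemma hasCompactSupport_gradient (h : IsTestFunction Ω φ) : HasCompactSupport (gradient φ) :=
  HasCompactSupport.intro' h.2.1 (isClosed_tsupport φ) fun _ hx =>
    Function.notMem_support.1 fun h' => hx (support_gradient_subset φ h')

lemma eq_zero_of_notMem (h : IsTestFunction Ω φ) {x : Space N} (hx : x ∉ Ω) : φ x = 0 :=
  image_eq_zero_of_notMem_tsupport fun h' => hx (h.2.2 h')

lemma gradient_eq_zero_of_notMem (h : IsTestFunction Ω φ) {x : Space N} (hx : x ∉ Ω) :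
    gradient φ x = 0 :=
  Function.notMem_support.1 fun h' => hx (h.2.2 (support_gradient_subset φ h'))

lemma hasWeakGradient (h : IsTestFunction Ω φ) : HasWeakGradient Ω φ (gradient φ) := by
  refine ⟨h.continuous.locallyIntegrable.locallyIntegrableOn _,
    h.continuous_gradient.locallyIntegrable.locallyIntegrableOn _, fun ψ hψ => ?_⟩
  rw [setIntegral_eq_integral_of_forall_compl_eq_zero
      fun x hx => by rw [h.eq_zero_of_notMem hx, zero_smul],
    setIntegral_eq_integral_of_forall_compl_eq_zero
      fun x hx => by rw [hψ.eq_zero_of_notMem hx, zero_smul]]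
  have i1 : Integrable (fun x => φ x • gradient ψ x) :=
    (h.continuous.smul hψ.continuous_gradient).integrable_of_hasCompactSupport h.2.1.smul_right
  have i2 : Integrable (fun x => ψ x • gradient φ x) :=
    (hψ.continuous.smul h.continuous_gradient).integrable_of_hasCompactSupport hψ.2.1.smul_right
  refine ext_inner_left ℝ fun e => ?_
  rw [inner_neg_right, ← integral_inner i1, ← integral_inner i2]
  have hg : ∀ (g : Space N → ℝ) x, inner ℝ e (gradient g x) = fderiv ℝ g x e := fun g x => by
    rw [real_inner_comm, gradient_eq, InnerProductSpace.toDual_symm_apply]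
  simp only [inner_smul_right, hg]
  have c1 : Continuous fun x => fderiv ℝ φ x e :=
    (h.1.continuous_fderiv (by simp)).clm_apply continuous_const
  have c2 : Continuous fun x => fderiv ℝ ψ x e :=
    (hψ.1.continuous_fderiv (by simp)).clm_apply continuous_const
  rw [integral_mul_fderiv_eq_neg_fderiv_mul_of_integrable]
  · simp only [mul_comm]
  · exact (c1.mul hψ.continuous).integrable_of_hasCompactSupport hψ.2.1.mul_left
  · exact (h.continuous.mul c2).integrable_of_hasCompactSupport h.2.1.mul_right
  · exact (h.continuous.mul hψ.continuous).integrable_of_hasCompactSupport h.2.1.mul_right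
  · exact fun x _ => h.differentiable x
  · exact fun x _ => hψ.differentiable x

end IsTestFunction

end TestFunctions

/-- Bounded measurable functions have finite modular on sets of finite measure. -/
lemma IsQuadraticIntegrand.modular_lt_top {N : ℕ} {Ω : Set (Space N)} {Φ : Space N → ℝ → ℝ} {C : ℝ}
    {F : Type*} [NormedAddCommGroup F]
    (h : IsQuadraticIntegrand Ω Φ C) (hΩ : volume Ω < ∞) {u : Space N → F} {K : ℝ}
    (hu : ∀ x, ‖u x‖ ≤ K) : modular Ω Φ u < ∞ := by
  have : modular Ω Φ u ≤
      ∫⁻ _ in Ω, ENNReal.ofReal (C * (K ^ 2 + K ^ sobolevExponent N)) := by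
    refine lintegral_mono_ae ?_
    filter_upwards [h.le_critical, h.mono] with x h1 h2
    refine ENNReal.ofReal_le_ofReal ((h2 _ _ (norm_nonneg _) (hu x)).trans (h1 K ?_))
    exact (norm_nonneg _).trans (hu x)
  refine this.trans_lt ?_
  simp only [lintegral_const, Measure.restrict_apply_univ]
  exact ENNReal.mul_lt_top ENNReal.ofReal_lt_top hΩ

/-- The Sobolev inequality `‖φ‖_{2*} ≤ K ‖∇φ‖_2` for test functions. -/
lemma exists_sobolev_testFunction {N : ℕ} (hN : 3 ≤ N) (Ω : Set (Space N)) :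
    ∃ K : NNReal, ∀ φ, IsTestFunction Ω φ →
      eLpNorm φ (ENNReal.ofReal (sobolevExponent N)) (volume.restrict Ω) ≤
        K * eLpNorm (gradient φ) 2 (volume.restrict Ω) := by
  have hS := two_lt_sobolevExponent hN
  have hN3 : (3 : ℝ) ≤ N := by exact_mod_cast hN
  refine ⟨SNormLESNormFDerivOfEqConst ℝ (volume : Measure (Space N)) 2, fun φ h => ?_⟩
  have h1 := eLpNorm_le_eLpNorm_fderiv_of_eq (F := ℝ) (volume : Measure (Space N))
    (h.1.of_le (by simp)) h.2.1 (p := 2) (p' := (sobolevExponent N).toNNReal) (by norm_num)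
    (by simp; omega) (by
      rw [Real.coe_toNNReal _ (by linarith)]
      simp only [sobolevExponent, finrank_euclideanSpace, Fintype.card_fin]
      push_cast
      field_simp)
  have e1 : eLpNorm φ (ENNReal.ofReal (sobolevExponent N)) (volume.restrict Ω) ≤
      eLpNorm φ (ENNReal.ofReal (sobolevExponent N)) volume :=
    eLpNorm_mono_measure _ Measure.restrict_le_self
  have e2 : eLpNorm (fderiv ℝ φ) 2 volume ≤ eLpNorm (gradient φ) 2 (volume.restrict Ω) := by
    have : eLpNorm (fderiv ℝ φ) 2 volume = eLpNorm (gradient φ) 2 volume :=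
      eLpNorm_congr_norm_ae (Eventually.of_forall fun x => (norm_gradient φ x).symm)
    rw [this]
    refine (eLpNorm_restrict_eq_of_support_subset ?_).ge
    exact fun x hx => by_contra fun hx' => hx (h.gradient_eq_zero_of_notMem hx')
  exact e1.trans (h1.trans (mul_le_mul_right e2 _))

/-! ### The closure of the test functions -/

/-- The pair `(u, v)` is a modular limit of pairs `(φ, ∇φ)` with test functions `φ`: a description
of `u ∈ W_0^{1,Φ}(Ω)` with `∇u = v` that keeps the gradient as separate data, see
`IsLimitPair.memWZero` and `MemWZero.isLimitPair`. -/
structure IsLimitPair {N : ℕ} (Ω : Set (Space N)) (Φ : Space N → ℝ → ℝ) (u : Space N → ℝ)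
    (v : Space N → Space N) : Prop where
  aesm : AEStronglyMeasurable u (volume.restrict Ω)
  aesm_grad : AEStronglyMeasurable v (volume.restrict Ω)
  exists_approx : ∃ φ : ℕ → Space N → ℝ, (∀ n, IsTestFunction Ω (φ n)) ∧
    Tendsto (fun n => modular Ω Φ (fun x => φ n x - u x)) atTop (𝓝 0) ∧
    Tendsto (fun n => modular Ω Φ (fun x => gradient (φ n) x - v x)) atTop (𝓝 0)

section LimitPair

variable {N : ℕ} {Ω : Set (Space N)} {Φ : Space N → ℝ → ℝ} {C : ℝ} {u u' : Space N → ℝ}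
  {v v' : Space N → Space N} {φ : Space N → ℝ}

namespace IsTestFunction

lemma aesm (h : IsTestFunction Ω φ) : AEStronglyMeasurable φ (volume.restrict Ω) :=
  h.continuous.aestronglyMeasurable

lemma aesm_grad (h : IsTestFunction Ω φ) :
    AEStronglyMeasurable (gradient φ) (volume.restrict Ω) :=
  h.continuous_gradient.aestronglyMeasurable

lemma modular_lt_top (h : IsTestFunction Ω φ) (hΦ : IsQuadraticIntegrand Ω Φ C)
    (hΩ : volume Ω < ∞) : modular Ω Φ φ < ∞ := by
  obtain ⟨K, hK⟩ := h.continuous.bounded_above_of_compact_support h.2.1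
  exact hΦ.modular_lt_top hΩ hK

lemma modular_gradient_lt_top (h : IsTestFunction Ω φ) (hΦ : IsQuadraticIntegrand Ω Φ C)
    (hΩ : volume Ω < ∞) : modular Ω Φ (gradient φ) < ∞ := by
  obtain ⟨K, hK⟩ := h.continuous_gradient.bounded_above_of_compact_support
    h.hasCompactSupport_gradient
  exact hΦ.modular_lt_top hΩ hK

end IsTestFunction

lemma IsQuadraticIntegrand.modular_zero {F : Type*} [NormedAddCommGroup F] [NormedSpace ℝ F]
    (hΦ : IsQuadraticIntegrand Ω Φ C) :
    modular Ω Φ (fun _ => (0 : F)) = 0 := by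
  rw [← nonpos_iff_eq_zero]
  have h0 : ∀ᵐ x ∂volume.restrict Ω, ENNReal.ofReal (Φ x ‖(0 : F)‖) ≤ 0 := by
    filter_upwards [hΦ.smul_le_sq] with x hx
    have := hx 0 0 le_rfl zero_le_one le_rfl
    simp only [mul_zero, ne_eq, OfNat.ofNat_ne_zero, not_false_eq_true, zero_pow, zero_mul] at this
    simpa using this
  exact (lintegral_mono_ae h0).trans (by simp)

namespace IsLimitPair

lemma of_testFunction (hΦ : IsQuadraticIntegrand Ω Φ C) (h : IsTestFunction Ω φ) :
    IsLimitPair Ω Φ φ (gradient φ) := by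
  refine ⟨h.aesm, h.aesm_grad, fun _ => φ, fun _ => h, ?_, ?_⟩ <;>
  simp [hΦ.modular_zero]

lemma congr (h : IsLimitPair Ω Φ u v) (hu : u =ᵐ[volume.restrict Ω] u')
    (hv : v =ᵐ[volume.restrict Ω] v') : IsLimitPair Ω Φ u' v' := by
  obtain ⟨φ, hφ, h1, h2⟩ := h.exists_approx
  refine ⟨h.aesm.congr hu, h.aesm_grad.congr hv, φ, hφ, h1.congr fun n => ?_,
    h2.congr fun n => ?_⟩
  · exact modular_congr_ae ((ae_eq_refl _).sub hu)
  · exact modular_congr_ae ((ae_eq_refl _).sub hv)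

lemma modular_lt_top (h : IsLimitPair Ω Φ u v) (hΦ : IsQuadraticIntegrand Ω Φ C)
    (hΩ : volume Ω < ∞) : modular Ω Φ u < ∞ ∧ modular Ω Φ v < ∞ := by
  obtain ⟨φ, hφ, h1, h2⟩ := h.exists_approx
  obtain ⟨n, hn1, hn2⟩ := ((h1.eventually (gt_mem_nhds one_pos)).and
    (h2.eventually (gt_mem_nhds one_pos))).exists
  constructor
  · have := hΦ.modular_add_le (u := fun x => u x - φ n x) (φ n) (h.aesm.sub (hφ n).aesm)
    simp only [sub_add_cancel] at this
    rw [modular_neg_sub] at this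
    exact this.trans_lt (ENNReal.mul_lt_top ENNReal.ofReal_lt_top
      (ENNReal.add_lt_top.2 ⟨hn1.trans ENNReal.one_lt_top, (hφ n).modular_lt_top hΦ hΩ⟩))
  · have := hΦ.modular_add_le (u := fun x => v x - gradient (φ n) x) (gradient (φ n))
      (h.aesm_grad.sub (hφ n).aesm_grad)
    simp only [sub_add_cancel] at this
    rw [modular_neg_sub] at this
    exact this.trans_lt (ENNReal.mul_lt_top ENNReal.ofReal_lt_top
      (ENNReal.add_lt_top.2 ⟨hn2.trans ENNReal.one_lt_top, (hφ n).modular_gradient_lt_top hΦ hΩ⟩))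

lemma memLp (h : IsLimitPair Ω Φ u v) (hΦ : IsQuadraticIntegrand Ω Φ C) (hΩ : volume Ω < ∞) :
    MemLp u 2 (volume.restrict Ω) :=
  hΦ.memLp_two h.aesm (h.modular_lt_top hΦ hΩ).1

lemma memLp_grad (h : IsLimitPair Ω Φ u v) (hΦ : IsQuadraticIntegrand Ω Φ C)
    (hΩ : volume Ω < ∞) : MemLp v 2 (volume.restrict Ω) :=
  hΦ.memLp_two h.aesm_grad (h.modular_lt_top hΦ hΩ).2

lemma add (h : IsLimitPair Ω Φ u v) (h' : IsLimitPair Ω Φ u' v')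
    (hΦ : IsQuadraticIntegrand Ω Φ C) :
    IsLimitPair Ω Φ (fun x => u x + u' x) (fun x => v x + v' x) := by
  obtain ⟨φ, hφ, h1, h2⟩ := h.exists_approx
  obtain ⟨ψ, hψ, h1', h2'⟩ := h'.exists_approx
  refine ⟨h.aesm.add h'.aesm, h.aesm_grad.add h'.aesm_grad, fun n x => φ n x + ψ n x,
    fun n => (hφ n).add (hψ n), ?_, ?_⟩
  · have := ENNReal.Tendsto.const_mul (a := ENNReal.ofReal (2 ^ C)) (h1.add h1')
      (Or.inr ENNReal.ofReal_ne_top)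
    rw [add_zero, mul_zero] at this
    refine tendsto_of_tendsto_of_tendsto_of_le_of_le tendsto_const_nhds this
      (fun _ => zero_le) fun n => ?_
    have h3 := hΦ.modular_add_le (u := fun x => φ n x - u x) (fun x => ψ n x - u' x)
      ((hφ n).aesm.sub h.aesm)
    simpa only [sub_add_sub_comm] using h3
  · have := ENNReal.Tendsto.const_mul (a := ENNReal.ofReal (2 ^ C)) (h2.add h2')
      (Or.inr ENNReal.ofReal_ne_top)
    rw [add_zero, mul_zero] at this
    refine tendsto_of_tendsto_of_tendsto_of_le_of_le tendsto_const_nhds this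
      (fun _ => zero_le) fun n => ?_
    have h3 := hΦ.modular_add_le (u := fun x => gradient (φ n) x - v x)
      (fun x => gradient (ψ n) x - v' x) ((hφ n).aesm_grad.sub h.aesm_grad)
    simpa only [sub_add_sub_comm, (hφ n).gradient_add (hψ n)] using h3

lemma smul (h : IsLimitPair Ω Φ u v) (hΦ : IsQuadraticIntegrand Ω Φ C) (c : ℝ) :
    IsLimitPair Ω Φ (fun x => c • u x) (fun x => c • v x) := by
  obtain ⟨φ, hφ, h1, h2⟩ := h.exists_approx
  refine ⟨h.aesm.const_smul c, h.aesm_grad.const_smul c, fun n x => c • φ n x,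
    fun n => (hφ n).smul c, ?_, ?_⟩
  · have := ENNReal.Tendsto.const_mul (a := ENNReal.ofReal ((|c| + 1) ^ C)) h1
      (Or.inr ENNReal.ofReal_ne_top)
    rw [mul_zero] at this
    refine tendsto_of_tendsto_of_tendsto_of_le_of_le tendsto_const_nhds this
      (fun _ => zero_le) fun n => ?_
    simpa only [smul_sub] using hΦ.modular_const_smul_le c (fun x => φ n x - u x)
  · have := ENNReal.Tendsto.const_mul (a := ENNReal.ofReal ((|c| + 1) ^ C)) h2
      (Or.inr ENNReal.ofReal_ne_top)
    rw [mul_zero] at this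
    refine tendsto_of_tendsto_of_tendsto_of_le_of_le tendsto_const_nhds this
      (fun _ => zero_le) fun n => ?_
    simpa only [smul_sub, (hφ n).gradient_smul c]
      using hΦ.modular_const_smul_le c (fun x => gradient (φ n) x - v x)

lemma sub (h : IsLimitPair Ω Φ u v) (h' : IsLimitPair Ω Φ u' v')
    (hΦ : IsQuadraticIntegrand Ω Φ C) :
    IsLimitPair Ω Φ (fun x => u x - u' x) (fun x => v x - v' x) := by
  simpa [sub_eq_add_neg] using h.add (h'.smul hΦ (-1)) hΦ

/-- Every `W_0^{1,Φ}` embeds into `W_0^{1,2}`. -/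
lemma powerFn_two (h : IsLimitPair Ω Φ u v) (hΦ : IsQuadraticIntegrand Ω Φ C) :
    IsLimitPair Ω (powerFn fun _ => 2) u v := by
  obtain ⟨φ, hφ, h1, h2⟩ := h.exists_approx
  have key : ∀ {F : Type} [NormedAddCommGroup F] (w : Space N → F),
      modular Ω (powerFn fun _ => 2) w ≤ modular Ω Φ w := fun w => by
    refine lintegral_mono_ae ?_
    filter_upwards [hΦ.sq_le] with x hx
    refine ENNReal.ofReal_le_ofReal ?_
    simpa [powerFn] using hx _ (norm_nonneg (w x))
  exact ⟨h.aesm, h.aesm_grad, φ, hφ,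
    tendsto_of_tendsto_of_tendsto_of_le_of_le tendsto_const_nhds h1 (fun _ => zero_le)
      fun n => key _,
    tendsto_of_tendsto_of_tendsto_of_le_of_le tendsto_const_nhds h2 (fun _ => zero_le)
      fun n => key _⟩

/-- A modular limit of limit pairs is a limit pair. -/
lemma of_tendsto (hΦ : IsQuadraticIntegrand Ω Φ C) {U : ℕ → Space N → ℝ}
    {V : ℕ → Space N → Space N} (h : ∀ n, IsLimitPair Ω Φ (U n) (V n))
    (hu : AEStronglyMeasurable u (volume.restrict Ω))
    (hv : AEStronglyMeasurable v (volume.restrict Ω))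
    (hU : Tendsto (fun n => modular Ω Φ (fun x => U n x - u x)) atTop (𝓝 0))
    (hV : Tendsto (fun n => modular Ω Φ (fun x => V n x - v x)) atTop (𝓝 0)) :
    IsLimitPair Ω Φ u v := by
  have hex : ∀ n : ℕ, ∃ φ, IsTestFunction Ω φ ∧
      modular Ω Φ (fun x => φ x - U n x) ≤ ENNReal.ofReal (1 / (n + 1 : ℝ)) ∧
      modular Ω Φ (fun x => gradient φ x - V n x) ≤ ENNReal.ofReal (1 / (n + 1 : ℝ)) := fun n => by
    obtain ⟨φ, hφ, h1, h2⟩ := (h n).exists_approx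
    have hpos : 0 < ENNReal.ofReal (1 / (n + 1 : ℝ)) := ENNReal.ofReal_pos.2 (by positivity)
    obtain ⟨k, hk⟩ := ((h1.eventually (gt_mem_nhds hpos)).and
      (h2.eventually (gt_mem_nhds hpos))).exists
    exact ⟨φ k, hφ k, hk.1.le, hk.2.le⟩
  choose φ hφ h1 h2 using hex
  have hz : Tendsto (fun n : ℕ => ENNReal.ofReal (1 / (n + 1 : ℝ))) atTop (𝓝 0) := by
    simpa using (ENNReal.tendsto_ofReal (tendsto_one_div_add_atTop_nhds_zero_nat (𝕜 := ℝ)))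
  refine ⟨hu, hv, φ, hφ, ?_, ?_⟩
  · have := ENNReal.Tendsto.const_mul (a := ENNReal.ofReal (2 ^ C)) (hz.add hU)
      (Or.inr ENNReal.ofReal_ne_top)
    rw [add_zero, mul_zero] at this
    refine tendsto_of_tendsto_of_tendsto_of_le_of_le tendsto_const_nhds this
      (fun _ => zero_le) fun n => ?_
    refine (hΦ.modular_sub_le (hφ n).aesm (h n).aesm).trans ?_
    gcongr
    exact h1 n
  · have := ENNReal.Tendsto.const_mul (a := ENNReal.ofReal (2 ^ C)) (hz.add hV)
      (Or.inr ENNReal.ofReal_ne_top)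
    rw [add_zero, mul_zero] at this
    refine tendsto_of_tendsto_of_tendsto_of_le_of_le tendsto_const_nhds this
      (fun _ => zero_le) fun n => ?_
    refine (hΦ.modular_sub_le (hφ n).aesm_grad (h n).aesm_grad).trans ?_
    gcongr
    exact h2 n

lemma hasWeakGradient (h : IsLimitPair Ω Φ u v) (hΦ : IsQuadraticIntegrand Ω Φ C)
    (hΩ : volume Ω < ∞) : HasWeakGradient Ω u v := by
  have : IsFiniteMeasure (volume.restrict Ω) := ⟨by simpa using hΩ⟩
  have hu := h.memLp hΦ hΩ
  have hv := h.memLp_grad hΦ hΩ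
  obtain ⟨φ, hφ, h1, h2⟩ := h.exists_approx
  refine ⟨IntegrableOn.locallyIntegrableOn (hu.integrable one_le_two),
    IntegrableOn.locallyIntegrableOn (hv.integrable one_le_two), fun ψ hψ => ?_⟩
  -- pairing with a bounded function is continuous under modular convergence
  obtain ⟨K, hK⟩ := hψ.continuous.bounded_above_of_compact_support hψ.2.1
  obtain ⟨K', hK'⟩ := hψ.continuous_gradient.bounded_above_of_compact_support
    hψ.hasCompactSupport_gradient
  have L1 : ∀ {F : Type} [NormedAddCommGroup F] [NormedSpace ℝ F] (w : ℕ → Space N → F)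
      (w₀ : Space N → F), (∀ n, AEStronglyMeasurable (fun x => w n x - w₀ x) (volume.restrict Ω)) →
      Tendsto (fun n => modular Ω Φ (fun x => w n x - w₀ x)) atTop (𝓝 0) →
      Tendsto (fun n => ∫⁻ x in Ω, ‖w n x - w₀ x‖ₑ) atTop (𝓝 0) := by
    intro F _ _ w w₀ hw hw0
    have hc : (volume.restrict Ω) Set.univ ^ (1 / 2 : ℝ) ≠ ∞ :=
      ENNReal.rpow_ne_top_of_nonneg (by norm_num) (measure_ne_top _ _)
    have h0 := ENNReal.Tendsto.mul_const (hΦ.tendsto_eLpNorm_two hw0) (Or.inr hc)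
    rw [zero_mul] at h0
    refine tendsto_of_tendsto_of_tendsto_of_le_of_le tendsto_const_nhds h0 (fun _ => zero_le)
      fun n => ?_
    have := eLpNorm_le_eLpNorm_mul_rpow_measure_univ (one_le_two (α := ℝ≥0∞)) (hw n)
    rw [eLpNorm_one_eq_lintegral_enorm] at this
    refine this.trans (le_of_eq ?_)
    norm_num
  have t1 : Tendsto (fun n => ∫ x in Ω, φ n x • gradient ψ x) atTop
      (𝓝 (∫ x in Ω, u x • gradient ψ x)) := by
    have i0 : ∀ w : Space N → ℝ, MemLp w 2 (volume.restrict Ω) →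
        Integrable (fun x => w x • gradient ψ x) (volume.restrict Ω) := fun w hw =>
      (hw.integrable one_le_two).smul_bdd K' hψ.aesm_grad (Eventually.of_forall hK')
    refine tendsto_integral_of_L1 _ (i0 _ hu).1 (Eventually.of_forall fun n => i0 _
      (hΦ.memLp_two (hφ n).aesm ((hφ n).modular_lt_top hΦ hΩ))) ?_
    have h0 := ENNReal.Tendsto.const_mul (a := ENNReal.ofReal K')
      (L1 φ u (fun n => (hφ n).aesm.sub h.aesm) h1) (Or.inr ENNReal.ofReal_ne_top)
    rw [mul_zero] at h0
    refine tendsto_of_tendsto_of_tendsto_of_le_of_le tendsto_const_nhds h0 (fun _ => zero_le)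
      fun n => ?_
    dsimp only
    rw [← lintegral_const_mul' _ _ ENNReal.ofReal_ne_top]
    refine lintegral_mono fun x => ?_
    rw [← sub_smul, enorm_smul, mul_comm]
    gcongr
    rw [← ofReal_norm]
    exact ENNReal.ofReal_le_ofReal (hK' x)
  have t2 : Tendsto (fun n => ∫ x in Ω, ψ x • gradient (φ n) x) atTop
      (𝓝 (∫ x in Ω, ψ x • v x)) := by
    have i0 : ∀ w : Space N → Space N, MemLp w 2 (volume.restrict Ω) →
        Integrable (fun x => ψ x • w x) (volume.restrict Ω) := fun w hw =>
      (hw.integrable one_le_two).bdd_smul K hψ.aesm (Eventually.of_forall hK)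
    refine tendsto_integral_of_L1 _ (i0 _ hv).1 (Eventually.of_forall fun n => i0 _
      (hΦ.memLp_two (hφ n).aesm_grad ((hφ n).modular_gradient_lt_top hΦ hΩ))) ?_
    have h0 := ENNReal.Tendsto.const_mul (a := ENNReal.ofReal K)
      (L1 (fun n => gradient (φ n)) v (fun n => (hφ n).aesm_grad.sub h.aesm_grad) h2)
      (Or.inr ENNReal.ofReal_ne_top)
    rw [mul_zero] at h0
    refine tendsto_of_tendsto_of_tendsto_of_le_of_le tendsto_const_nhds h0 (fun _ => zero_le)
      fun n => ?_
    dsimp only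
    rw [← lintegral_const_mul' _ _ ENNReal.ofReal_ne_top]
    refine lintegral_mono fun x => ?_
    rw [← smul_sub, enorm_smul]
    gcongr
    rw [← ofReal_norm]
    exact ENNReal.ofReal_le_ofReal (hK x)
  refine tendsto_nhds_unique t1 (t2.neg.congr fun n => ?_)
  exact ((hφ n).hasWeakGradient.2.2 ψ hψ).symm

end IsLimitPair

lemma HasWeakGradient.ae_eq (hΩ : IsOpen Ω) (h : HasWeakGradient Ω u v)
    (h' : HasWeakGradient Ω u v') : v =ᵐ[volume.restrict Ω] v' := by
  have := hΩ.ae_eq_zero_of_integral_contDiff_smul_eq_zero (f := fun x => v x - v' x)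
    (μ := volume) (h.2.1.sub h'.2.1) fun g h1 h2 h3 => ?_
  · refine (ae_restrict_iff' hΩ.measurableSet).2 ?_
    filter_upwards [this] with x hx hxΩ using sub_eq_zero.1 (hx hxΩ)
  have hg : IsTestFunction Ω g := ⟨h1, h2, h3⟩
  have hint : ∀ w : Space N → Space N, LocallyIntegrableOn w Ω →
      IntegrableOn (fun x => g x • w x) Ω := fun w hw => by
    obtain ⟨K, hK⟩ := hg.continuous.bounded_above_of_compact_support h2
    have h0 : IntegrableOn (fun x => g x • w x) (tsupport g) :=
      (hw.integrableOn_compact_subset h3 h2).bdd_smul K hg.continuous.aestronglyMeasurable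
        (Eventually.of_forall hK)
    refine ((integrableOn_iff_integrable_of_support_subset ?_).1 h0).integrableOn
    exact (Function.support_smul_subset_left g w).trans (subset_tsupport g)
  rw [← setIntegral_eq_integral_of_forall_compl_eq_zero (s := Ω)
    fun x hx => by rw [hg.eq_zero_of_notMem hx, zero_smul]]
  simp only [smul_sub]
  rw [integral_sub (hint v h.2.1) (hint v' h'.2.1), sub_eq_zero, ← neg_inj, ← h.2.2 g hg,
    ← h'.2.2 g hg]

end LimitPair

section LimitPair

variable {N : ℕ} {Ω : Set (Space N)} {Φ : Space N → ℝ → ℝ} {C : ℝ} {u : Space N → ℝ}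
  {v : Space N → Space N}

lemma hasWeakGradient_weakGrad (h : ∃ v, HasWeakGradient Ω u v) :
    HasWeakGradient Ω u (weakGrad Ω u) := by
  unfold weakGrad
  rw [dif_pos h]
  exact h.choose_spec

namespace IsLimitPair

lemma weakGrad_ae_eq (h : IsLimitPair Ω Φ u v) (hΦ : IsQuadraticIntegrand Ω Φ C)
    (ho : IsOpen Ω) (hΩ : volume Ω < ∞) : weakGrad Ω u =ᵐ[volume.restrict Ω] v :=
  (hasWeakGradient_weakGrad ⟨v, h.hasWeakGradient hΦ hΩ⟩).ae_eq ho (h.hasWeakGradient hΦ hΩ)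

lemma memWZero (h : IsLimitPair Ω Φ u v) (hΦ : IsQuadraticIntegrand Ω Φ C)
    (ho : IsOpen Ω) (hΩ : volume Ω < ∞) : MemWZero Ω Φ u := by
  have hw := h.congr (ae_eq_refl _) (h.weakGrad_ae_eq hΦ ho hΩ).symm
  have hm := hw.modular_lt_top hΦ hΩ
  obtain ⟨φ, hφ, h1, h2⟩ := hw.exists_approx
  refine ⟨⟨⟨h.aesm, hm.1⟩, ⟨v, h.hasWeakGradient hΦ hΩ⟩, hw.aesm_grad, hm.2⟩, φ, hφ, ?_⟩
  simpa using (hΦ.tendsto_luxemburgNorm_iff.2 h1).add (hΦ.tendsto_luxemburgNorm_iff.2 h2)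

end IsLimitPair

lemma MemWZero.isLimitPair (h : MemWZero Ω Φ u) (hΦ : IsQuadraticIntegrand Ω Φ C) :
    IsLimitPair Ω Φ u (weakGrad Ω u) := by
  obtain ⟨h0, φ, hφ, h1⟩ := h
  refine ⟨h0.memL.1, h0.memL_grad.1, φ, hφ, hΦ.tendsto_luxemburgNorm_iff.1 ?_,
    hΦ.tendsto_luxemburgNorm_iff.1 ?_⟩
  · exact tendsto_of_tendsto_of_tendsto_of_le_of_le tendsto_const_nhds h1 (fun _ => zero_le)
      fun n => le_self_add
  · exact tendsto_of_tendsto_of_tendsto_of_le_of_le tendsto_const_nhds h1 (fun _ => zero_le)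
      fun n => le_add_self

/-! ### Sobolev and Poincaré inequalities -/

/-- The Sobolev inequality on `W_0^{1,2}(Ω)`. -/
lemma exists_sobolev (hN : 3 ≤ N) (Ω : Set (Space N)) :
    ∃ K : NNReal, ∀ u v, IsLimitPair Ω (powerFn fun _ => 2) u v →
      eLpNorm u (ENNReal.ofReal (sobolevExponent N)) (volume.restrict Ω) ≤
        K * eLpNorm v 2 (volume.restrict Ω) := by
  obtain ⟨K, hK⟩ := exists_sobolev_testFunction hN Ω
  have hΦ := isQuadraticIntegrand_powerFn Ω hN
  refine ⟨K, fun u v h => ?_⟩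
  obtain ⟨φ, hφ, h1, h2⟩ := h.exists_approx
  obtain ⟨k, hk, hku⟩ := (tendstoInMeasure_of_tendsto_eLpNorm two_ne_zero
    (fun n => (hφ n).aesm) h.aesm (hΦ.tendsto_eLpNorm_two h1)).exists_seq_tendsto_ae
  have hlim := Lp.eLpNorm_lim_le_liminf_eLpNorm
    (p := ENNReal.ofReal (sobolevExponent N)) (fun n => (hφ (k n)).aesm) u hku
  have hg : Tendsto (fun n => (K : ℝ≥0∞) * (eLpNorm v 2 (volume.restrict Ω) +
      eLpNorm (fun x => gradient (φ (k n)) x - v x) 2 (volume.restrict Ω))) atTop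
      (𝓝 (K * (eLpNorm v 2 (volume.restrict Ω) + 0))) :=
    ENNReal.Tendsto.const_mul (tendsto_const_nhds.add
      ((hΦ.tendsto_eLpNorm_two h2).comp hk.tendsto_atTop)) (Or.inr ENNReal.coe_ne_top)
  rw [add_zero] at hg
  refine hlim.trans ?_
  rw [← hg.liminf_eq]
  refine liminf_le_liminf (Eventually.of_forall fun n => ?_)
  refine (hK _ (hφ (k n))).trans ?_
  gcongr
  have := eLpNorm_add_le (p := 2) h.aesm_grad ((hφ (k n)).aesm_grad.sub h.aesm_grad) one_le_two
  rwa [add_sub_cancel] at this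

lemma modular_powerFn_two {F : Type*} [NormedAddCommGroup F] (w : Space N → F) :
    modular Ω (powerFn fun _ => 2) w = eLpNorm w 2 (volume.restrict Ω) ^ 2 := by
  have := eLpNorm_nnreal_pow_eq_lintegral (f := w) (μ := volume.restrict Ω)
    (show (2 : NNReal) ≠ 0 by norm_num)
  have h2 : eLpNorm w 2 (volume.restrict Ω) ^ 2 = ∫⁻ x in Ω, ‖w x‖ₑ ^ 2 := by
    simpa using this
  rw [h2]
  refine lintegral_congr fun x => ?_
  rw [← ofReal_norm, ← ENNReal.ofReal_pow (norm_nonneg _)]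
  simp [powerFn]

lemma modular_powerFn_two_eq_integral {F : Type*} [NormedAddCommGroup F] {w : Space N → F}
    (hw : MemLp w 2 (volume.restrict Ω)) :
    modular Ω (powerFn fun _ => 2) w = ENNReal.ofReal (∫ x in Ω, ‖w x‖ ^ 2) := by
  rw [ofReal_integral_eq_lintegral_ofReal (hw.integrable_norm_pow two_ne_zero)
    (Eventually.of_forall fun x => by positivity)]
  simp [modular, powerFn]

lemma eLpNorm_two_sq_eq {F : Type*} [NormedAddCommGroup F] {w : Space N → F}
    (hw : MemLp w 2 (volume.restrict Ω)) :
    eLpNorm w 2 (volume.restrict Ω) ^ 2 = ENNReal.ofReal (∫ x in Ω, ‖w x‖ ^ 2) := by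
  rw [← modular_powerFn_two, modular_powerFn_two_eq_integral hw]

/-- Sobolev and Poincaré inequalities on `W_0^{1,2}(Ω)` for sets of finite measure. -/
lemma exists_sobolev_poincare (hN : 3 ≤ N) (hΩ : volume Ω < ∞) :
    ∃ K : NNReal, ∀ u v, IsLimitPair Ω (powerFn fun _ => 2) u v →
      eLpNorm u (ENNReal.ofReal (sobolevExponent N)) (volume.restrict Ω) ≤
        K * eLpNorm v 2 (volume.restrict Ω) ∧
      eLpNorm u 2 (volume.restrict Ω) ≤ K * eLpNorm v 2 (volume.restrict Ω) := by
  have hS := two_lt_sobolevExponent hN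
  obtain ⟨K, hK⟩ := exists_sobolev hN Ω
  have hfin : IsFiniteMeasure (volume.restrict Ω) := ⟨by simpa using hΩ⟩
  set c := (volume.restrict Ω) Set.univ ^ (1 / (2 : ℝ≥0∞).toReal -
    1 / (ENNReal.ofReal (sobolevExponent N)).toReal) with hc
  have hct : c ≠ ∞ := by
    refine ENNReal.rpow_ne_top_of_nonneg ?_ (measure_ne_top _ _)
    rw [ENNReal.toReal_ofReal (by linarith), ENNReal.toReal_ofNat, sub_nonneg]
    exact one_div_le_one_div_of_le (by norm_num) hS.le
  refine ⟨max K (K * c.toNNReal), fun u v h => ⟨(hK u v h).trans ?_, ?_⟩⟩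
  · gcongr
    exact le_max_left _ _
  · have h2 : (2 : ℝ≥0∞) ≤ ENNReal.ofReal (sobolevExponent N) := by
      rw [← ENNReal.ofReal_ofNat]
      exact ENNReal.ofReal_le_ofReal hS.le
    calc eLpNorm u 2 (volume.restrict Ω)
        ≤ eLpNorm u (ENNReal.ofReal (sobolevExponent N)) (volume.restrict Ω) * c :=
          eLpNorm_le_eLpNorm_mul_rpow_measure_univ h2 h.aesm
      _ ≤ K * eLpNorm v 2 (volume.restrict Ω) * c := by
          gcongr
          exact hK u v h
      _ = (K * c.toNNReal : NNReal) * eLpNorm v 2 (volume.restrict Ω) := by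
          rw [ENNReal.coe_mul, ENNReal.coe_toNNReal hct]
          ring
      _ ≤ _ := by
          gcongr
          exact le_max_right _ _

/-- Modulars of `u` are controlled by the Dirichlet integral, up to critical growth. -/
lemma exists_modular_le (hN : 3 ≤ N) (hΩ : volume Ω < ∞) (hΦ : IsQuadraticIntegrand Ω Φ C)
    {ε : ℝ≥0∞} (hε : 0 < ε) :
    ∃ δ : ℝ, 0 < δ ∧ ∀ u v, IsLimitPair Ω (powerFn fun _ => 2) u v →
      ∫ x in Ω, ‖v x‖ ^ 2 ≤ δ → modular Ω Φ u ≤ ε := by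
  have hS := two_lt_sobolevExponent hN
  obtain ⟨K, hK⟩ := exists_sobolev_poincare hN hΩ
  let G : ℝ≥0∞ → ℝ≥0∞ := fun a =>
    ENNReal.ofReal C * ((K * a) ^ 2 + (K * a) ^ sobolevExponent N)
  have hG : Tendsto G (𝓝 0) (𝓝 0) := by
    have h1 : Tendsto (fun a : ℝ≥0∞ => K * a) (𝓝 0) (𝓝 0) := by
      simpa using ENNReal.Tendsto.const_mul (tendsto_id (x := 𝓝 (0 : ℝ≥0∞)))
        (Or.inr (ENNReal.coe_ne_top (r := K)))
    have h2 := ENNReal.Tendsto.const_mul (a := ENNReal.ofReal C)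
      ((ENNReal.Tendsto.pow (n := 2) h1).add (h1.ennrpow_const (sobolevExponent N)))
      (Or.inr ENNReal.ofReal_ne_top)
    rw [ENNReal.zero_rpow_of_pos (by linarith)] at h2
    simpa using h2
  obtain ⟨η, hη, hηG⟩ := ENNReal.nhds_zero_basis.eventually_iff.1
    ((ENNReal.tendsto_nhds_zero.1 hG) ε hε)
  obtain ⟨d, hd0, hd⟩ := ENNReal.lt_iff_exists_nnreal_btwn.1 hη
  have hd0' : 0 < d := by exact_mod_cast hd0
  refine ⟨(d : ℝ) ^ 2, by positivity, fun u v h hv => ?_⟩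
  have hΦ2 := isQuadraticIntegrand_powerFn Ω hN
  have ht : eLpNorm v 2 (volume.restrict Ω) ≤ d := by
    refine (ENNReal.pow_le_pow_left_iff two_ne_zero).1 ?_
    rw [eLpNorm_two_sq_eq (h.memLp_grad hΦ2 hΩ)]
    refine (ENNReal.ofReal_le_ofReal hv).trans ?_
    rw [ENNReal.ofReal_pow d.coe_nonneg, ENNReal.ofReal_coe_nnreal]
  refine le_trans ?_ (hηG (lt_of_le_of_lt ht hd))
  have hm : AEMeasurable (fun x => ENNReal.ofReal (‖u x‖ ^ 2)) (volume.restrict Ω) :=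
    (h.aesm.norm.aemeasurable.pow_const 2).ennreal_ofReal
  calc modular Ω Φ u
      ≤ ∫⁻ x in Ω, ENNReal.ofReal C *
          (ENNReal.ofReal (‖u x‖ ^ 2) + ENNReal.ofReal (‖u x‖ ^ sobolevExponent N)) := by
        refine lintegral_mono_ae ?_
        filter_upwards [hΦ.le_critical] with x hx
        rw [← ENNReal.ofReal_add (by positivity) (by positivity),
          ← ENNReal.ofReal_mul (by linarith [hΦ.one_le])]
        exact ENNReal.ofReal_le_ofReal (hx _ (norm_nonneg _))
    _ = ENNReal.ofReal C * (eLpNorm u 2 (volume.restrict Ω) ^ 2 +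
          eLpNorm u (ENNReal.ofReal (sobolevExponent N)) (volume.restrict Ω) ^
            sobolevExponent N) := by
        rw [lintegral_const_mul' _ _ ENNReal.ofReal_ne_top, lintegral_add_left' hm,
          ← modular_powerFn_two]
        congr 2
        · simp [modular, powerFn]
        · have := eLpNorm_nnreal_pow_eq_lintegral (f := u) (μ := volume.restrict Ω)
            (p := (sobolevExponent N).toNNReal) (by
              rw [ne_eq, Real.toNNReal_eq_zero]; linarith)
          rw [Real.coe_toNNReal _ (by linarith)] at this
          refine Eq.trans ?_ this.symm
          refine lintegral_congr fun x => ?_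
          rw [← ofReal_norm, ENNReal.ofReal_rpow_of_nonneg (norm_nonneg _) (by linarith)]
    _ ≤ G (eLpNorm v 2 (volume.restrict Ω)) := by
        have := hK u v h
        dsimp only [G]
        gcongr
        · exact this.2
        · exact this.1

/-- The Poincaré inequality on `W_0^{1,2}(Ω)`, with some constant. -/
lemma exists_poincare (hN : 3 ≤ N) (hΩ : volume Ω < ∞) :
    ∃ K : ℝ, 0 < K ∧ ∀ u v, IsLimitPair Ω (powerFn fun _ => 2) u v →
      ∫ x in Ω, ‖u x‖ ^ 2 ≤ K * ∫ x in Ω, ‖v x‖ ^ 2 := by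
  obtain ⟨K, hK⟩ := exists_sobolev_poincare hN hΩ
  have hΦ2 := isQuadraticIntegrand_powerFn Ω hN
  refine ⟨(K : ℝ) ^ 2 + 1, by positivity, fun u v h => ?_⟩
  have h1 := pow_le_pow_left' (hK u v h).2 2
  have hv : 0 ≤ ∫ x in Ω, ‖v x‖ ^ 2 := integral_nonneg fun x => by positivity
  rw [mul_pow, eLpNorm_two_sq_eq (h.memLp_grad hΦ2 hΩ), eLpNorm_two_sq_eq (h.memLp hΦ2 hΩ),
    ← ENNReal.ofReal_coe_nnreal, ← ENNReal.ofReal_pow K.coe_nonneg, ← ENNReal.ofReal_mul (by positivity),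
    ENNReal.ofReal_le_ofReal_iff (by positivity)] at h1
  linarith

/-- `W_0^{1,Φ}(Ω)` is complete for the modular of the gradient. -/
lemma exists_limitPair_of_cauchy (hN : 3 ≤ N) (hΩ : volume Ω < ∞)
    (hΦ : IsQuadraticIntegrand Ω Φ C) {U : ℕ → Space N → ℝ} {V : ℕ → Space N → Space N}
    (h : ∀ n, IsLimitPair Ω Φ (U n) (V n))
    (hc : ∀ ε : ℝ≥0∞, 0 < ε → ∃ n₀, ∀ n ≥ n₀, ∀ m ≥ n₀,
      modular Ω Φ (fun x => V n x - V m x) ≤ ε) :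
    ∃ u v, IsLimitPair Ω Φ u v ∧
      Tendsto (fun n => modular Ω Φ (fun x => U n x - u x)) atTop (𝓝 0) ∧
      Tendsto (fun n => modular Ω Φ (fun x => V n x - v x)) atTop (𝓝 0) := by
  obtain ⟨v, hv, hV⟩ := hΦ.exists_tendsto_modular (fun n => (h n).memLp_grad hΦ hΩ) hc
  obtain ⟨u, hu, hU⟩ := hΦ.exists_tendsto_modular (fun n => (h n).memLp hΦ hΩ) (by
    intro ε hε
    obtain ⟨δ, hδ, hδ'⟩ := exists_modular_le hN hΩ hΦ hε
    obtain ⟨n₀, hn₀⟩ := hc (ENNReal.ofReal δ) (ENNReal.ofReal_pos.2 hδ)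
    refine ⟨n₀, fun n hn m hm => ?_⟩
    have hs := (h n).sub (h m) hΦ
    refine hδ' _ _ (hs.powerFn_two hΦ) ?_
    have := (hΦ.eLpNorm_two_le _).trans (hn₀ n hn m hm)
    rwa [eLpNorm_two_sq_eq (hs.memLp_grad hΦ hΩ), ENNReal.ofReal_le_ofReal_iff hδ.le] at this)
  exact ⟨u, v, .of_tendsto hΦ h hu hv hU hV, hU, hV⟩

end LimitPair

/-! ### Rellich compactness -/

lemma sq_lintegral_enorm_le {α F : Type*} [MeasurableSpace α] [NormedAddCommGroup F]
    {m : Measure α} {f : α → F} (hf : AEStronglyMeasurable f m) :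
    (∫⁻ x, ‖f x‖ₑ ∂m) ^ 2 ≤ m Set.univ * ∫⁻ x, ‖f x‖ₑ ^ 2 ∂m := by
  have h := eLpNorm_le_eLpNorm_mul_rpow_measure_univ (one_le_two (α := ℝ≥0∞)) hf
  rw [eLpNorm_one_eq_lintegral_enorm] at h
  have h2 : eLpNorm f 2 m ^ 2 = ∫⁻ x, ‖f x‖ₑ ^ 2 ∂m := by
    simpa using eLpNorm_nnreal_pow_eq_lintegral (f := f) (μ := m)
      (show (2 : NNReal) ≠ 0 by norm_num)
  refine (pow_le_pow_left' h 2).trans ?_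
  rw [mul_pow, h2, mul_comm, ← ENNReal.rpow_natCast, ← ENNReal.rpow_mul]
  norm_num

lemma ennreal_add_sq_le (a b : ℝ≥0∞) : (a + b) ^ 2 ≤ 2 * a ^ 2 + 2 * b ^ 2 := by
  have := ENNReal.rpow_add_le_mul_rpow_add_rpow a b (p := 2) (by norm_num)
  norm_num at this
  rwa [mul_add] at this

section Translation

variable {N : ℕ} {Ω : Set (Space N)} {φ : Space N → ℝ}

/-- `‖φ(· + y) - φ‖_2 ≤ |y| ‖∇φ‖_2`, by the fundamental theorem of calculus along segments. -/
lemma IsTestFunction.lintegral_translate_sub_le (h : IsTestFunction Ω φ) (y : Space N) :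
    ∫⁻ x, ‖φ (x + y) - φ x‖ₑ ^ 2 ≤ ‖y‖ₑ ^ 2 * ∫⁻ x, ‖gradient φ x‖ₑ ^ 2 := by
  have hc := h.continuous_gradient
  have hpt : ∀ x, ‖φ (x + y) - φ x‖ₑ ^ 2 ≤
      ∫⁻ t in Set.Icc (0 : ℝ) 1, ‖y‖ₑ ^ 2 * ‖gradient φ (x + t • y)‖ₑ ^ 2 := by
    intro x
    have hd : ∀ t ∈ Set.uIcc (0 : ℝ) 1,
        HasDerivAt (fun t : ℝ => φ (x + t • y)) (inner ℝ (gradient φ (x + t • y)) y) t := by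
      intro t _
      have h1 : HasDerivAt (fun t : ℝ => x + t • y) y t := by
        simpa using ((hasDerivAt_id t).smul_const y).const_add x
      have h2 := (h.differentiable (x + t • y)).hasFDerivAt.comp_hasDerivAt t h1
      rwa [gradient_eq, InnerProductSpace.toDual_symm_apply]
    have hcc : Continuous fun t : ℝ => inner ℝ (gradient φ (x + t • y)) y := by fun_prop
    have hftc := intervalIntegral.integral_eq_sub_of_hasDerivAt hd (hcc.intervalIntegrable 0 1)
    simp only [one_smul, zero_smul, add_zero] at hftc
    rw [← hftc, intervalIntegral.integral_of_le zero_le_one, ← integral_Icc_eq_integral_Ioc]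
    refine (pow_le_pow_left' (enorm_integral_le_lintegral_enorm _) 2).trans ?_
    refine (sq_lintegral_enorm_le hcc.aestronglyMeasurable).trans ?_
    simp only [Measure.restrict_apply_univ, Real.volume_Icc, sub_zero, ENNReal.ofReal_one, one_mul]
    refine lintegral_mono fun t => ?_
    rw [← mul_pow, mul_comm]
    refine pow_le_pow_left' ?_ 2
    rw [← ofReal_norm, ← ofReal_norm, ← ofReal_norm, ← ENNReal.ofReal_mul (norm_nonneg _)]
    exact ENNReal.ofReal_le_ofReal (norm_inner_le_norm _ _)
  refine (lintegral_mono hpt).trans ?_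
  have hm : Measurable fun z : Space N × ℝ => ‖y‖ₑ ^ 2 * ‖gradient φ (z.1 + z.2 • y)‖ₑ ^ 2 := by
    have : Continuous fun z : Space N × ℝ => gradient φ (z.1 + z.2 • y) := by fun_prop
    exact (this.enorm.measurable.pow_const 2).const_mul _
  rw [lintegral_lintegral_swap hm.aemeasurable]
  have hin : ∀ t : ℝ, ∫⁻ x, ‖y‖ₑ ^ 2 * ‖gradient φ (x + t • y)‖ₑ ^ 2 =
      ‖y‖ₑ ^ 2 * ∫⁻ x, ‖gradient φ x‖ₑ ^ 2 := fun t => by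
    rw [lintegral_const_mul' _ _ (by simp),
      lintegral_add_right_eq_self (fun x => ‖gradient φ x‖ₑ ^ 2)]
  simp [hin]

/-- The `L²`-norm of `φ` is controlled by that of its averages over balls of radius `δ`, up to an
error `δ ‖∇φ‖_2`. -/
lemma IsTestFunction.lintegral_sq_le_averages (h : IsTestFunction Ω φ) (δ : ℝ) :
    volume (Metric.ball (0 : Space N) δ) ^ 2 * ∫⁻ x in Ω, ‖φ x‖ₑ ^ 2 ≤
      2 * (volume (Metric.ball (0 : Space N) δ) ^ 2 *
        (ENNReal.ofReal δ ^ 2 * ∫⁻ x, ‖gradient φ x‖ₑ ^ 2)) +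
      2 * ∫⁻ x in Ω, ‖∫ y in Metric.ball (0 : Space N) δ, φ (x + y)‖ₑ ^ 2 := by
  set B := Metric.ball (0 : Space N) δ with hB
  have hBt : volume B ≠ ∞ := measure_ball_lt_top.ne
  have hc := h.continuous
  have hint : ∀ x, IntegrableOn (fun y => φ (x + y)) B := fun x =>
    ((show Continuous fun y => φ (x + y) by fun_prop).continuousOn.integrableOn_compact
      (isCompact_closedBall (0 : Space N) δ)).mono_set Metric.ball_subset_closedBall
  have hpt : ∀ x, volume B ^ 2 * ‖φ x‖ₑ ^ 2 ≤
      2 * (volume B * ∫⁻ y in B, ‖φ (x + y) - φ x‖ₑ ^ 2) + 2 * ‖∫ y in B, φ (x + y)‖ₑ ^ 2 := by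
    intro x
    have h1 : volume B * ‖φ x‖ₑ ≤
        (∫⁻ y in B, ‖φ (x + y) - φ x‖ₑ) + ‖∫ y in B, φ (x + y)‖ₑ := by
      have e1 : volume B * ‖φ x‖ₑ = ‖∫ _ in B, φ x‖ₑ := by
        rw [setIntegral_const, enorm_smul, measureReal_def, Real.enorm_of_nonneg ENNReal.toReal_nonneg,
          ENNReal.ofReal_toReal hBt]
      have e2 : ∫ _ in B, φ x = (∫ y in B, φ (x + y)) - ∫ y in B, (φ (x + y) - φ x) := by
        rw [integral_sub (hint x) (integrableOn_const hBt)]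
        ring
      rw [e1, e2, add_comm]
      refine (enorm_sub_le).trans ?_
      gcongr
      exact enorm_integral_le_lintegral_enorm _
    rw [← mul_pow]
    refine (pow_le_pow_left' h1 2).trans ((ennreal_add_sq_le _ _).trans ?_)
    gcongr
    have := sq_lintegral_enorm_le (m := volume.restrict B) (f := fun y => φ (x + y) - φ x)
      (by fun_prop)
    simpa using this
  have hm : Measurable fun z : Space N × Space N => ‖φ (z.1 + z.2) - φ z.1‖ₑ ^ 2 := by
    have : Continuous fun z : Space N × Space N => φ (z.1 + z.2) - φ z.1 := by fun_prop
    exact this.enorm.measurable.pow_const 2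
  rw [← lintegral_const_mul' _ _ (ENNReal.pow_ne_top hBt)]
  refine (lintegral_mono hpt).trans ?_
  rw [lintegral_add_left, lintegral_const_mul' _ _ (by simp), lintegral_const_mul' _ _ hBt,
    lintegral_const_mul' _ _ (by simp)]
  · rw [pow_two (volume B), mul_assoc (volume B) (volume B)]
    gcongr
    rw [lintegral_lintegral_swap hm.aemeasurable]
    calc ∫⁻ y in B, ∫⁻ x in Ω, ‖φ (x + y) - φ x‖ₑ ^ 2
        ≤ ∫⁻ y in B, ENNReal.ofReal δ ^ 2 * ∫⁻ x, ‖gradient φ x‖ₑ ^ 2 := by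
          refine setLIntegral_mono' measurableSet_ball fun y hy => ?_
          refine (setLIntegral_le_lintegral _ _).trans
            ((h.lintegral_translate_sub_le y).trans ?_)
          gcongr
          rw [← ofReal_norm]
          exact ENNReal.ofReal_le_ofReal (mem_ball_zero_iff.1 hy).le
      _ = _ := by simp [mul_comm]
  · exact ((hm.lintegral_prod_right').const_mul _).const_mul _

/-- Rellich's theorem: test functions that are bounded in `W_0^{1,2}(Ω)` have a subsequence which is
Cauchy in `L²(Ω)`. A weakly convergent subsequence has pointwise convergent, hence by dominated
convergence `L²`-convergent, averages over balls of any fixed radius. -/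
theorem exists_subseq_cauchy_of_gradient_bounded (hN : 3 ≤ N) (hΩ : volume Ω < ∞)
    {φ : ℕ → Space N → ℝ} {R : ℝ} (hφ : ∀ n, IsTestFunction Ω (φ n))
    (hR : ∀ n, ∫ x in Ω, ‖gradient (φ n) x‖ ^ 2 ≤ R) :
    ∃ k : ℕ → ℕ, StrictMono k ∧ ∀ ε : ℝ≥0∞, 0 < ε → ∃ n₀, ∀ n ≥ n₀, ∀ m ≥ n₀,
      ∫⁻ x in Ω, ‖φ (k n) x - φ (k m) x‖ₑ ^ 2 ≤ ε := by
  have hfin : IsFiniteMeasure (volume.restrict Ω) := ⟨by simpa using hΩ⟩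
  have hΦ := isQuadraticIntegrand_powerFn Ω hN
  obtain ⟨K, hK0, hK⟩ := exists_poincare hN hΩ
  have hL := fun n => IsLimitPair.of_testFunction hΦ (hφ n)
  have hLp := fun n => (hL n).memLp hΦ hΩ
  let f : ℕ → Lp ℝ 2 (volume.restrict Ω) := fun n => (hLp n).toLp
  have hR0 : 0 ≤ R := (integral_nonneg fun x => by positivity).trans (hR 0)
  obtain ⟨r, hr0, hr⟩ : ∃ r : ℝ, 0 ≤ r ∧ ∀ n, ‖f n‖ ≤ r := by
    refine ⟨Real.sqrt (K * R), Real.sqrt_nonneg _, fun n => ?_⟩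
    rw [Lp.norm_toLp]
    refine ENNReal.toReal_le_of_le_ofReal (Real.sqrt_nonneg _) ?_
    refine (ENNReal.pow_le_pow_left_iff two_ne_zero).1 ?_
    rw [eLpNorm_two_sq_eq (hLp n), ← ENNReal.ofReal_pow (Real.sqrt_nonneg _),
      Real.sq_sqrt (by positivity)]
    exact ENNReal.ofReal_le_ofReal ((hK _ _ (hL n)).trans (by gcongr; exact hR n))
  -- weak compactness in `L²(Ω)`
  have : Fact ((1 : ℝ≥0∞) ≤ 2) := ⟨one_le_two⟩
  have : Fact ((2 : ℝ≥0∞) ≠ ∞) := ⟨by simp⟩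
  obtain ⟨a, -, k, hk, hka⟩ := WeakDual.isSeqCompact_closedBall (𝕜 := ℝ)
    (E := Lp ℝ 2 (volume.restrict Ω)) 0 r
    (x := fun n => StrongDual.toWeakDual (innerSL ℝ (f n))) (fun n => by
      simpa [mem_closedBall_zero_iff] using hr n)
  have hweak : ∀ g : Lp ℝ 2 (volume.restrict Ω),
      Tendsto (fun n => inner ℝ (f (k n)) g) atTop (𝓝 (a g)) := fun g =>
    ((WeakDual.eval_continuous g).tendsto a).comp hka
  refine ⟨k, hk, fun ε hε => ?_⟩
  -- the radius is chosen to make the error of averaging at most `ε / 2`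
  obtain ⟨δ, hδ0, hδ⟩ : ∃ δ : ℝ, 0 < δ ∧
      2 * (ENNReal.ofReal δ ^ 2 * (4 * ENNReal.ofReal R)) ≤ ε / 2 := by
    have h1 : Tendsto (fun δ : ℝ => 2 * (ENNReal.ofReal δ ^ 2 * (4 * ENNReal.ofReal R)))
        (𝓝[>] 0) (𝓝 0) := by
      have h2 : Tendsto (fun δ : ℝ => ENNReal.ofReal δ) (𝓝[>] 0) (𝓝 0) := by
        simpa using (ENNReal.tendsto_ofReal (tendsto_id (x := 𝓝 (0 : ℝ)))).mono_left
          nhdsWithin_le_nhds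
      have h3 := ENNReal.Tendsto.const_mul (a := 2) (ENNReal.Tendsto.mul_const
        (b := 4 * ENNReal.ofReal R) (ENNReal.Tendsto.pow (n := 2) h2)
        (Or.inr (ENNReal.mul_ne_top (by simp) ENNReal.ofReal_ne_top))) (Or.inr (by simp))
      simpa using h3
    obtain ⟨δ, h2, h3⟩ := (((ENNReal.tendsto_nhds_zero.1 h1) (ε / 2)
      (ENNReal.half_pos hε.ne')).and self_mem_nhdsWithin).exists
    exact ⟨δ, h3, h2⟩
  set B := Metric.ball (0 : Space N) δ with hB
  have hBt : volume B ≠ ∞ := measure_ball_lt_top.ne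
  have hB0 : volume B ≠ 0 := (Metric.measure_ball_pos _ _ hδ0).ne'
  let g : Space N → Lp ℝ 2 (volume.restrict Ω) := fun x =>
    indicatorConstLp 2 (measurableSet_ball (x := x) (ε := δ)) (measure_ne_top _ _) (1 : ℝ)
  let A : ℕ → Space N → ℝ := fun n x => ∫ y in B, φ (k n) (x + y)
  have hA : ∀ n x, A n x = inner ℝ (f (k n)) (g x) := by
    intro n x
    rw [real_inner_comm, L2.inner_indicatorConstLp_one]
    have e1 : ∫ y in Metric.ball x δ, f (k n) y ∂volume.restrict Ω =
        ∫ y in Metric.ball x δ, φ (k n) y ∂volume.restrict Ω :=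
      integral_congr_ae (ae_restrict_of_ae (hLp (k n)).coeFn_toLp)
    have hpre : (fun y => x + y) ⁻¹' Metric.ball x δ = B := by
      ext y
      simp [hB]
    rw [e1, Measure.restrict_restrict measurableSet_ball,
      ← setIntegral_eq_of_subset_of_forall_sdiff_eq_zero measurableSet_ball Set.inter_subset_left
        fun y hy => (hφ (k n)).eq_zero_of_notMem fun h' => hy.2 ⟨hy.1, h'⟩,
      ← (measurePreserving_add_left volume x).setIntegral_preimage_emb
        (measurableEmbedding_addLeft x), hpre]
  have hgb : ∀ x, ‖g x‖ ≤ (volume.restrict Ω).real Set.univ ^ (1 / (2 : ℝ≥0∞).toReal) := by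
    intro x
    refine norm_indicatorConstLp_le.trans ?_
    rw [norm_one, one_mul]
    exact Real.rpow_le_rpow measureReal_nonneg (measureReal_mono (Set.subset_univ _)) (by simp)
  set b := (volume.restrict Ω).real Set.univ ^ (1 / (2 : ℝ≥0∞).toReal) with hb
  have hAb : ∀ n x, ‖A n x‖ ≤ r * b := fun n x => by
    rw [hA]
    exact (norm_inner_le_norm _ _).trans (mul_le_mul (hr _) (hgb x) (norm_nonneg _) hr0)
  have hAlim : ∀ x, Tendsto (fun n => A n x) atTop (𝓝 (a (g x))) := fun x => by
    simp only [hA]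
    exact hweak (g x)
  have hAm : ∀ n, Measurable (A n) := fun n => by
    have : Continuous fun z : Space N × Space N => φ (k n) (z.1 + z.2) :=
      (hφ (k n)).continuous.comp (by fun_prop)
    exact (this.stronglyMeasurable.integral_prod_right (ν := volume.restrict B)).measurable
  have hagm : Measurable fun x => a (g x) :=
    measurable_of_tendsto_metrizable hAm (tendsto_pi_nhds.2 hAlim)
  have hdct : Tendsto (fun n => ∫⁻ x in Ω, ‖A n x - a (g x)‖ₑ ^ 2) atTop (𝓝 0) := by
    have h1 := tendsto_lintegral_of_dominated_convergence' (μ := volume.restrict Ω)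
      (F := fun n x => ‖A n x - a (g x)‖ₑ ^ 2) (f := fun _ => 0)
      (fun _ => ENNReal.ofReal (r * b + r * b) ^ 2)
      (fun n => (((hAm n).sub hagm).enorm.pow_const 2).aemeasurable)
      (fun n => Eventually.of_forall fun x => by
        refine pow_le_pow_left' ?_ 2
        rw [← ofReal_norm]
        refine ENNReal.ofReal_le_ofReal ((norm_sub_le _ _).trans (add_le_add (hAb n x) ?_))
        exact le_of_tendsto (hAlim x).norm (Eventually.of_forall fun n => hAb n x))
      (by
        rw [lintegral_const]
        exact ENNReal.mul_ne_top (by simp) (measure_ne_top _ _))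
      (Eventually.of_forall fun x => by
        have h2 : Tendsto (fun n => ‖A n x - a (g x)‖ₑ) atTop (𝓝 0) := by
          have := ((hAlim x).sub_const (a (g x))).enorm
          simpa using this
        simpa using ENNReal.Tendsto.pow (n := 2) h2)
    simpa using h1
  obtain ⟨n₀, hn₀⟩ := eventually_atTop.1 ((ENNReal.tendsto_nhds_zero.1 hdct)
    (volume B ^ 2 * (ε / 2) / 2 / 4) (by
      refine ENNReal.div_pos (ENNReal.half_pos (mul_ne_zero (pow_ne_zero 2 hB0)
        (ENNReal.half_pos hε.ne').ne')).ne' (by simp)))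
  refine ⟨n₀, fun n hn m hm => ?_⟩
  have hd : IsTestFunction Ω (fun x => φ (k n) x - φ (k m) x) := by
    simpa [sub_eq_add_neg] using (hφ (k n)).add ((hφ (k m)).smul (-1))
  have hgrad : ∫⁻ x, ‖gradient (fun x => φ (k n) x - φ (k m) x) x‖ₑ ^ 2 ≤
      4 * ENNReal.ofReal R := by
    have h1 : ∀ j, ∫⁻ x, ‖gradient (φ j) x‖ₑ ^ 2 ≤ ENNReal.ofReal R := fun j => by
      refine le_trans (le_of_eq ?_) (ENNReal.ofReal_le_ofReal (hR j))
      rw [← modular_powerFn_two_eq_integral ((hL j).memLp_grad hΦ hΩ), modular_powerFn_two,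
        eLpNorm_restrict_eq_of_support_subset fun x hx =>
          by_contra fun hx' => hx ((hφ j).gradient_eq_zero_of_notMem hx')]
      simpa using (eLpNorm_nnreal_pow_eq_lintegral (f := gradient (φ j))
        (μ := (volume : Measure (Space N))) (show (2 : NNReal) ≠ 0 by norm_num)).symm
    calc ∫⁻ x, ‖gradient (fun x => φ (k n) x - φ (k m) x) x‖ₑ ^ 2
        ≤ ∫⁻ x, (2 * ‖gradient (φ (k n)) x‖ₑ ^ 2 + 2 * ‖gradient (φ (k m)) x‖ₑ ^ 2) := by
          refine lintegral_mono fun x => ?_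
          have e1 : gradient (fun x => φ (k n) x - φ (k m) x) x =
              gradient (φ (k n)) x - gradient (φ (k m)) x := by
            simp only [gradient_eq]
            rw [fderiv_fun_sub ((hφ _).differentiable x) ((hφ _).differentiable x), map_sub]
          rw [e1]
          exact (pow_le_pow_left' enorm_sub_le 2).trans (ennreal_add_sq_le _ _)
      _ = 2 * (∫⁻ x, ‖gradient (φ (k n)) x‖ₑ ^ 2) + 2 * ∫⁻ x, ‖gradient (φ (k m)) x‖ₑ ^ 2 := by
          rw [lintegral_add_left
            (((hφ (k n)).continuous_gradient.enorm.measurable.pow_const 2).const_mul 2),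
            lintegral_const_mul' _ _ (by simp), lintegral_const_mul' _ _ (by simp)]
      _ ≤ 2 * ENNReal.ofReal R + 2 * ENNReal.ofReal R := by
          gcongr <;> exact h1 _
      _ = 4 * ENNReal.ofReal R := by rw [← add_mul]; norm_num
  have hav : ∫⁻ x in Ω, ‖∫ y in B, (φ (k n) (x + y) - φ (k m) (x + y))‖ₑ ^ 2 ≤
      volume B ^ 2 * (ε / 2) / 2 := by
    have hint : ∀ j x, IntegrableOn (fun y => φ j (x + y)) B := fun j x =>
      (((hφ j).continuous.comp (continuous_const.add continuous_id)).continuousOn.integrableOn_compact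
        (isCompact_closedBall (0 : Space N) δ)).mono_set Metric.ball_subset_closedBall
    calc ∫⁻ x in Ω, ‖∫ y in B, (φ (k n) (x + y) - φ (k m) (x + y))‖ₑ ^ 2
        ≤ ∫⁻ x in Ω, (2 * ‖A n x - a (g x)‖ₑ ^ 2 + 2 * ‖A m x - a (g x)‖ₑ ^ 2) := by
          refine lintegral_mono fun x => ?_
          rw [integral_sub (hint _ x) (hint _ x),
            show (∫ y in B, φ (k n) (x + y)) - ∫ y in B, φ (k m) (x + y) =
              (A n x - a (g x)) - (A m x - a (g x)) by ring]
          exact (pow_le_pow_left' enorm_sub_le 2).trans (ennreal_add_sq_le _ _)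
      _ = 2 * (∫⁻ x in Ω, ‖A n x - a (g x)‖ₑ ^ 2) + 2 * ∫⁻ x in Ω, ‖A m x - a (g x)‖ₑ ^ 2 := by
          rw [lintegral_add_left (f := fun x => 2 * ‖A n x - a (g x)‖ₑ ^ 2)
              ((((hAm n).sub hagm).enorm.pow_const 2).const_mul 2),
            lintegral_const_mul' _ _ (by simp), lintegral_const_mul' _ _ (by simp)]
      _ ≤ 2 * (volume B ^ 2 * (ε / 2) / 2 / 4) + 2 * (volume B ^ 2 * (ε / 2) / 2 / 4) := by
          gcongr
          · exact hn₀ n hn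
          · exact hn₀ m hm
      _ = volume B ^ 2 * (ε / 2) / 2 := by
          rw [← add_mul, show (2 + 2 : ℝ≥0∞) = 4 by norm_num,
            ENNReal.mul_div_cancel (by simp) (by simp)]
  have hfinal := hd.lintegral_sq_le_averages δ
  rw [← hB] at hfinal
  refine (ENNReal.mul_le_mul_iff_right (pow_ne_zero 2 hB0) (ENNReal.pow_ne_top hBt)).1 ?_
  calc _ ≤ _ := hfinal
    _ ≤ volume B ^ 2 * (2 * (ENNReal.ofReal δ ^ 2 * (4 * ENNReal.ofReal R))) +
        2 * (volume B ^ 2 * (ε / 2) / 2) := by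
        rw [mul_left_comm 2]
        gcongr
    _ ≤ volume B ^ 2 * (ε / 2) + volume B ^ 2 * (ε / 2) := by
        rw [ENNReal.mul_div_cancel (by simp) (by simp)]
        gcongr
    _ = volume B ^ 2 * ε := by rw [← mul_add, ENNReal.add_halves]

end Translation

/-! ### The first eigenvalue -/

section Quadratic

variable {α F : Type*} [MeasurableSpace α] {m : Measure α} [NormedAddCommGroup F]

lemma norm_toLp_sq {v : α → F} (hv : MemLp v 2 m) : ‖hv.toLp‖ ^ 2 = ∫ x, ‖v x‖ ^ 2 ∂m := by
  rw [Lp.norm_toLp, ← ENNReal.toReal_pow]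
  have h2 : eLpNorm v 2 m ^ 2 = ∫⁻ x, ‖v x‖ₑ ^ 2 ∂m := by
    simpa using eLpNorm_nnreal_pow_eq_lintegral (f := v) (μ := m)
      (show (2 : NNReal) ≠ 0 by norm_num)
  rw [h2, integral_eq_lintegral_of_nonneg_ae (Eventually.of_forall fun x => by positivity)
    (hv.integrable_norm_pow two_ne_zero).1]
  simp only [ENNReal.ofReal_pow (norm_nonneg _), ofReal_norm]

lemma tendsto_integral_norm_sq {w : ℕ → α → F} {w₀ : α → F} (hw : ∀ n, MemLp (w n) 2 m)
    (hw₀ : MemLp w₀ 2 m) (h : Tendsto (fun n => eLpNorm (fun x => w n x - w₀ x) 2 m) atTop (𝓝 0)) :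
    Tendsto (fun n => ∫ x, ‖w n x‖ ^ 2 ∂m) atTop (𝓝 (∫ x, ‖w₀ x‖ ^ 2 ∂m)) := by
  have h1 : Tendsto (fun n => (hw n).toLp) atTop (𝓝 hw₀.toLp) :=
    (Lp.tendsto_Lp_iff_tendsto_eLpNorm'' _ hw _ hw₀).2 h
  simpa only [norm_toLp_sq] using h1.norm.pow 2

variable [InnerProductSpace ℝ F]

lemma integrable_inner {v w : α → F} (hv : MemLp v 2 m) (hw : MemLp w 2 m) :
    Integrable (fun x => inner ℝ (v x) (w x)) m := by
  refine (L2.integrable_inner (𝕜 := ℝ) hv.toLp hw.toLp).congr ?_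
  filter_upwards [hv.coeFn_toLp, hw.coeFn_toLp] with x h1 h2
  rw [h1, h2]

lemma integral_norm_add_smul_sq {v w : α → F} (hv : MemLp v 2 m) (hw : MemLp w 2 m) (t : ℝ) :
    ∫ x, ‖v x + t • w x‖ ^ 2 ∂m =
      ∫ x, ‖v x‖ ^ 2 ∂m + 2 * t * ∫ x, inner ℝ (v x) (w x) ∂m + t ^ 2 * ∫ x, ‖w x‖ ^ 2 ∂m := by
  have i1 := hv.integrable_norm_pow two_ne_zero
  have i2 := hw.integrable_norm_pow two_ne_zero
  have i3 := integrable_inner hv hw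
  have j1 : Integrable (fun x => ‖v x‖ ^ 2 + 2 * t * inner ℝ (v x) (w x)) m :=
    i1.add (i3.const_mul _)
  have j2 : Integrable (fun x => t ^ 2 * ‖w x‖ ^ 2) m := i2.const_mul _
  rw [← integral_const_mul, ← integral_const_mul, ← integral_add i1 (i3.const_mul _),
    ← integral_add j1 j2]
  refine integral_congr_ae (Eventually.of_forall fun x => ?_)
  dsimp only
  rw [norm_add_sq_real, inner_smul_right, norm_smul, mul_pow, Real.norm_eq_abs, sq_abs]
  ring

lemma integral_parallelogram {v w : α → F} (hv : MemLp v 2 m) (hw : MemLp w 2 m) :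
    ∫ x, ‖v x - w x‖ ^ 2 ∂m =
      2 * ∫ x, ‖v x‖ ^ 2 ∂m + 2 * ∫ x, ‖w x‖ ^ 2 ∂m - ∫ x, ‖v x + w x‖ ^ 2 ∂m := by
  have h1 := integral_norm_add_smul_sq hv hw 1
  have h2 := integral_norm_add_smul_sq hv hw (-1)
  simp only [one_smul, neg_smul, ← sub_eq_add_neg] at h1 h2
  rw [h1, h2]
  ring

end Quadratic

lemma eq_zero_of_forall_nonneg_quadratic {a b : ℝ} (h : ∀ t : ℝ, 0 ≤ 2 * t * a + t ^ 2 * b) :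
    a = 0 := by
  have h1 := h (-a / (|b| + 1))
  have hb : 0 < |b| + 1 := by positivity
  have h2 : 2 * (-a / (|b| + 1)) * a + (-a / (|b| + 1)) ^ 2 * b =
      a ^ 2 * (b - 2 * (|b| + 1)) / (|b| + 1) ^ 2 := by
    field_simp
    ring
  rw [h2] at h1
  by_contra ha
  have h3 : a ^ 2 * (b - 2 * (|b| + 1)) < 0 :=
    mul_neg_of_pos_of_neg (by positivity) (by linarith [le_abs_self b, abs_nonneg b])
  exact absurd h1 (not_le.2 (div_neg_of_neg_of_pos h3 (by positivity)))

section Eigenvalue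

variable {N : ℕ} {Ω : Set (Space N)}

/-- The infimum of the Rayleigh quotient over the test functions. -/
def rayleighInf (Ω : Set (Space N)) : ℝ :=
  sInf {l | ∃ φ, IsTestFunction Ω φ ∧ ∫ x in Ω, ‖φ x‖ ^ 2 = 1 ∧
    l = ∫ x in Ω, ‖gradient φ x‖ ^ 2}

lemma rayleighInf_le {φ : Space N → ℝ} (h : IsTestFunction Ω φ) (h1 : ∫ x in Ω, ‖φ x‖ ^ 2 = 1) :
    rayleighInf Ω ≤ ∫ x in Ω, ‖gradient φ x‖ ^ 2 := by
  refine csInf_le ⟨0, ?_⟩ ⟨φ, h, h1, rfl⟩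
  rintro _ ⟨ψ, -, -, rfl⟩
  exact integral_nonneg fun x => by positivity

lemma exists_testFunction_integral_sq_eq_one (ho : IsOpen Ω) (hne : Ω.Nonempty) :
    ∃ φ, IsTestFunction Ω φ ∧ ∫ x in Ω, ‖φ x‖ ^ 2 = 1 := by
  obtain ⟨x₀, hx₀⟩ := hne
  obtain ⟨g, h1, h2, h3, -, h5⟩ := exists_contDiff_tsupport_subset (n := ⊤) (ho.mem_nhds hx₀)
  have hg : IsTestFunction Ω g := ⟨h3, h2, h1⟩
  have hpos : 0 < ∫ x in Ω, ‖g x‖ ^ 2 := by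
    rw [setIntegral_eq_integral_of_forall_compl_eq_zero
      fun x hx => by rw [hg.eq_zero_of_notMem hx]; simp]
    refine Continuous.integral_pos_of_hasCompactSupport_nonneg_nonzero (x := x₀)
      (hg.continuous.norm.pow 2) ?_ (fun x => by positivity) (by simp [h5])
    exact h2.comp_left (g := fun t : ℝ => ‖t‖ ^ 2) (by simp)
  refine ⟨fun x => (Real.sqrt (∫ x in Ω, ‖g x‖ ^ 2))⁻¹ • g x, hg.smul _, ?_⟩
  simp only [norm_smul, mul_pow]
  rw [integral_const_mul, norm_inv, Real.norm_of_nonneg (Real.sqrt_nonneg _), inv_pow,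
    Real.sq_sqrt hpos.le, inv_mul_cancel₀ hpos.ne']

lemma rayleighInf_mul_le_testFunction {φ : Space N → ℝ} (h : IsTestFunction Ω φ) :
    rayleighInf Ω * ∫ x in Ω, ‖φ x‖ ^ 2 ≤ ∫ x in Ω, ‖gradient φ x‖ ^ 2 := by
  have h0 : 0 ≤ ∫ x in Ω, ‖φ x‖ ^ 2 := integral_nonneg fun x => by positivity
  rcases h0.eq_or_lt with h1 | h1
  · rw [← h1, mul_zero]
    exact integral_nonneg fun x => by positivity
  set s := ∫ x in Ω, ‖φ x‖ ^ 2 with hs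
  have h2 := rayleighInf_le (h.smul (Real.sqrt s)⁻¹) (by
    simp only [norm_smul, mul_pow]
    rw [integral_const_mul, norm_inv, Real.norm_of_nonneg (Real.sqrt_nonneg _), inv_pow,
      Real.sq_sqrt h0, ← hs, inv_mul_cancel₀ h1.ne'])
  simp only [h.gradient_smul, norm_smul, mul_pow] at h2
  rw [integral_const_mul, norm_inv, Real.norm_of_nonneg (Real.sqrt_nonneg _), inv_pow,
    Real.sq_sqrt h0, le_inv_mul_iff₀ h1] at h2
  linarith

variable {u : Space N → ℝ} {v : Space N → Space N}

lemma rayleighInf_mul_le (hN : 3 ≤ N) (hΩ : volume Ω < ∞)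
    (h : IsLimitPair Ω (powerFn fun _ => 2) u v) :
    rayleighInf Ω * ∫ x in Ω, ‖u x‖ ^ 2 ≤ ∫ x in Ω, ‖v x‖ ^ 2 := by
  have hΦ := isQuadraticIntegrand_powerFn Ω hN
  obtain ⟨φ, hφ, h1, h2⟩ := h.exists_approx
  have hL := fun n => IsLimitPair.of_testFunction hΦ (hφ n)
  refine le_of_tendsto_of_tendsto'
    ((tendsto_integral_norm_sq (fun n => (hL n).memLp hΦ hΩ) (h.memLp hΦ hΩ)
      (hΦ.tendsto_eLpNorm_two h1)).const_mul _)
    (tendsto_integral_norm_sq (fun n => (hL n).memLp_grad hΦ hΩ) (h.memLp_grad hΦ hΩ)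
      (hΦ.tendsto_eLpNorm_two h2)) fun n => rayleighInf_mul_le_testFunction (hφ n)

lemma rayleighInf_pos (hN : 3 ≤ N) (hΩ : volume Ω < ∞) (ho : IsOpen Ω) (hne : Ω.Nonempty) :
    0 < rayleighInf Ω := by
  obtain ⟨K, hK0, hK⟩ := exists_poincare hN hΩ
  refine (inv_pos.2 hK0).trans_le (le_csInf ?_ ?_)
  · obtain ⟨φ, hφ, h1⟩ := exists_testFunction_integral_sq_eq_one ho hne
    exact ⟨_, φ, hφ, h1, rfl⟩
  · rintro _ ⟨φ, hφ, h1, rfl⟩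
    have := hK _ _ (IsLimitPair.of_testFunction (isQuadraticIntegrand_powerFn Ω hN) hφ)
    rw [h1] at this
    rw [inv_le_iff_one_le_mul₀ hK0]
    linarith

/-- The Rayleigh quotient attains its infimum: by Rellich's theorem a minimizing sequence may be
taken Cauchy in `L²`, and the parallelogram identity makes its gradients Cauchy as well. -/
lemma exists_rayleigh_minimizer (hN : 3 ≤ N) (hΩ : volume Ω < ∞) (ho : IsOpen Ω)
    (hne : Ω.Nonempty) :
    ∃ u v, IsLimitPair Ω (powerFn fun _ => 2) u v ∧ ∫ x in Ω, ‖u x‖ ^ 2 = 1 ∧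
      ∫ x in Ω, ‖v x‖ ^ 2 = rayleighInf Ω := by
  have hΦ := isQuadraticIntegrand_powerFn Ω hN
  have hpos := rayleighInf_pos hN hΩ ho hne
  have hex : ∀ n : ℕ, ∃ φ, IsTestFunction Ω φ ∧ ∫ x in Ω, ‖φ x‖ ^ 2 = 1 ∧
      ∫ x in Ω, ‖gradient φ x‖ ^ 2 < rayleighInf Ω + 1 / (n + 1 : ℝ) := fun n => by
    obtain ⟨φ, hφ, h1⟩ := exists_testFunction_integral_sq_eq_one ho hne
    obtain ⟨_, ⟨ψ, hψ, h2, rfl⟩, h3⟩ := exists_lt_of_csInf_lt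
      (s := {l | ∃ φ, IsTestFunction Ω φ ∧ ∫ x in Ω, ‖φ x‖ ^ 2 = 1 ∧
        l = ∫ x in Ω, ‖gradient φ x‖ ^ 2}) ⟨_, φ, hφ, h1, rfl⟩
      (show rayleighInf Ω < rayleighInf Ω + 1 / (n + 1 : ℝ) by
        have : (0 : ℝ) < 1 / (n + 1 : ℝ) := by positivity
        linarith)
    exact ⟨ψ, hψ, h2, h3⟩
  choose φ hφ h1 h2 using hex
  obtain ⟨k, hk, hc⟩ := exists_subseq_cauchy_of_gradient_bounded hN hΩ hφ
    (R := rayleighInf Ω + 1) fun n => by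
      refine (h2 n).le.trans (add_le_add_right ?_ _)
      rw [div_le_one (by positivity)]
      linarith [(Nat.cast_nonneg n : (0 : ℝ) ≤ n)]
  have hL := fun n => IsLimitPair.of_testFunction hΦ (hφ n)
  have hg2 := fun n => (hL n).memLp_grad hΦ hΩ
  have hu2 := fun n => (hL n).memLp hΦ hΩ
  have hest : ∀ n m, ∫ x in Ω, ‖gradient (φ n) x - gradient (φ m) x‖ ^ 2 ≤
      2 * (1 / (n + 1 : ℝ)) + 2 * (1 / (m + 1 : ℝ)) +
        rayleighInf Ω * ∫ x in Ω, ‖φ n x - φ m x‖ ^ 2 := by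
    intro n m
    have e1 := integral_parallelogram (hg2 n) (hg2 m)
    have e2 := integral_parallelogram (hu2 n) (hu2 m)
    have e3 := rayleighInf_mul_le hN hΩ ((hL n).add (hL m) hΦ)
    rw [h1, h1] at e2
    have e4 : ∫ x in Ω, ‖φ n x + φ m x‖ ^ 2 = 4 - ∫ x in Ω, ‖φ n x - φ m x‖ ^ 2 := by linarith
    rw [e4] at e3
    linarith [h2 n, h2 m]
  obtain ⟨u, v, huv, hU, hV⟩ := exists_limitPair_of_cauchy hN hΩ hΦ (fun n => hL (k n)) (by
    intro ε hε
    obtain ⟨e, he0, he⟩ : ∃ e : ℝ, 0 < e ∧ ENNReal.ofReal e ≤ ε := by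
      obtain ⟨d, hd0, hd⟩ := ENNReal.lt_iff_exists_nnreal_btwn.1 hε
      exact ⟨d, by exact_mod_cast hd0, by simpa using hd.le⟩
    obtain ⟨n₁, hn₁⟩ := hc (ENNReal.ofReal (e / (2 * rayleighInf Ω)))
      (ENNReal.ofReal_pos.2 (by positivity))
    have ht := tendsto_one_div_add_atTop_nhds_zero_nat (𝕜 := ℝ)
    obtain ⟨n₂, hn₂⟩ := eventually_atTop.1
      ((ht.eventually (gt_mem_nhds (show 0 < e / 8 by positivity))))
    refine ⟨max n₁ n₂, fun n hn m hm => ?_⟩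
    rw [modular_powerFn_two_eq_integral
      (w := fun x => gradient (φ (k n)) x - gradient (φ (k m)) x) ((hg2 _).sub (hg2 _))]
    refine (ENNReal.ofReal_le_ofReal ((hest _ _).trans ?_)).trans he
    have a1 := hn₂ (k n) (((le_max_right _ _).trans hn).trans hk.le_apply)
    have a2 := hn₂ (k m) (((le_max_right _ _).trans hm).trans hk.le_apply)
    have a3 := hn₁ n ((le_max_left _ _).trans hn) m ((le_max_left _ _).trans hm)
    have a4 : ∫ x in Ω, ‖φ (k n) x - φ (k m) x‖ ^ 2 ≤ e / (2 * rayleighInf Ω) := by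
      rw [← ENNReal.ofReal_le_ofReal_iff (by positivity)]
      refine le_trans (le_of_eq ?_) a3
      rw [ofReal_integral_eq_lintegral_ofReal
        (f := fun x => ‖φ (k n) x - φ (k m) x‖ ^ 2) (((hu2 (k n)).sub (hu2 (k m))).integrable_norm_pow two_ne_zero)
        (Eventually.of_forall fun x => by positivity)]
      simp only [ENNReal.ofReal_pow (norm_nonneg _), ofReal_norm]
    have a5 : rayleighInf Ω * ∫ x in Ω, ‖φ (k n) x - φ (k m) x‖ ^ 2 ≤ e / 2 := by
      calc _ ≤ rayleighInf Ω * (e / (2 * rayleighInf Ω)) := by gcongr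
        _ = e / 2 := by field_simp
    linarith)
  have lu := tendsto_integral_norm_sq (fun n => hu2 (k n)) (huv.memLp hΦ hΩ)
    (hΦ.tendsto_eLpNorm_two hU)
  have lv := tendsto_integral_norm_sq (fun n => hg2 (k n)) (huv.memLp_grad hΦ hΩ)
    (hΦ.tendsto_eLpNorm_two hV)
  simp only [h1] at lu
  have hu1 := tendsto_nhds_unique lu tendsto_const_nhds
  refine ⟨u, v, huv, hu1, le_antisymm ?_ ?_⟩
  · refine le_of_tendsto_of_tendsto' lv
      (g := fun n => rayleighInf Ω + 1 / ((k n : ℕ) + 1 : ℝ)) ?_ fun n => (h2 (k n)).le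
    simpa using (tendsto_const_nhds (x := rayleighInf Ω)).add
      ((tendsto_one_div_add_atTop_nhds_zero_nat (𝕜 := ℝ)).comp hk.tendsto_atTop)
  · have := rayleighInf_mul_le hN hΩ huv
    rwa [hu1, mul_one] at this

lemma isDirichletEigenvalue_rayleighInf (hN : 3 ≤ N) (hΩ : volume Ω < ∞) (ho : IsOpen Ω)
    (hne : Ω.Nonempty) : IsDirichletEigenvalue 2 Ω (rayleighInf Ω) := by
  have hΦ := isQuadraticIntegrand_powerFn Ω hN
  obtain ⟨u, v, huv, hu, hv⟩ := exists_rayleigh_minimizer hN hΩ ho hne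
  have hu2 := huv.memLp hΦ hΩ
  have hv2 := huv.memLp_grad hΦ hΩ
  refine ⟨u, huv.memWZero hΦ ho hΩ, fun h0 => ?_, fun φ hφ => ?_⟩
  · rw [integral_congr_ae (g := fun _ => 0) (by
      filter_upwards [h0] with x hx
      simp [hx])] at hu
    simp at hu
  · have hφp := hφ.isLimitPair hΦ
    have hgu := huv.weakGrad_ae_eq hΦ ho hΩ
    simp only [sub_self, Real.rpow_zero, one_smul, one_mul]
    have e1 : ∫ x in Ω, inner ℝ (weakGrad Ω u x) (weakGrad Ω φ x) =
        ∫ x in Ω, inner ℝ (v x) (weakGrad Ω φ x) := by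
      refine integral_congr_ae ?_
      filter_upwards [hgu] with x hx
      rw [hx]
    have e2 : ∫ x in Ω, u x * φ x = ∫ x in Ω, inner ℝ (u x) (φ x) := by
      refine integral_congr_ae (Eventually.of_forall fun x => ?_)
      simp [mul_comm]
    rw [e1, e2, ← sub_eq_zero]
    -- the first variation of `∫ |∇u|² - λ ∫ u²` at its minimum vanishes
    refine eq_zero_of_forall_nonneg_quadratic (b := (∫ x in Ω, ‖weakGrad Ω φ x‖ ^ 2) -
      rayleighInf Ω * ∫ x in Ω, ‖φ x‖ ^ 2) fun t => ?_
    have h3 := rayleighInf_mul_le hN hΩ (huv.add (hφp.smul hΦ t) hΦ)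
    rw [integral_norm_add_smul_sq hu2 (hφp.memLp hΦ hΩ),
      integral_norm_add_smul_sq hv2 (hφp.memLp_grad hΦ hΩ), hu, hv] at h3
    linarith

lemma firstEigenvalue_two_eq (hN : 3 ≤ N) (hΩ : volume Ω < ∞) (ho : IsOpen Ω)
    (hne : Ω.Nonempty) : firstEigenvalue 2 Ω = rayleighInf Ω := by
  have hΦ := isQuadraticIntegrand_powerFn Ω hN
  have hlow : ∀ l, IsDirichletEigenvalue 2 Ω l → rayleighInf Ω ≤ l := by
    rintro l ⟨w, hw, hw0, hl⟩
    have hwp := hw.isLimitPair hΦ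
    have h1 := hl w hw
    simp only [sub_self, Real.rpow_zero, one_smul, one_mul, real_inner_self_eq_norm_sq] at h1
    have h2 := rayleighInf_mul_le hN hΩ hwp
    have e : ∫ x in Ω, w x * w x = ∫ x in Ω, ‖w x‖ ^ 2 :=
      integral_congr_ae (Eventually.of_forall fun x => by simp [pow_two])
    rw [h1, e] at h2
    refine le_of_mul_le_mul_right h2 ?_
    refine (integral_nonneg fun x => by positivity).lt_of_ne' fun h0 => hw0 ?_
    rw [integral_eq_zero_iff_of_nonneg (fun x => by positivity)
      ((hwp.memLp hΦ hΩ).integrable_norm_pow two_ne_zero)] at h0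
    filter_upwards [h0] with x hx
    simpa using hx
  have he := isDirichletEigenvalue_rayleighInf hN hΩ ho hne
  exact le_antisymm (csInf_le ⟨_, hlow⟩ he) (le_csInf ⟨_, he⟩ hlow)

end Eigenvalue

/-! ### Power functions of the norm in a Hilbert space -/

section Pointwise

variable {E : Type*} [NormedAddCommGroup E] [InnerProductSpace ℝ E] {q : ℝ}

lemma rpow_sub_two_mul_sq {t : ℝ} (ht : 0 ≤ t) (hq : 2 ≤ q) : t ^ (q - 2) * t ^ 2 = t ^ q := by
  rw [← Real.rpow_two, ← Real.rpow_add_of_nonneg ht (by linarith) (by norm_num)]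
  congr 1
  ring

/-- Clarkson's inequality for exponents at least two. -/
lemma norm_rpow_half_sub_add_le (hq : 2 ≤ q) (a b : E) :
    ‖(2⁻¹ : ℝ) • (a - b)‖ ^ q + ‖(2⁻¹ : ℝ) • (a + b)‖ ^ q ≤ (‖a‖ ^ q + ‖b‖ ^ q) / 2 := by
  have hsq : ∀ t : ℝ, 0 ≤ t → t ^ q = (t ^ 2) ^ (q / 2) := fun t ht => by
    rw [← Real.rpow_two, ← Real.rpow_mul ht]
    congr 1
    ring
  have hpar : ‖(2⁻¹ : ℝ) • (a - b)‖ ^ 2 + ‖(2⁻¹ : ℝ) • (a + b)‖ ^ 2 =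
      2⁻¹ * ‖a‖ ^ 2 + 2⁻¹ * ‖b‖ ^ 2 := by
    rw [norm_smul, norm_smul, mul_pow, mul_pow, norm_sub_sq_real, norm_add_sq_real]
    norm_num
    ring
  have hq2 : 1 ≤ q / 2 := by linarith
  rw [hsq _ (norm_nonneg _), hsq _ (norm_nonneg (_ • (a + b))), hsq _ (norm_nonneg a),
    hsq _ (norm_nonneg b)]
  refine (Real.add_rpow_le_rpow_add (sq_nonneg _) (sq_nonneg _) hq2).trans ?_
  rw [hpar]
  have := (convexOn_rpow hq2).2 (Set.mem_Ici.2 (sq_nonneg ‖a‖)) (Set.mem_Ici.2 (sq_nonneg ‖b‖))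
    (show (0 : ℝ) ≤ 2⁻¹ by norm_num) (show (0 : ℝ) ≤ 2⁻¹ by norm_num) (by norm_num)
  simp only [smul_eq_mul] at this
  linarith

/-- The tangent inequality for the convex function `‖·‖ ^ q`. -/
lemma norm_rpow_sub_le (hq : 2 ≤ q) (a b : E) :
    ‖b‖ ^ q - ‖a‖ ^ q ≤ q * (‖b‖ ^ (q - 2) * inner ℝ b (b - a)) := by
  have hconj : q.HolderConjugate (q / (q - 1)) :=
    Real.HolderConjugate.conjExponent (by linarith)
  have hy := Real.young_inequality_of_nonneg (norm_nonneg a)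
    (Real.rpow_nonneg (norm_nonneg b) (q - 1)) hconj
  rw [← Real.rpow_mul (norm_nonneg b), mul_div_cancel₀ _ (by linarith)] at hy
  have h1 : ‖b‖ ^ (q - 2) * ‖b‖ = ‖b‖ ^ (q - 1) := by
    nth_rewrite 2 [← Real.rpow_one ‖b‖]
    rw [← Real.rpow_add_of_nonneg (norm_nonneg b) (by linarith) zero_le_one]
    congr 1
    ring
  have h2 := mul_le_mul_of_nonneg_left (real_inner_le_norm b a)
    (Real.rpow_nonneg (norm_nonneg b) (q - 2))
  rw [inner_sub_right, real_inner_self_eq_norm_sq, mul_sub, rpow_sub_two_mul_sq (norm_nonneg b) hq]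
  rw [← mul_assoc, h1] at h2
  have h3 : q * (‖a‖ ^ q / q + ‖b‖ ^ q / (q / (q - 1))) = ‖a‖ ^ q + (q - 1) * ‖b‖ ^ q := by
    field_simp
  have h4 := mul_le_mul_of_nonneg_left hy (show (0 : ℝ) ≤ q by linarith)
  have h5 := mul_le_mul_of_nonneg_left h2 (show (0 : ℝ) ≤ q by linarith)
  rw [h3] at h4
  linarith

lemma norm_rpow_inner_mono (hq : 2 ≤ q) (a b : E) :
    0 ≤ inner ℝ (‖a‖ ^ (q - 2) • a - ‖b‖ ^ (q - 2) • b) (a - b) := by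
  have h1 := norm_rpow_sub_le hq a b
  have h2 := norm_rpow_sub_le hq b a
  have h3 : q * inner ℝ (‖a‖ ^ (q - 2) • a - ‖b‖ ^ (q - 2) • b) (a - b) =
      q * (‖a‖ ^ (q - 2) * inner ℝ a (a - b)) + q * (‖b‖ ^ (q - 2) * inner ℝ b (b - a)) := by
    rw [inner_sub_left, real_inner_smul_left, real_inner_smul_left, ← neg_sub a b,
      inner_neg_right]
    ring
  have h4 : 0 ≤ q * inner ℝ (‖a‖ ^ (q - 2) • a - ‖b‖ ^ (q - 2) • b) (a - b) := by
    rw [h3]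
    linarith
  exact nonneg_of_mul_nonneg_right h4 (by linarith)

end Pointwise

/-! ### The double phase energy -/

/-- The double phase problem with `p = 2` on a set of finite measure, stated through almost everywhere
properties of the exponents and the weight. -/
structure IsQuadraticSetting {N : ℕ} (Ω : Set (Space N)) (p q μ : Space N → ℝ) (M : ℝ) : Prop where
  three_le : 3 ≤ N
  isOpen : IsOpen Ω
  nonempty : Ω.Nonempty
  volume_lt_top : volume Ω < ∞
  p_eq : ∀ᵐ x ∂volume.restrict Ω, p x = 2
  weight_aem : AEMeasurable μ (volume.restrict Ω)
  exponent_aem : AEMeasurable q (volume.restrict Ω)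
  weight : ∀ᵐ x ∂volume.restrict Ω, 0 ≤ μ x ∧ μ x ≤ M
  exponent : ∀ᵐ x ∂volume.restrict Ω, 2 ≤ q x ∧ q x ≤ sobolevExponent N
  bound_nonneg : 0 ≤ M

/-- Twice the energy density: `|t|² + (2 μ / q) |t|^q`. It is again a double phase integrand. -/
def energyFn {N : ℕ} (p q μ : Space N → ℝ) : Space N → ℝ → ℝ :=
  doublePhaseFn p q (fun x => 2 * μ x / q x)

lemma IsQuadraticIntegrand.integrable_of_modular {N : ℕ} {Ω : Set (Space N)} {Φ : Space N → ℝ → ℝ} {C : ℝ} (hΦ : IsQuadraticIntegrand Ω Φ C)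
    {F : Type*} [NormedAddCommGroup F] {w : Space N → F}
    (hw : AEStronglyMeasurable w (volume.restrict Ω)) (hm : modular Ω Φ w < ∞) :
    Integrable (fun x => Φ x ‖w x‖) (volume.restrict Ω) := by
  refine ⟨(hΦ.aemeasurable _ hw.norm.aemeasurable).aestronglyMeasurable, ?_⟩
  rw [hasFiniteIntegral_iff_ofReal]
  · exact hm
  · filter_upwards [hΦ.sq_le] with x hx
    exact (sq_nonneg _).trans (hx _ (norm_nonneg _))

namespace IsQuadraticSetting

variable {N : ℕ} {Ω : Set (Space N)} {p q μ : Space N → ℝ} {M : ℝ}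
  (hs : IsQuadraticSetting Ω p q μ M)
include hs

lemma integrand : IsQuadraticIntegrand Ω (doublePhaseFn p q μ) (1 + M + sobolevExponent N) :=
  isQuadraticIntegrand_doublePhaseFn hs.three_le hs.p_eq hs.weight_aem hs.exponent_aem hs.weight
    hs.exponent hs.bound_nonneg

lemma energy_integrand : IsQuadraticIntegrand Ω (energyFn p q μ) (1 + M + sobolevExponent N) := by
  refine isQuadraticIntegrand_doublePhaseFn hs.three_le hs.p_eq
    ((hs.weight_aem.const_mul 2).div hs.exponent_aem) hs.exponent_aem ?_
    hs.exponent hs.bound_nonneg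
  filter_upwards [hs.weight, hs.exponent] with x hm hq
  refine ⟨div_nonneg (by linarith) (by linarith), ?_⟩
  rw [div_le_iff₀ (by linarith)]
  nlinarith [hs.bound_nonneg]

lemma energyFn_bounds : ∀ᵐ x ∂volume.restrict Ω, ∀ t, 0 ≤ t → 0 ≤ energyFn p q μ x t ∧
    energyFn p q μ x t ≤ doublePhaseFn p q μ x t ∧
    doublePhaseFn p q μ x t ≤ sobolevExponent N / 2 * energyFn p q μ x t := by
  filter_upwards [hs.p_eq, hs.weight, hs.exponent] with x hp hm hq t ht
  have hS := two_lt_sobolevExponent hs.three_le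
  simp only [energyFn, doublePhaseFn]
  rw [hp]
  have h2 : 0 ≤ t ^ (2 : ℝ) := Real.rpow_nonneg ht _
  have h3 : 0 ≤ t ^ q x := Real.rpow_nonneg ht _
  have h4 : 0 ≤ 2 * μ x / q x := div_nonneg (by linarith) (by linarith)
  have h5 : 2 * μ x / q x ≤ μ x := by
    rw [div_le_iff₀ (by linarith)]
    nlinarith
  have h6 : μ x ≤ sobolevExponent N / 2 * (2 * μ x / q x) := by
    rw [div_mul_div_comm, le_div_iff₀ (by linarith)]
    nlinarith
  refine ⟨by positivity, by gcongr, ?_⟩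
  have h7 := mul_le_mul_of_nonneg_right h6 h3
  have h8 := mul_le_mul_of_nonneg_right (show 1 ≤ sobolevExponent N / 2 by linarith) h2
  linarith

lemma energyFn_clarkson : ∀ᵐ x ∂volume.restrict Ω, ∀ a b : Space N,
    energyFn p q μ x ‖(2⁻¹ : ℝ) • (a - b)‖ + energyFn p q μ x ‖(2⁻¹ : ℝ) • (a + b)‖ ≤
      (energyFn p q μ x ‖a‖ + energyFn p q μ x ‖b‖) / 2 := by
  filter_upwards [hs.p_eq, hs.weight, hs.exponent] with x hp hm hq a b
  simp only [energyFn, doublePhaseFn]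
  rw [hp]
  have h1 := norm_rpow_half_sub_add_le le_rfl a b
  have h4 : 0 ≤ 2 * μ x / q x := div_nonneg (by linarith) (by linarith)
  have h2 := mul_le_mul_of_nonneg_left (norm_rpow_half_sub_add_le hq.1 a b) h4
  linarith

lemma energyFn_tangent : ∀ᵐ x ∂volume.restrict Ω, ∀ a b : Space N,
    energyFn p q μ x ‖b‖ / 2 - energyFn p q μ x ‖a‖ / 2 ≤
      inner ℝ (doublePhaseField p q μ x b) (b - a) := by
  filter_upwards [hs.p_eq, hs.weight, hs.exponent] with x hp hm hq a b
  simp only [energyFn, doublePhaseFn, doublePhaseField]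
  rw [hp, sub_self, Real.rpow_zero, one_smul, inner_add_left, real_inner_smul_left]
  have h1 := norm_rpow_sub_le le_rfl a b
  rw [sub_self, Real.rpow_zero, one_mul] at h1
  have h4 : 0 ≤ μ x / q x := div_nonneg (by linarith) (by linarith)
  have h2 := mul_le_mul_of_nonneg_left (norm_rpow_sub_le hq.1 a b) h4
  have h3 : μ x / q x * (q x * (‖b‖ ^ (q x - 2) * inner ℝ b (b - a))) =
      μ x * ‖b‖ ^ (q x - 2) * inner ℝ b (b - a) := by
    have : q x ≠ 0 := by linarith
    field_simp
  have h5 : 2 * μ x / q x = 2 * (μ x / q x) := by ring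
  rw [h5]
  linarith

/-- The double phase operator is strongly monotone with respect to the Dirichlet norm. -/
lemma field_strongly_mono : ∀ᵐ x ∂volume.restrict Ω, ∀ a b : Space N,
    ‖a - b‖ ^ 2 ≤ inner ℝ (doublePhaseField p q μ x a - doublePhaseField p q μ x b) (a - b) := by
  filter_upwards [hs.p_eq, hs.weight, hs.exponent] with x hp hm hq a b
  simp only [doublePhaseField]
  rw [hp, sub_self, Real.rpow_zero, Real.rpow_zero, one_smul, one_smul, add_sub_add_comm,
    inner_add_left, real_inner_self_eq_norm_sq, mul_smul, mul_smul, ← smul_sub,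
    real_inner_smul_left]
  have := mul_nonneg hm.1 (norm_rpow_inner_mono hq.1 a b)
  linarith

lemma norm_inner_field_le : ∀ᵐ x ∂volume.restrict Ω, ∀ a b : Space N,
    ‖inner ℝ (doublePhaseField p q μ x a) b‖ ≤ doublePhaseFn p q μ x (‖a‖ + ‖b‖) := by
  filter_upwards [hs.p_eq, hs.weight, hs.exponent] with x hp hm hq a b
  refine (norm_inner_le_norm _ _).trans ?_
  simp only [doublePhaseField, doublePhaseFn]
  rw [hp, sub_self, Real.rpow_zero, one_smul]
  have ha := norm_nonneg a
  have hb := norm_nonneg b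
  have h1 : ‖a‖ ^ (q x - 2) ≤ (‖a‖ + ‖b‖) ^ (q x - 2) :=
    Real.rpow_le_rpow ha (by linarith) (by linarith)
  have h2 : ‖a‖ * ‖b‖ ≤ (‖a‖ + ‖b‖) ^ 2 := by nlinarith
  have h0 : 0 ≤ ‖a‖ ^ (q x - 2) := Real.rpow_nonneg ha _
  have h3 : ‖a‖ ^ (q x - 2) * (‖a‖ * ‖b‖) ≤ (‖a‖ + ‖b‖) ^ q x := by
    rw [← rpow_sub_two_mul_sq (add_nonneg ha hb) hq.1]
    exact mul_le_mul h1 h2 (by positivity) (h0.trans h1)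
  calc ‖a + (μ x * ‖a‖ ^ (q x - 2)) • a‖ * ‖b‖
      ≤ (‖a‖ + μ x * ‖a‖ ^ (q x - 2) * ‖a‖) * ‖b‖ := by
        gcongr
        refine (norm_add_le _ _).trans ?_
        rw [norm_smul, Real.norm_of_nonneg (mul_nonneg hm.1 h0)]
    _ = ‖a‖ * ‖b‖ + μ x * (‖a‖ ^ (q x - 2) * (‖a‖ * ‖b‖)) := by ring
    _ ≤ _ := by
        rw [Real.rpow_two]
        exact add_le_add h2 (mul_le_mul_of_nonneg_left h3 hm.1)

lemma continuous_field : ∀ᵐ x ∂volume.restrict Ω, Continuous (doublePhaseField p q μ x) := by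
  filter_upwards [hs.p_eq, hs.exponent] with x hp hq
  unfold doublePhaseField
  rw [hp]
  refine Continuous.add ?_ ?_
  · simpa using continuous_id'
  · exact (continuous_const.mul
      (continuous_norm.rpow_const fun _ => Or.inr (by linarith))).smul continuous_id

lemma aesm_field {w : Space N → Space N} (hw : AEStronglyMeasurable w (volume.restrict Ω)) :
    AEStronglyMeasurable (fun x => doublePhaseField p q μ x (w x)) (volume.restrict Ω) := by
  have hpm : AEMeasurable p (volume.restrict Ω) :=
    (aemeasurable_const (b := (2 : ℝ))).congr (by
      filter_upwards [hs.p_eq] with x hx using hx.symm)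
  have hn := hw.norm.aemeasurable
  exact ((hn.pow (hpm.sub_const 2)).aestronglyMeasurable.smul hw).add
    ((hs.weight_aem.mul (hn.pow (hs.exponent_aem.sub_const 2))).aestronglyMeasurable.smul hw)

lemma integrable_inner_field {v w : Space N → Space N}
    (hv : AEStronglyMeasurable v (volume.restrict Ω))
    (hw : AEStronglyMeasurable w (volume.restrict Ω))
    (hvm : modular Ω (doublePhaseFn p q μ) v < ∞) (hwm : modular Ω (doublePhaseFn p q μ) w < ∞) :
    Integrable (fun x => doublePhaseFn p q μ x (‖v x‖ + ‖w x‖)) (volume.restrict Ω) ∧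
    Integrable (fun x => inner ℝ (doublePhaseField p q μ x (v x)) (w x)) (volume.restrict Ω) := by
  have h1 : Integrable (fun x => doublePhaseFn p q μ x (‖v x‖ + ‖w x‖)) (volume.restrict Ω) := by
    have hsum := hs.integrand.modular_add_le (u := fun x => ‖v x‖) (fun x => ‖w x‖) hv.norm
    have hnn : ∀ z : Space N → Space N, modular Ω (doublePhaseFn p q μ) (fun x => ‖z x‖) =
        modular Ω (doublePhaseFn p q μ) z := fun z => by simp [modular]
    rw [hnn, hnn] at hsum
    have := hs.integrand.integrable_of_modular (hv.norm.add hw.norm)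
      (hsum.trans_lt (ENNReal.mul_lt_top ENNReal.ofReal_lt_top (ENNReal.add_lt_top.2 ⟨hvm, hwm⟩)))
    refine this.congr (Eventually.of_forall fun x => ?_)
    simp only [Pi.add_apply]
    rw [Real.norm_of_nonneg (by positivity)]
  refine ⟨h1, h1.mono' ((hs.aesm_field hv).inner hw) ?_⟩
  filter_upwards [hs.norm_inner_field_le] with x hx using hx _ _

end IsQuadraticSetting

/-! ### The variational problem with a fixed right-hand side -/

/-- Integration against `h` is a functional on `W_0^{1,2}(Ω)` of norm at most `c` with respect to the
Dirichlet norm. The bound is stated for all `s ≥ ‖∇u‖_2` with `s > 0`. -/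
structure HasDualBound {N : ℕ} (Ω : Set (Space N)) (h : Space N → ℝ) (c : ℝ) : Prop where
  integrable : ∀ u v, IsLimitPair Ω (powerFn fun _ => 2) u v →
    Integrable (fun x => h x * u x) (volume.restrict Ω)
  bound : ∀ u v, IsLimitPair Ω (powerFn fun _ => 2) u v → ∀ s : ℝ, 0 < s →
    ∫ x in Ω, ‖v x‖ ^ 2 ≤ s ^ 2 → |∫ x in Ω, h x * u x| ≤ c * s

/-- The functional `½ ∫ |∇u|² + ∫ (μ / q) |∇u|^q - ∫ h u`, with the gradient as a separate
argument. -/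
def energy {N : ℕ} (Ω : Set (Space N)) (p q μ h : Space N → ℝ) (u : Space N → ℝ)
    (v : Space N → Space N) : ℝ :=
  (∫ x in Ω, energyFn p q μ x ‖v x‖) / 2 - ∫ x in Ω, h x * u x

/-- `(u, v)` is a weak solution with gradient `v = ∇u` of `-div (∇u + μ |∇u|^{q-2} ∇u) = h` in `Ω`,
`u = 0` on `∂Ω`. -/
structure IsSolutionPair {N : ℕ} (Ω : Set (Space N)) (p q μ h u : Space N → ℝ)
    (v : Space N → Space N) : Prop where
  isLimitPair : IsLimitPair Ω (doublePhaseFn p q μ) u v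
  integrable : ∀ φ ψ, IsLimitPair Ω (doublePhaseFn p q μ) φ ψ →
    Integrable (fun x => h x * φ x) (volume.restrict Ω)
  integral_eq : ∀ φ ψ, IsLimitPair Ω (doublePhaseFn p q μ) φ ψ →
    ∫ x in Ω, inner ℝ (doublePhaseField p q μ x (v x)) (ψ x) = ∫ x in Ω, h x * φ x

namespace IsQuadraticSetting

variable {N : ℕ} {Ω : Set (Space N)} {p q μ h : Space N → ℝ} {M c : ℝ} {u u' : Space N → ℝ}
  {v v' : Space N → Space N}
  (hs : IsQuadraticSetting Ω p q μ M)
include hs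

lemma integrable_energyFn (huv : IsLimitPair Ω (doublePhaseFn p q μ) u v) :
    Integrable (fun x => energyFn p q μ x ‖v x‖) (volume.restrict Ω) := by
  refine hs.energy_integrand.integrable_of_modular huv.aesm_grad
    (lt_of_le_of_lt ?_ (huv.modular_lt_top hs.integrand hs.volume_lt_top).2)
  refine lintegral_mono_ae ?_
  filter_upwards [hs.energyFn_bounds] with x hx
  exact ENNReal.ofReal_le_ofReal (hx _ (norm_nonneg _)).2.1

lemma modular_energyFn (huv : IsLimitPair Ω (doublePhaseFn p q μ) u v) :
    modular Ω (energyFn p q μ) v = ENNReal.ofReal (∫ x in Ω, energyFn p q μ x ‖v x‖) := by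
  rw [ofReal_integral_eq_lintegral_ofReal (hs.integrable_energyFn huv)]
  · rfl
  · filter_upwards [hs.energyFn_bounds] with x hx using (hx _ (norm_nonneg _)).1

lemma integral_sq_le_energyFn (huv : IsLimitPair Ω (doublePhaseFn p q μ) u v) :
    ∫ x in Ω, ‖v x‖ ^ 2 ≤ ∫ x in Ω, energyFn p q μ x ‖v x‖ := by
  refine integral_mono_ae
    ((huv.memLp_grad hs.integrand hs.volume_lt_top).integrable_norm_pow two_ne_zero)
    (hs.integrable_energyFn huv) ?_
  filter_upwards [hs.energy_integrand.sq_le] with x hx using hx _ (norm_nonneg _)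

lemma energy_lower_bound (hb : HasDualBound Ω h c)
    (huv : IsLimitPair Ω (doublePhaseFn p q μ) u v) :
    -(1 + c ^ 2) / 2 ≤ energy Ω p q μ h u v := by
  have h0 : 0 ≤ ∫ x in Ω, ‖v x‖ ^ 2 := integral_nonneg fun x => by positivity
  have h1 := hb.bound u v (huv.powerFn_two hs.integrand) (Real.sqrt ((∫ x in Ω, ‖v x‖ ^ 2) + 1))
    (Real.sqrt_pos.2 (by linarith)) (by rw [Real.sq_sqrt (by linarith)]; linarith)
  have h2 := hs.integral_sq_le_energyFn huv
  have h3 := Real.sq_sqrt (show 0 ≤ (∫ x in Ω, ‖v x‖ ^ 2) + 1 by linarith)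
  unfold energy
  nlinarith [le_abs_self (∫ x in Ω, h x * u x),
    sq_nonneg (Real.sqrt ((∫ x in Ω, ‖v x‖ ^ 2) + 1) - c)]

/-- Uniform convexity: by Clarkson's inequality, the modular of the difference of two gradients is
controlled by the energy gap at the midpoint. -/
lemma modular_sub_le_energy (hb : HasDualBound Ω h c)
    (huv : IsLimitPair Ω (doublePhaseFn p q μ) u v)
    (huv' : IsLimitPair Ω (doublePhaseFn p q μ) u' v') :
    modular Ω (doublePhaseFn p q μ) (fun x => v x - v' x) ≤
      ENNReal.ofReal (2 ^ (1 + M + sobolevExponent N)) * ENNReal.ofReal (sobolevExponent N / 2 *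
        (energy Ω p q μ h u v + energy Ω p q μ h u' v' -
          2 * energy Ω p q μ h (fun x => (2⁻¹ : ℝ) • (u x + u' x))
            (fun x => (2⁻¹ : ℝ) • (v x + v' x)))) := by
  have hΦ := hs.integrand
  have hS := two_lt_sobolevExponent hs.three_le
  have hmid := (huv.add huv' hΦ).smul hΦ 2⁻¹
  have hdiff := (huv.sub huv' hΦ).smul hΦ 2⁻¹
  have i1 := hs.integrable_energyFn huv
  have i2 := hs.integrable_energyFn huv'
  have i3 := hs.integrable_energyFn hmid
  have i4 := hs.integrable_energyFn hdiff
  have hcl : ∫ x in Ω, energyFn p q μ x ‖(2⁻¹ : ℝ) • (v x - v' x)‖ ≤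
      ((∫ x in Ω, energyFn p q μ x ‖v x‖) + ∫ x in Ω, energyFn p q μ x ‖v' x‖) / 2 -
        ∫ x in Ω, energyFn p q μ x ‖(2⁻¹ : ℝ) • (v x + v' x)‖ := by
    have h1 : ∫ x in Ω, (energyFn p q μ x ‖(2⁻¹ : ℝ) • (v x - v' x)‖ +
        energyFn p q μ x ‖(2⁻¹ : ℝ) • (v x + v' x)‖) ≤
        ∫ x in Ω, (energyFn p q μ x ‖v x‖ + energyFn p q μ x ‖v' x‖) / 2 := by
      refine integral_mono_ae (i4.add i3) ((i1.add i2).div_const 2) ?_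
      filter_upwards [hs.energyFn_clarkson] with x hx using hx _ _
    rw [integral_add i4 i3, integral_div, integral_add i1 i2] at h1
    linarith
  have hlin : ∫ x in Ω, h x * ((2⁻¹ : ℝ) • (u x + u' x)) =
      ((∫ x in Ω, h x * u x) + ∫ x in Ω, h x * u' x) / 2 := by
    rw [← integral_add (hb.integrable _ _ (huv.powerFn_two hΦ))
      (hb.integrable _ _ (huv'.powerFn_two hΦ)), ← integral_div]
    refine integral_congr_ae (Eventually.of_forall fun x => ?_)
    simp only [smul_eq_mul]
    ring
  have h2 := hΦ.modular_smul_le one_le_two (fun x => (2⁻¹ : ℝ) • (v x - v' x))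
  simp only [smul_inv_smul₀ (two_ne_zero (α := ℝ))] at h2
  refine h2.trans ?_
  gcongr
  have h3 : modular Ω (doublePhaseFn p q μ) (fun x => (2⁻¹ : ℝ) • (v x - v' x)) ≤
      ENNReal.ofReal (sobolevExponent N / 2) *
        modular Ω (energyFn p q μ) (fun x => (2⁻¹ : ℝ) • (v x - v' x)) := by
    unfold modular
    rw [← lintegral_const_mul' _ _ ENNReal.ofReal_ne_top]
    refine lintegral_mono_ae ?_
    filter_upwards [hs.energyFn_bounds] with x hx
    rw [← ENNReal.ofReal_mul (by linarith)]
    exact ENNReal.ofReal_le_ofReal (hx _ (norm_nonneg _)).2.2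
  refine h3.trans ?_
  rw [hs.modular_energyFn hdiff, ← ENNReal.ofReal_mul (by linarith)]
  refine ENNReal.ofReal_le_ofReal (mul_le_mul_of_nonneg_left ?_ (by linarith))
  unfold energy
  rw [hlin]
  linarith

lemma exists_energy_minimizer (hb : HasDualBound Ω h c) :
    ∃ u v, IsLimitPair Ω (doublePhaseFn p q μ) u v ∧
      ∀ u' v', IsLimitPair Ω (doublePhaseFn p q μ) u' v' →
        energy Ω p q μ h u v ≤ energy Ω p q μ h u' v' := by
  have hΦ := hs.integrand
  have hΩ := hs.volume_lt_top
  have hS := two_lt_sobolevExponent hs.three_le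
  let S : Set ℝ := {l | ∃ u v, IsLimitPair Ω (doublePhaseFn p q μ) u v ∧
    l = energy Ω p q μ h u v}
  have hSne : S.Nonempty := ⟨_, _, _, IsLimitPair.of_testFunction hΦ IsTestFunction.zero, rfl⟩
  have hSb : BddBelow S := by
    refine ⟨-(1 + c ^ 2) / 2, ?_⟩
    rintro _ ⟨u, v, huv, rfl⟩
    exact hs.energy_lower_bound hb huv
  have hinf : ∀ {u v}, IsLimitPair Ω (doublePhaseFn p q μ) u v →
      sInf S ≤ energy Ω p q μ h u v := fun huv => csInf_le hSb ⟨_, _, huv, rfl⟩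
  have hex : ∀ n : ℕ, ∃ u v, IsLimitPair Ω (doublePhaseFn p q μ) u v ∧
      energy Ω p q μ h u v < sInf S + 1 / (n + 1 : ℝ) := fun n => by
    obtain ⟨_, ⟨u, v, huv, rfl⟩, h1⟩ := exists_lt_of_csInf_lt hSne
      (show sInf S < sInf S + 1 / (n + 1 : ℝ) by
        have : (0 : ℝ) < 1 / (n + 1 : ℝ) := by positivity
        linarith)
    exact ⟨u, v, huv, h1⟩
  choose U V hUV hE using hex
  have ht := tendsto_one_div_add_atTop_nhds_zero_nat (𝕜 := ℝ)
  obtain ⟨u, v, huv, hU, hV⟩ := exists_limitPair_of_cauchy hs.three_le hΩ hΦ hUV (by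
    intro ε hε
    set D := ENNReal.ofReal (2 ^ (1 + M + sobolevExponent N)) with hD
    have h1 : Tendsto (fun e : ℝ => D * ENNReal.ofReal (sobolevExponent N / 2 * (e + e)))
        (𝓝 0) (𝓝 0) := by
      have h2 : Tendsto (fun e : ℝ => sobolevExponent N / 2 * (e + e)) (𝓝 0) (𝓝 0) := by
        have : Continuous fun e : ℝ => sobolevExponent N / 2 * (e + e) := by fun_prop
        simpa using this.tendsto 0
      simpa using ENNReal.Tendsto.const_mul (a := D) (ENNReal.tendsto_ofReal h2)
        (Or.inr ENNReal.ofReal_ne_top)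
    obtain ⟨n₀, hn₀⟩ := eventually_atTop.1
      ((ENNReal.tendsto_nhds_zero.1 (h1.comp ht)) ε hε)
    refine ⟨n₀, fun n hn m hm => ?_⟩
    refine (hs.modular_sub_le_energy hb (hUV n) (hUV m)).trans (le_trans ?_ (hn₀ n₀ le_rfl))
    dsimp only [Function.comp]
    gcongr
    have a1 := hinf (((hUV n).add (hUV m) hΦ).smul hΦ 2⁻¹)
    have a2 : 1 / (n + 1 : ℝ) ≤ 1 / (n₀ + 1 : ℝ) := Nat.one_div_le_one_div hn
    have a3 : 1 / (m + 1 : ℝ) ≤ 1 / (n₀ + 1 : ℝ) := Nat.one_div_le_one_div hm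
    linarith [hE n, hE m])
  refine ⟨u, v, huv, fun u' v' huv' => le_trans ?_ (hinf huv')⟩
  -- the linear part of the energy converges along the minimizing sequence
  have hlin : Tendsto (fun n => ∫ x in Ω, h x * U n x) atTop (𝓝 (∫ x in Ω, h x * u x)) := by
    rw [tendsto_iff_norm_sub_tendsto_zero]
    have hv0 : Tendsto (fun n => ∫ x in Ω, ‖V n x - v x‖ ^ 2) atTop (𝓝 0) := by
      have := tendsto_integral_norm_sq (m := volume.restrict Ω) (w := fun n x => V n x - v x)
        (w₀ := fun _ => 0)
        (fun n => ((hUV n).sub huv hΦ).memLp_grad hΦ hΩ) MemLp.zero (by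
          simpa using hΦ.tendsto_eLpNorm_two hV)
      simpa using this
    rw [Metric.tendsto_atTop]
    intro ε hε
    have hs0 : 0 < ε / (|c| + 1) := by positivity
    obtain ⟨n₀, hn₀⟩ := eventually_atTop.1
      (hv0.eventually (gt_mem_nhds (show 0 < (ε / (|c| + 1)) ^ 2 by positivity)))
    refine ⟨n₀, fun n hn => ?_⟩
    have h1 := hb.bound _ _ (((hUV n).sub huv hΦ).powerFn_two hΦ) _ hs0 (hn₀ n hn).le
    have h2 : ∫ x in Ω, h x * (U n x - u x) =
        (∫ x in Ω, h x * U n x) - ∫ x in Ω, h x * u x := by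
      rw [← integral_sub (hb.integrable _ _ ((hUV n).powerFn_two hΦ))
        (hb.integrable _ _ (huv.powerFn_two hΦ))]
      simp only [mul_sub]
    rw [h2] at h1
    rw [Real.dist_eq, sub_zero, Real.norm_eq_abs, abs_abs]
    refine h1.trans_lt ?_
    rw [mul_div_assoc', div_lt_iff₀ (by positivity)]
    nlinarith [le_abs_self c]
  -- the convex part is lower semicontinuous by Fatou's lemma
  obtain ⟨k, hk, hkV⟩ := (tendstoInMeasure_of_tendsto_eLpNorm two_ne_zero
    (fun n => (hUV n).aesm_grad) huv.aesm_grad (hΦ.tendsto_eLpNorm_two hV)).exists_seq_tendsto_ae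
  have hF := hs.energy_integrand.modular_le_liminf (fun n => (hUV (k n)).aesm_grad) hkV
  rw [hs.modular_energyFn huv] at hF
  have hlim : Tendsto (fun n => 2 * (sInf S + 1 / ((k n : ℕ) + 1 : ℝ) +
      ∫ x in Ω, h x * U (k n) x)) atTop (𝓝 (2 * (sInf S + 0 + ∫ x in Ω, h x * u x))) :=
    ((tendsto_const_nhds.add (ht.comp hk.tendsto_atTop)).add
      (hlin.comp hk.tendsto_atTop)).const_mul 2
  have hle : ∀ n, ∫ x in Ω, energyFn p q μ x ‖V (k n) x‖ ≤
      2 * (sInf S + 1 / ((k n : ℕ) + 1 : ℝ) + ∫ x in Ω, h x * U (k n) x) := fun n => by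
    have := hE (k n)
    unfold energy at this
    linarith
  have hnn : ∀ n, 0 ≤ ∫ x in Ω, energyFn p q μ x ‖V (k n) x‖ := fun n => by
    refine integral_nonneg_of_ae ?_
    filter_upwards [hs.energyFn_bounds] with x hx using (hx _ (norm_nonneg _)).1
  have hlim0 := ge_of_tendsto' hlim fun n => (hnn n).trans (hle n)
  have hF2 : ENNReal.ofReal (∫ x in Ω, energyFn p q μ x ‖v x‖) ≤
      ENNReal.ofReal (2 * (sInf S + 0 + ∫ x in Ω, h x * u x)) := by
    refine hF.trans ?_
    rw [← (ENNReal.tendsto_ofReal hlim).liminf_eq]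
    refine liminf_le_liminf (Eventually.of_forall fun n => ?_)
    rw [hs.modular_energyFn (hUV (k n))]
    exact ENNReal.ofReal_le_ofReal (hle n)
  rw [ENNReal.ofReal_le_ofReal_iff hlim0] at hF2
  unfold energy
  linarith

lemma tendsto_integral_inner_field {φ : Space N → ℝ} {ψ : Space N → Space N}
    (huv : IsLimitPair Ω (doublePhaseFn p q μ) u v)
    (hφ : IsLimitPair Ω (doublePhaseFn p q μ) φ ψ) :
    Tendsto (fun n : ℕ => ∫ x in Ω,
      inner ℝ (doublePhaseField p q μ x (v x + (1 / (n + 1 : ℝ)) • ψ x)) (ψ x)) atTop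
      (𝓝 (∫ x in Ω, inner ℝ (doublePhaseField p q μ x (v x)) (ψ x))) := by
  have hΦ := hs.integrand
  have hp2 := hφ.smul hΦ 2
  have hdom := (hs.integrable_inner_field huv.aesm_grad hp2.aesm_grad
    (huv.modular_lt_top hΦ hs.volume_lt_top).2 (hp2.modular_lt_top hΦ hs.volume_lt_top).2).1
  refine tendsto_integral_of_dominated_convergence _ (fun n => ?_) hdom (fun n => ?_) ?_
  · have hw := (huv.add (hφ.smul hΦ (1 / (n + 1 : ℝ))) hΦ).aesm_grad
    exact (hs.aesm_field hw).inner hφ.aesm_grad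
  · filter_upwards [hs.norm_inner_field_le, hΦ.mono] with x h1 h2
    have h3 : (1 / (n + 1 : ℝ)) ≤ 1 := by
      rw [div_le_one (by positivity)]
      linarith [(Nat.cast_nonneg n : (0 : ℝ) ≤ n)]
    have h4 : ‖(1 / (n + 1 : ℝ)) • ψ x‖ ≤ ‖ψ x‖ := by
      rw [norm_smul, Real.norm_of_nonneg (by positivity)]
      exact mul_le_of_le_one_left (norm_nonneg _) h3
    have h5 : ‖(2 : ℝ) • ψ x‖ = 2 * ‖ψ x‖ := by
      rw [norm_smul, Real.norm_of_nonneg zero_le_two]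
    have h6 := norm_add_le (v x) ((1 / (n + 1 : ℝ)) • ψ x)
    refine (h1 (v x + (1 / (n + 1 : ℝ)) • ψ x) (ψ x)).trans (h2 _ _ (by positivity) ?_)
    linarith
  · filter_upwards [hs.continuous_field] with x hx
    have h1 : Tendsto (fun n : ℕ => v x + (1 / (n + 1 : ℝ)) • ψ x) atTop (𝓝 (v x)) := by
      simpa using (tendsto_one_div_add_atTop_nhds_zero_nat (𝕜 := ℝ)).smul_const (ψ x)
        |>.const_add (v x)
    exact ((hx.tendsto _).comp h1).inner tendsto_const_nhds

/-- Solvability of `-div (∇u + μ |∇u|^{q-2} ∇u) = h` for `h` in the dual of `W_0^{1,2}(Ω)`: the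
Euler-Lagrange equation of a minimizer of the energy. -/
theorem exists_weak_solution_of_dualBound (hb : HasDualBound Ω h c) :
    ∃ u v, IsSolutionPair Ω p q μ h u v := by
  have hΦ := hs.integrand
  have hΩ := hs.volume_lt_top
  obtain ⟨u, v, huv, hmin⟩ := hs.exists_energy_minimizer hb
  refine ⟨u, v, huv, fun φ ψ hφ => hb.integrable _ _ (hφ.powerFn_two hΦ), ?_⟩
  have hmv := (huv.modular_lt_top hΦ hΩ).2
  have key : ∀ φ ψ, IsLimitPair Ω (doublePhaseFn p q μ) φ ψ →
      ∫ x in Ω, h x * φ x ≤ ∫ x in Ω, inner ℝ (doublePhaseField p q μ x (v x)) (ψ x) := by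
    intro φ ψ hφ
    have hmψ := (hφ.modular_lt_top hΦ hΩ).2
    have hone : ∀ n : ℕ, ∫ x in Ω, h x * φ x ≤
        ∫ x in Ω, inner ℝ (doublePhaseField p q μ x (v x + (1 / (n + 1 : ℝ)) • ψ x)) (ψ x) := by
      intro n
      set t : ℝ := 1 / (n + 1 : ℝ) with ht
      have ht0 : 0 < t := by positivity
      have hp := huv.add (hφ.smul hΦ t) hΦ
      have h1 := hmin _ _ hp
      have i1 := hs.integrable_energyFn huv
      have i2 := hs.integrable_energyFn hp
      have i3 := (hs.integrable_inner_field hp.aesm_grad hφ.aesm_grad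
        (hp.modular_lt_top hΦ hΩ).2 hmψ).2
      have h2 : ∫ x in Ω, (energyFn p q μ x ‖v x + t • ψ x‖ / 2 - energyFn p q μ x ‖v x‖ / 2) ≤
          ∫ x in Ω, t * inner ℝ (doublePhaseField p q μ x (v x + t • ψ x)) (ψ x) := by
        refine integral_mono_ae ((i2.div_const 2).sub (i1.div_const 2)) (i3.const_mul t) ?_
        filter_upwards [hs.energyFn_tangent] with x hx
        have := hx (v x) (v x + t • ψ x)
        rwa [add_sub_cancel_left, real_inner_smul_right] at this
      rw [integral_sub (i2.div_const 2) (i1.div_const 2), integral_div, integral_div,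
        integral_const_mul] at h2
      have h3 : ∫ x in Ω, h x * (u x + t • φ x) =
          (∫ x in Ω, h x * u x) + t * ∫ x in Ω, h x * φ x := by
        rw [← integral_const_mul, ← integral_add (hb.integrable _ _ (huv.powerFn_two hΦ))
          ((hb.integrable _ _ (hφ.powerFn_two hΦ)).const_mul t)]
        refine integral_congr_ae (Eventually.of_forall fun x => ?_)
        simp only [smul_eq_mul]
        ring
      unfold energy at h1
      rw [h3] at h1
      exact le_of_mul_le_mul_left (by linarith) ht0
    exact ge_of_tendsto' (hs.tendsto_integral_inner_field huv hφ) hone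
  intro φ ψ hφ
  refine le_antisymm ?_ (key φ ψ hφ)
  have := key _ _ (hφ.smul hΦ (-1))
  simp only [smul_eq_mul, neg_mul, one_mul, mul_neg, neg_smul, one_smul, inner_neg_right,
    integral_neg] at this
  linarith

end IsQuadraticSetting

section DualBound

variable {N : ℕ} {Ω : Set (Space N)} {h : Space N → ℝ}

lemma hasDualBound_of_lintegral_le (hN : 3 ≤ N)
    (hm : AEStronglyMeasurable h (volume.restrict Ω)) {δ T : ℝ} (hδ : 0 < δ) (hT : 0 ≤ T)
    (hb : ∀ u v, IsLimitPair Ω (powerFn fun _ => 2) u v → ∫ x in Ω, ‖v x‖ ^ 2 ≤ δ →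
      ∫⁻ x in Ω, ‖h x * u x‖ₑ ≤ ENNReal.ofReal T) :
    HasDualBound Ω h (T / Real.sqrt δ) := by
  have hΦ := isQuadraticIntegrand_powerFn Ω hN
  have hδ' := Real.sqrt_pos.2 hδ
  -- both claims follow by scaling to Dirichlet norm `√δ`
  have key : ∀ u v, IsLimitPair Ω (powerFn fun _ => 2) u v → ∀ s : ℝ, 0 < s →
      ∫ x in Ω, ‖v x‖ ^ 2 ≤ s ^ 2 →
      ∫⁻ x in Ω, ‖h x * u x‖ₑ ≤ ENNReal.ofReal (T / Real.sqrt δ * s) := by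
    intro u v huv s hs hv
    have h1 := hb _ _ (huv.smul hΦ (Real.sqrt δ / s)) (by
      simp only [norm_smul, mul_pow]
      rw [integral_const_mul, Real.norm_of_nonneg (by positivity), div_pow, Real.sq_sqrt hδ.le,
        div_mul_eq_mul_div, div_le_iff₀ (by positivity)]
      gcongr)
    have h2 : ∫⁻ x in Ω, ‖h x * u x‖ₑ =
        ENNReal.ofReal (s / Real.sqrt δ) * ∫⁻ x in Ω, ‖h x * ((Real.sqrt δ / s) • u x)‖ₑ := by
      rw [← lintegral_const_mul' _ _ ENNReal.ofReal_ne_top]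
      refine lintegral_congr fun x => ?_
      rw [← Real.enorm_of_nonneg (by positivity), ← enorm_mul]
      congr 1
      simp only [smul_eq_mul]
      field_simp
    rw [h2]
    calc _ ≤ ENNReal.ofReal (s / Real.sqrt δ) * ENNReal.ofReal T := by gcongr
      _ = ENNReal.ofReal (T / Real.sqrt δ * s) := by
        rw [← ENNReal.ofReal_mul (by positivity)]
        congr 1
        ring
  refine ⟨fun u v huv => ⟨hm.mul huv.aesm, ?_⟩, fun u v huv s hs hv => ?_⟩
  · have h0 : 0 ≤ ∫ x in Ω, ‖v x‖ ^ 2 := integral_nonneg fun x => by positivity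
    refine (key u v huv (Real.sqrt ((∫ x in Ω, ‖v x‖ ^ 2) + 1)) (Real.sqrt_pos.2 (by linarith))
      (by rw [Real.sq_sqrt (by linarith)]; linarith)).trans_lt ENNReal.ofReal_lt_top
  · have h1 := (enorm_integral_le_lintegral_enorm _).trans (key u v huv s hs hv)
    rw [← ofReal_norm, ENNReal.ofReal_le_ofReal_iff (by positivity)] at h1
    exact h1

/-- Sums of functions in `L^{r(·)/(r(·)-1)}`, with `r` at most critical, and functions in `L²` act
boundedly on `W_0^{1,2}(Ω)`: this follows from Young's inequality and the Sobolev embedding. -/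
lemma exists_hasDualBound (hN : 3 ≤ N) (hΩ : volume Ω < ∞) {r ρ k : Space N → ℝ}
    (hr : ∀ᵐ x ∂volume.restrict Ω, 1 < r x ∧ r x ≤ sobolevExponent N)
    (hρ : MemL Ω (powerFn fun x => r x / (r x - 1)) ρ) (hk : MemLp k 2 (volume.restrict Ω)) :
    ∃ c, HasDualBound Ω (fun x => ρ x + k x) c := by
  have hS := two_lt_sobolevExponent hN
  have hΦ := isQuadraticIntegrand_doublePhaseFn (Ω := Ω) (p := fun _ => 2)
    (q := fun _ => sobolevExponent N) (μ := fun _ => 1) (M := 1) hN (by simp) aemeasurable_const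
    aemeasurable_const (by simp) (by simp [hS.le]) zero_le_one
  obtain ⟨δ, hδ, hδ'⟩ := exists_modular_le hN hΩ hΦ one_pos
  set T := modular Ω (powerFn fun x => r x / (r x - 1)) ρ + volume Ω +
    ENNReal.ofReal (∫ x in Ω, ‖k x‖ ^ 2) + 1 with hT
  have hTt : T ≠ ∞ := by
    simp only [hT, ne_eq, ENNReal.add_eq_top, hρ.2.ne, hΩ.ne, ENNReal.ofReal_ne_top,
      ENNReal.one_ne_top, or_self, not_false_eq_true]
  refine ⟨_, hasDualBound_of_lintegral_le hN (hρ.1.add hk.1) hδ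
    (ENNReal.toReal_nonneg (a := T)) fun u v huv hv => ?_⟩
  rw [ENNReal.ofReal_toReal hTt]
  have hk2 : AEMeasurable (fun x => ENNReal.ofReal (‖k x‖ ^ 2)) (volume.restrict Ω) :=
    (hk.1.norm.aemeasurable.pow_const 2).ennreal_ofReal
  calc ∫⁻ x in Ω, ‖(ρ x + k x) * u x‖ₑ
      ≤ ∫⁻ x in Ω, (ENNReal.ofReal (powerFn (fun x => r x / (r x - 1)) x ‖ρ x‖) + 1 +
          ENNReal.ofReal (‖k x‖ ^ 2) +
          ENNReal.ofReal (doublePhaseFn (fun _ => 2) (fun _ => sobolevExponent N)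
            (fun _ => 1) x ‖u x‖)) := by
        refine lintegral_mono_ae ?_
        filter_upwards [hr] with x hx
        simp only [powerFn, doublePhaseFn, one_mul]
        have h1 : 0 ≤ ‖ρ x‖ ^ (r x / (r x - 1)) := Real.rpow_nonneg (norm_nonneg _) _
        have h2 : 0 ≤ ‖u x‖ ^ sobolevExponent N := Real.rpow_nonneg (norm_nonneg _) _
        have h3 : ‖u x‖ ^ r x ≤ 1 + ‖u x‖ ^ sobolevExponent N := by
          rcases le_total ‖u x‖ 1 with h4 | h4
          · linarith [Real.rpow_le_one (norm_nonneg (u x)) h4 (show 0 ≤ r x by linarith)]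
          · linarith [Real.rpow_le_rpow_of_exponent_le h4 hx.2]
        have hconj := (Real.HolderConjugate.conjExponent hx.1).symm
        have h5 := Real.young_inequality_of_nonneg (norm_nonneg (ρ x)) (norm_nonneg (u x)) hconj
        have h6 : ‖ρ x‖ ^ Real.conjExponent (r x) / Real.conjExponent (r x) ≤
            ‖ρ x‖ ^ (r x / (r x - 1)) := div_le_self h1 hconj.lt.le
        have h7 : ‖u x‖ ^ r x / r x ≤ ‖u x‖ ^ r x :=
          div_le_self (Real.rpow_nonneg (norm_nonneg _) _) hx.1.le
        rw [← ENNReal.ofReal_one, ← ENNReal.ofReal_add h1 zero_le_one,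
          ← ENNReal.ofReal_add (by positivity) (by positivity),
          ← ENNReal.ofReal_add (by positivity) (by positivity), ← ofReal_norm, Real.rpow_two]
        refine ENNReal.ofReal_le_ofReal ?_
        rw [norm_mul]
        have h8 := mul_le_mul_of_nonneg_right (norm_add_le (ρ x) (k x)) (norm_nonneg (u x))
        nlinarith [sq_nonneg (‖k x‖ - ‖u x‖), sq_nonneg ‖k x‖, sq_nonneg ‖u x‖]
    _ = modular Ω (powerFn fun x => r x / (r x - 1)) ρ + volume Ω +
          ENNReal.ofReal (∫ x in Ω, ‖k x‖ ^ 2) +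
          modular Ω (doublePhaseFn (fun _ => 2) (fun _ => sobolevExponent N) (fun _ => 1)) u := by
        have hu := hΦ.aemeasurable_norm huv.aesm
        rw [lintegral_add_right' _ hu, lintegral_add_right' _ hk2,
          lintegral_add_right' _ aemeasurable_const, ← modular_powerFn_two_eq_integral hk]
        simp [modular, powerFn]
    _ ≤ T := by
        rw [hT]
        gcongr
        exact hδ' u v huv hv

end DualBound

/-! ### Contraction -/

namespace IsQuadraticSetting

variable {N : ℕ} {Ω : Set (Space N)} {p q μ : Space N → ℝ} {M : ℝ}
  (hs : IsQuadraticSetting Ω p q μ M)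
include hs

lemma firstEigenvalue_pos : 0 < firstEigenvalue 2 Ω := by
  rw [firstEigenvalue_two_eq hs.three_le hs.volume_lt_top hs.isOpen hs.nonempty]
  exact rayleighInf_pos hs.three_le hs.volume_lt_top hs.isOpen hs.nonempty

/-- The Poincaré inequality with the optimal constant. -/
lemma firstEigenvalue_mul_le {u : Space N → ℝ} {v : Space N → Space N}
    (h : IsLimitPair Ω (powerFn fun _ => 2) u v) :
    firstEigenvalue 2 Ω * ∫ x in Ω, ‖u x‖ ^ 2 ≤ ∫ x in Ω, ‖v x‖ ^ 2 := by
  rw [firstEigenvalue_two_eq hs.three_le hs.volume_lt_top hs.isOpen hs.nonempty]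
  exact rayleighInf_mul_le hs.three_le hs.volume_lt_top h

/-- The gradient of the solution depends on the field `g` in the right-hand side `ρ + ⟪B, g⟫` with
Lipschitz constant less than one: by monotonicity the left-hand side is at most
`∫ ⟪B, g₁ - g₂⟫ (u₁ - u₂)`, to which Young's and the Poincaré inequality apply. -/
lemma integral_grad_sub_sq_le {ρ : Space N → ℝ} {B : Space N → Space N} {c₂ κ : ℝ}
    (hκ : κ = c₂ * firstEigenvalue 2 Ω ^ (-(1 / 2) : ℝ)) (hκ1 : κ < 1) (hc₂ : 0 ≤ c₂)
    (hB : ∀ᵐ x ∂volume.restrict Ω, ∀ ξ, |inner ℝ (B x) ξ| ≤ c₂ * ‖ξ‖)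
    {u₁ u₂ : Space N → ℝ} {v₁ v₂ g₁ g₂ : Space N → Space N}
    (hg₁ : MemLp g₁ 2 (volume.restrict Ω)) (hg₂ : MemLp g₂ 2 (volume.restrict Ω))
    (hs₁ : IsSolutionPair Ω p q μ (fun x => ρ x + inner ℝ (B x) (g₁ x)) u₁ v₁)
    (hs₂ : IsSolutionPair Ω p q μ (fun x => ρ x + inner ℝ (B x) (g₂ x)) u₂ v₂) :
    ∫ x in Ω, ‖v₁ x - v₂ x‖ ^ 2 ≤ κ / (2 - κ) * ∫ x in Ω, ‖g₁ x - g₂ x‖ ^ 2 := by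
  have hΦ := hs.integrand
  have hΩ := hs.volume_lt_top
  have hlam := hs.firstEigenvalue_pos
  set lam := firstEigenvalue 2 Ω with hlam_def
  set θ := lam ^ (-(1 / 2) : ℝ) with hθ
  have hθ0 : 0 < θ := Real.rpow_pos_of_pos hlam _
  have hθ2 : θ ^ 2 * lam = 1 := by
    rw [hθ, ← Real.rpow_natCast, ← Real.rpow_mul hlam.le]
    norm_num
    rw [Real.rpow_neg_one, inv_mul_cancel₀ hlam.ne']
  obtain ⟨h₁, hi₁, he₁⟩ := hs₁
  obtain ⟨h₂, hi₂, he₂⟩ := hs₂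
  have hd := h₁.sub h₂ hΦ
  have hdm := (hd.modular_lt_top hΦ hΩ).2
  have hd2 := hd.memLp_grad hΦ hΩ
  have hdu := hd.memLp hΦ hΩ
  have hgd : MemLp (fun x => g₁ x - g₂ x) 2 (volume.restrict Ω) := hg₁.sub hg₂
  have i1 := (hs.integrable_inner_field h₁.aesm_grad hd.aesm_grad
    (h₁.modular_lt_top hΦ hΩ).2 hdm).2
  have i2 := (hs.integrable_inner_field h₂.aesm_grad hd.aesm_grad
    (h₂.modular_lt_top hΦ hΩ).2 hdm).2
  have j1 := hgd.integrable_norm_pow two_ne_zero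
  have j2 := hdu.integrable_norm_pow two_ne_zero
  have k1 : ∫ x in Ω, ‖v₁ x - v₂ x‖ ^ 2 ≤
      ∫ x in Ω, (inner ℝ (doublePhaseField p q μ x (v₁ x)) (v₁ x - v₂ x) -
        inner ℝ (doublePhaseField p q μ x (v₂ x)) (v₁ x - v₂ x)) := by
    refine integral_mono_ae (hd2.integrable_norm_pow two_ne_zero) (i1.sub i2) ?_
    filter_upwards [hs.field_strongly_mono] with x hx
    have := hx (v₁ x) (v₂ x)
    rwa [inner_sub_left] at this
  rw [integral_sub i1 i2, he₁ _ _ hd, he₂ _ _ hd, ← integral_sub (hi₁ _ _ hd) (hi₂ _ _ hd)] at k1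
  have k2 : ∫ x in Ω, ((ρ x + inner ℝ (B x) (g₁ x)) * (u₁ x - u₂ x) -
      (ρ x + inner ℝ (B x) (g₂ x)) * (u₁ x - u₂ x)) ≤
      ∫ x in Ω, (c₂ / 2 * θ * ‖g₁ x - g₂ x‖ ^ 2 + c₂ / 2 * θ⁻¹ * ‖u₁ x - u₂ x‖ ^ 2) := by
    refine integral_mono_ae ((hi₁ _ _ hd).sub (hi₂ _ _ hd))
      ((j1.const_mul _).add (j2.const_mul _)) ?_
    filter_upwards [hB] with x hx
    have e1 : (ρ x + inner ℝ (B x) (g₁ x)) * (u₁ x - u₂ x) -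
        (ρ x + inner ℝ (B x) (g₂ x)) * (u₁ x - u₂ x) =
        inner ℝ (B x) (g₁ x - g₂ x) * (u₁ x - u₂ x) := by
      rw [inner_sub_right]
      ring
    rw [e1]
    refine (le_abs_self _).trans ?_
    rw [abs_mul, ← Real.norm_eq_abs (u₁ x - u₂ x)]
    refine (mul_le_mul_of_nonneg_right (hx _) (norm_nonneg _)).trans ?_
    set a := ‖g₁ x - g₂ x‖
    set b := ‖u₁ x - u₂ x‖
    have e2 : 0 ≤ c₂ / 2 * θ * (a - θ⁻¹ * b) ^ 2 := by positivity
    have e3 : c₂ / 2 * θ * (a - θ⁻¹ * b) ^ 2 =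
        c₂ / 2 * θ * a ^ 2 + c₂ / 2 * θ⁻¹ * b ^ 2 - c₂ * a * b := by
      field_simp
      ring
    linarith
  rw [integral_add (j1.const_mul _) (j2.const_mul _), integral_const_mul, integral_const_mul] at k2
  have k3 := hs.firstEigenvalue_mul_le (hd.powerFn_two hΦ)
  rw [← hlam_def] at k3
  have k4 : c₂ / 2 * θ⁻¹ * ∫ x in Ω, ‖u₁ x - u₂ x‖ ^ 2 ≤
      κ / 2 * ∫ x in Ω, ‖v₁ x - v₂ x‖ ^ 2 := by
    have e4 : c₂ / 2 * θ⁻¹ = κ / 2 * lam := by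
      rw [hκ]
      field_simp
      rw [mul_assoc, hθ2, mul_one]
    have hκ0 : 0 ≤ κ := by rw [hκ]; positivity
    rw [e4, mul_assoc]
    gcongr
  have e5 : c₂ / 2 * θ = κ / 2 := by rw [hκ]; ring
  rw [e5] at k2
  rw [div_mul_eq_mul_div, le_div_iff₀ (by linarith)]
  linarith

end IsQuadraticSetting

/-! ### The structure of the right-hand side -/

section RightHandSide

/-- A family of linear forms satisfying a one-sided Lipschitz condition in the parameter is constant:
the condition is quadratic in the parameter, but linear in the argument, which can be scaled. -/
lemma eq_of_isLinearMap_of_oneSidedLipschitz {E : Type*} [AddCommGroup E] [Module ℝ E] {c : ℝ}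
    {L : ℝ → E → ℝ} (hlin : ∀ s, IsLinearMap ℝ (L s))
    (h : ∀ s t ξ, (L s ξ - L t ξ) * (s - t) ≤ c * |s - t| ^ 2) (s t : ℝ) (ξ : E) :
    L s ξ = L t ξ := by
  by_contra hne
  have hst : s ≠ t := fun e => hne (by rw [e])
  have hd : (L s ξ - L t ξ) * (s - t) ≠ 0 := mul_ne_zero (sub_ne_zero.2 hne) (sub_ne_zero.2 hst)
  have h1 := h s t (((c * |s - t| ^ 2 + 1) / ((L s ξ - L t ξ) * (s - t))) • ξ)
  rw [(hlin s).map_smul, (hlin t).map_smul, ← smul_sub, smul_eq_mul, mul_assoc,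
    div_mul_cancel₀ _ hd] at h1
  linarith

variable {N : ℕ} {Ω : Set (Space N)}

lemma isLinearMap_eq_inner {L : Space N → ℝ} (hL : IsLinearMap ℝ L) (ξ : Space N) :
    L ξ = inner ℝ (∑ i, L (EuclideanSpace.single i 1) • EuclideanSpace.single i (1 : ℝ)) ξ := by
  have h1 := (EuclideanSpace.basisFun (Fin N) ℝ).sum_repr ξ
  simp only [EuclideanSpace.basisFun_repr, EuclideanSpace.basisFun_apply] at h1
  have h2 : L ξ = ∑ i, ξ i * L (EuclideanSpace.single i 1) := by
    conv_lhs => rw [← h1]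
    have := map_sum (hL.mk' L) (fun i => ξ i • EuclideanSpace.single i (1 : ℝ)) Finset.univ
    simp only [IsLinearMap.mk'_apply, hL.map_smul, smul_eq_mul] at this
    exact this
  rw [h2, sum_inner]
  refine Finset.sum_congr rfl fun i _ => ?_
  rw [real_inner_smul_left, EuclideanSpace.inner_single_left]
  simp [mul_comm]

/-- Under (U1) and (U2) the right-hand side is `f(x, s, ξ) = ρ(x) + ⟪B(x), ξ⟫` with `|B| ≤ c₂`; in
particular it does not depend on `s`. -/
lemma exists_rightHandSide_eq {p : Space N → ℝ} {f : Space N → ℝ → Space N → ℝ} {c₁ c₂ : ℝ}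
    (hf : IsCaratheodory Ω f) (hU1 : HypU1 Ω f c₁) (hU2 : HypU2 Ω p f c₁ c₂) :
    ∃ (r ρ : Space N → ℝ) (B : Space N → Space N), MemCPlus Ω r ∧
      (∀ x ∈ closure Ω, r x < criticalExponent p x) ∧
      MemL Ω (powerFn fun x => r x / (r x - 1)) ρ ∧
      AEStronglyMeasurable B (volume.restrict Ω) ∧
      (∀ᵐ x ∂volume.restrict Ω, ∀ ξ, |inner ℝ (B x) ξ| ≤ c₂ * ‖ξ‖) ∧
      ∀ᵐ x ∂volume.restrict Ω, ∀ s ξ, f x s ξ = ρ x + inner ℝ (B x) ξ := by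
  obtain ⟨⟨r, ρ, hr, hrc, hρ, hlin, hbd⟩, -, -⟩ := hU2
  let B : Space N → Space N := fun x =>
    ∑ i, (f x 0 (EuclideanSpace.single i 1) - ρ x) • EuclideanSpace.single i (1 : ℝ)
  have hfB : ∀ᵐ x ∂volume.restrict Ω, ∀ s ξ, f x s ξ - ρ x = inner ℝ (B x) ξ := by
    filter_upwards [hlin, hU1.2] with x hx h1 s ξ
    rw [← isLinearMap_eq_inner (hx 0) ξ]
    refine eq_of_isLinearMap_of_oneSidedLipschitz (c := c₁) hx (fun s t ξ => ?_) s 0 ξ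
    simpa using h1 s t ξ
  refine ⟨r, ρ, B, hr, hrc, hρ, ?_, ?_, ?_⟩
  · exact Finset.aestronglyMeasurable_fun_sum _ fun i _ =>
      ((hf.1 0 _).sub hρ.1).smul aestronglyMeasurable_const
  · filter_upwards [hfB, hbd] with x h1 h2 ξ
    rw [← h1 0 ξ]
    exact h2 0 ξ
  · filter_upwards [hfB] with x h1 s ξ
    rw [← h1 s ξ]
    ring

end RightHandSide

lemma HypH.isQuadraticSetting {N : ℕ} {Ω : Set (Space N)} {p q μ : Space N → ℝ}
    (hH : HypH Ω p q μ) (hp : ∀ x ∈ closure Ω, p x = 2) :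
    ∃ M, IsQuadraticSetting Ω p q μ M := by
  have hne := hH.domain.isConnected.nonempty
  have hm := hH.domain.isOpen.measurableSet
  have hN : 3 ≤ N := by
    obtain ⟨x, hx⟩ := hne
    have := hH.p_lt_dim x (subset_closure hx)
    rw [hp x (subset_closure hx)] at this
    exact_mod_cast this
  refine ⟨(eLpNormEssSup μ (volume.restrict Ω)).toReal, hN, hH.domain.isOpen, hne,
    hH.domain.isBounded.measure_lt_top, ?_, hH.weight_bounded.1.aemeasurable,
    (hH.q_mem.1.mono subset_closure).aemeasurable hm, ?_, ?_, ENNReal.toReal_nonneg⟩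
  · exact ae_restrict_of_forall_mem hm fun x hx => hp x (subset_closure hx)
  · have hb := hH.weight_bounded.2
    rw [eLpNorm_exponent_top] at hb
    filter_upwards [hH.weight_nonneg, enorm_ae_le_eLpNormEssSup μ (volume.restrict Ω)]
      with x h0 h1
    refine ⟨h0, ?_⟩
    rw [← ofReal_norm, ENNReal.ofReal_le_iff_le_toReal hb.ne] at h1
    exact (le_abs_self _).trans h1
  · refine ae_restrict_of_forall_mem hm fun x hx => ?_
    have hx' := subset_closure hx
    have h1 := hH.p_lt_q x hx'
    have h2 := hH.q_lt_critical x hx'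
    rw [criticalExponent, hp x hx'] at h2
    rw [hp x hx'] at h1
    refine ⟨h1.le, h2.le.trans (le_of_eq ?_)⟩
    rw [sobolevExponent, mul_comm]

/-! ### Existence and uniqueness -/

namespace IsQuadraticSetting

variable {N : ℕ} {Ω : Set (Space N)} {p q μ : Space N → ℝ} {M : ℝ}
  (hs : IsQuadraticSetting Ω p q μ M)
include hs

/-- Banach's fixed point theorem, applied on `L²(Ω; ℝ^N)` to the map `g ↦ ∇u_g` where `u_g` solves
the problem with right-hand side `ρ + ⟪B, g⟫`. -/
lemma exists_isSolutionPair {r ρ : Space N → ℝ} {B : Space N → Space N} {c₂ : ℝ}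
    (hr : ∀ᵐ x ∂volume.restrict Ω, 1 < r x ∧ r x ≤ sobolevExponent N)
    (hρ : MemL Ω (powerFn fun x => r x / (r x - 1)) ρ)
    (hBm : AEStronglyMeasurable B (volume.restrict Ω)) (hc₂ : 0 ≤ c₂)
    (hκ : c₂ * firstEigenvalue 2 Ω ^ (-(1 / 2) : ℝ) < 1)
    (hB : ∀ᵐ x ∂volume.restrict Ω, ∀ ξ, |inner ℝ (B x) ξ| ≤ c₂ * ‖ξ‖) :
    ∃ u v, IsSolutionPair Ω p q μ (fun x => ρ x + inner ℝ (B x) (v x)) u v := by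
  have hΦ := hs.integrand
  have hΩ := hs.volume_lt_top
  have hsol : ∀ g : Lp (Space N) 2 (volume.restrict Ω), ∃ u v,
      IsSolutionPair Ω p q μ (fun x => ρ x + inner ℝ (B x) (g x)) u v := fun g => by
    have hk : MemLp (fun x => inner ℝ (B x) (g x)) 2 (volume.restrict Ω) := by
      refine (Lp.memLp g).of_le_mul (c := c₂) (hBm.inner (Lp.aestronglyMeasurable g)) ?_
      filter_upwards [hB] with x hx using hx _
    obtain ⟨c, hc⟩ := exists_hasDualBound hs.three_le hΩ hr hρ hk
    exact hs.exists_weak_solution_of_dualBound hc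
  choose U V hUV using hsol
  have hV2 := fun g => (hUV g).isLimitPair.memLp_grad hΦ hΩ
  set κ := c₂ * firstEigenvalue 2 Ω ^ (-(1 / 2) : ℝ) with hκ_def
  have hκ0 : 0 ≤ κ := mul_nonneg hc₂ (Real.rpow_nonneg hs.firstEigenvalue_pos.le _)
  have hK0 : 0 ≤ κ / (2 - κ) := div_nonneg hκ0 (by linarith)
  let T : Lp (Space N) 2 (volume.restrict Ω) → Lp (Space N) 2 (volume.restrict Ω) :=
    fun g => (hV2 g).toLp
  have hT : ContractingWith (Real.sqrt (κ / (2 - κ))).toNNReal T := by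
    refine ⟨?_, LipschitzWith.of_dist_le_mul fun g₁ g₂ => ?_⟩
    · rw [Real.toNNReal_lt_one, Real.sqrt_lt' one_pos, one_pow, div_lt_one (by linarith)]
      linarith
    · have h1 := hs.integral_grad_sub_sq_le hκ_def hκ hc₂ hB (Lp.memLp g₁) (Lp.memLp g₂)
        (hUV g₁) (hUV g₂)
      rw [Real.coe_toNNReal _ (Real.sqrt_nonneg _), dist_eq_norm, dist_eq_norm]
      refine abs_le_of_sq_le_sq' ?_ (by positivity) |>.2
      have e1 : ‖T g₁ - T g₂‖ ^ 2 = ∫ x in Ω, ‖V g₁ x - V g₂ x‖ ^ 2 :=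
        norm_toLp_sq ((hV2 g₁).sub (hV2 g₂))
      have e2 : ‖g₁ - g₂‖ ^ 2 = ∫ x in Ω, ‖g₁ x - g₂ x‖ ^ 2 := by
        have := norm_toLp_sq ((Lp.memLp g₁).sub (Lp.memLp g₂))
        rwa [MemLp.toLp_sub (Lp.memLp g₁) (Lp.memLp g₂), Lp.toLp_coeFn, Lp.toLp_coeFn] at this
      rw [mul_pow, Real.sq_sqrt hK0, e1, e2]
      exact h1
  have hfix : T hT.fixedPoint = hT.fixedPoint := hT.fixedPoint_isFixedPt
  set g := hT.fixedPoint
  have hg : (g : Space N → Space N) =ᵐ[volume.restrict Ω] V g := by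
    have := (hV2 g).coeFn_toLp
    rw [show (hV2 g).toLp = g from hfix] at this
    exact this
  have hcongr : ∀ φ : Space N → ℝ, (fun x => (ρ x + inner ℝ (B x) (g x)) * φ x)
      =ᵐ[volume.restrict Ω] fun x => (ρ x + inner ℝ (B x) (V g x)) * φ x := fun φ => by
    filter_upwards [hg] with x hx
    rw [hx]
  refine ⟨U g, V g, (hUV g).isLimitPair, fun φ ψ hφ => ?_, fun φ ψ hφ => ?_⟩
  · exact ((hUV g).integrable φ ψ hφ).congr (hcongr φ)
  · rw [(hUV g).integral_eq φ ψ hφ]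
    exact integral_congr_ae (hcongr φ)

variable {f : Space N → ℝ → Space N → ℝ} {ρ u u' : Space N → ℝ} {B v : Space N → Space N}

lemma isWeakSolution_of_isSolutionPair
    (hf : ∀ᵐ x ∂volume.restrict Ω, ∀ s ξ, f x s ξ = ρ x + inner ℝ (B x) ξ)
    (h : IsSolutionPair Ω p q μ (fun x => ρ x + inner ℝ (B x) (v x)) u v)
    (hu : u =ᵐ[volume.restrict Ω] u') : IsWeakSolution Ω p q μ f u' := by
  have hΦ := hs.integrand
  have hΩ := hs.volume_lt_top
  have hp := h.isLimitPair.congr hu (ae_eq_refl v)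
  have hg := hp.weakGrad_ae_eq hΦ hs.isOpen hΩ
  refine ⟨hp.memWZero hΦ hs.isOpen hΩ, fun φ hφ => ?_⟩
  have hφp := hφ.isLimitPair hΦ
  have e1 : (fun x => inner ℝ (doublePhaseField p q μ x (v x)) (weakGrad Ω φ x))
      =ᵐ[volume.restrict Ω]
      fun x => inner ℝ (doublePhaseField p q μ x (weakGrad Ω u' x)) (weakGrad Ω φ x) := by
    filter_upwards [hg] with x hx
    rw [hx]
  have e2 : (fun x => (ρ x + inner ℝ (B x) (v x)) * φ x) =ᵐ[volume.restrict Ω]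
      fun x => f x (u' x) (weakGrad Ω u' x) * φ x := by
    filter_upwards [hg, hf] with x hx h1
    rw [h1, hx]
  refine ⟨?_, (h.integrable _ _ hφp).congr e2, ?_⟩
  · exact (hs.integrable_inner_field hp.aesm_grad hφp.aesm_grad (hp.modular_lt_top hΦ hΩ).2
      (hφp.modular_lt_top hΦ hΩ).2).2.congr e1
  · rw [← integral_congr_ae e1, ← integral_congr_ae e2]
    exact h.integral_eq _ _ hφp

lemma isSolutionPair_of_isWeakSolution
    (hf : ∀ᵐ x ∂volume.restrict Ω, ∀ s ξ, f x s ξ = ρ x + inner ℝ (B x) ξ)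
    (h : IsWeakSolution Ω p q μ f u) :
    IsSolutionPair Ω p q μ (fun x => ρ x + inner ℝ (B x) (weakGrad Ω u x)) u
      (weakGrad Ω u) := by
  have hΦ := hs.integrand
  have hΩ := hs.volume_lt_top
  have e2 : ∀ φ : Space N → ℝ, (fun x => f x (u x) (weakGrad Ω u x) * φ x)
      =ᵐ[volume.restrict Ω] fun x => (ρ x + inner ℝ (B x) (weakGrad Ω u x)) * φ x := fun φ => by
    filter_upwards [hf] with x h1
    rw [h1]
  refine ⟨h.1.isLimitPair hΦ, fun φ ψ hφ => ?_, fun φ ψ hφ => ?_⟩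
  · exact (h.2 φ (hφ.memWZero hΦ hs.isOpen hΩ)).2.1.congr (e2 φ)
  · rw [← integral_congr_ae (e2 φ), ← (h.2 φ (hφ.memWZero hΦ hs.isOpen hΩ)).2.2]
    refine integral_congr_ae ?_
    filter_upwards [hφ.weakGrad_ae_eq hΦ hs.isOpen hΩ] with x hx
    rw [hx]

lemma isSolutionPair_unique {c₂ : ℝ} {u₁ u₂ : Space N → ℝ} {v₁ v₂ : Space N → Space N}
    (hc₂ : 0 ≤ c₂) (hκ : c₂ * firstEigenvalue 2 Ω ^ (-(1 / 2) : ℝ) < 1)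
    (hB : ∀ᵐ x ∂volume.restrict Ω, ∀ ξ, |inner ℝ (B x) ξ| ≤ c₂ * ‖ξ‖)
    (h₁ : IsSolutionPair Ω p q μ (fun x => ρ x + inner ℝ (B x) (v₁ x)) u₁ v₁)
    (h₂ : IsSolutionPair Ω p q μ (fun x => ρ x + inner ℝ (B x) (v₂ x)) u₂ v₂) :
    u₁ =ᵐ[volume.restrict Ω] u₂ := by
  have hΦ := hs.integrand
  have hΩ := hs.volume_lt_top
  have h := hs.integral_grad_sub_sq_le rfl hκ hc₂ hB (h₁.isLimitPair.memLp_grad hΦ hΩ)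
    (h₂.isLimitPair.memLp_grad hΦ hΩ) h₁ h₂
  have hd := h₁.isLimitPair.sub h₂.isLimitPair hΦ
  have h0 : 0 ≤ ∫ x in Ω, ‖v₁ x - v₂ x‖ ^ 2 := integral_nonneg fun x => by positivity
  have hK1 : c₂ * firstEigenvalue 2 Ω ^ (-(1 / 2) : ℝ) /
      (2 - c₂ * firstEigenvalue 2 Ω ^ (-(1 / 2) : ℝ)) < 1 := by
    rw [div_lt_one (by linarith)]
    linarith
  have hv : ∫ x in Ω, ‖v₁ x - v₂ x‖ ^ 2 = 0 := by
    refine le_antisymm ?_ h0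
    by_contra hc
    nlinarith
  have hP := hs.firstEigenvalue_mul_le (hd.powerFn_two hΦ)
  rw [hv] at hP
  have hu : ∫ x in Ω, ‖u₁ x - u₂ x‖ ^ 2 = 0 := by
    refine le_antisymm ?_ (integral_nonneg fun x => by positivity)
    exact nonpos_of_mul_nonpos_right hP hs.firstEigenvalue_pos
  rw [integral_eq_zero_iff_of_nonneg (fun x => by positivity)
    ((hd.memLp hΦ hΩ).integrable_norm_pow two_ne_zero)] at hu
  filter_upwards [hu] with x hx
  simpa [sub_eq_zero] using hx

end IsQuadraticSetting

end DoublePhase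
end

/-- Functions on `Ω` are identified when they agree almost everywhere on `Ω`, so `u` ranges over
the almost-everywhere classes of measurable functions. -/
theorem mainTheorem2 (N : ℕ) (Ω : Set (DoublePhase.Space N))
    (p q μ : DoublePhase.Space N → ℝ)
    (f : DoublePhase.Space N → ℝ → DoublePhase.Space N → ℝ) (c₁ c₂ : ℝ)
    (hH : DoublePhase.HypH Ω p q μ) (hf : DoublePhase.HypF Ω p f)
    (hU1 : DoublePhase.HypU1 Ω f c₁) (hU2 : DoublePhase.HypU2 Ω p f c₁ c₂)
    (hp : ∀ x ∈ closure Ω, p x = 2) :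
    ∃! u : DoublePhase.Space N →ₘ[volume.restrict Ω] ℝ,
      DoublePhase.IsWeakSolution Ω p q μ f u := by
  obtain ⟨M, hs⟩ := hH.isQuadraticSetting hp
  obtain ⟨r, ρ, B, hr, hrc, hρ, hBm, hB, hfB⟩ :=
    DoublePhase.exists_rightHandSide_eq hf.caratheodory hU1 hU2
  have hr' : ∀ᵐ x ∂volume.restrict Ω, 1 < r x ∧ r x ≤ DoublePhase.sobolevExponent N := by
    refine ae_restrict_of_forall_mem hs.isOpen.measurableSet fun x hx => ?_
    have hx' := subset_closure hx
    have h1 := hrc x hx'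
    rw [DoublePhase.criticalExponent, hp x hx', mul_comm] at h1
    exact ⟨hr.2 x hx', h1.le⟩
  have hκ : c₂ * DoublePhase.firstEigenvalue 2 Ω ^ (-(1 / 2) : ℝ) < 1 := by
    have h1 := mul_nonneg hU1.1 (inv_nonneg.2 hs.firstEigenvalue_pos.le)
    linarith [hU2.2.2]
  obtain ⟨u, v, huv⟩ := hs.exists_isSolutionPair hr' hρ hBm hU2.2.1 hκ hB
  refine ⟨AEEqFun.mk u huv.isLimitPair.aesm, ?_, fun w hw => ?_⟩
  · exact hs.isWeakSolution_of_isSolutionPair hfB huv (AEEqFun.coeFn_mk _ _).symm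
  · rw [← AEEqFun.mk_coeFn w, AEEqFun.mk_eq_mk]
    exact hs.isSolutionPair_unique hU2.2.1 hκ hB (hs.isSolutionPair_of_isWeakSolution hfB hw) huv
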